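/- Let $\alpha,\beta,\mu\in\mathbb R$ with $0\le\alpha<2$ and $\mu<\mu(\alpha+\beta)$, where $\mu(\delta):=\frac{(1-\delta)^2}{4}$. Let $L^2_\beta(0,1)=L^2((0,1);x^\beta dx)$ (real valued), with inner product $\langle f,g\rangle_\beta=\int_0^1 fg\,x^\beta dx$, and $$\mathcal A u:=-(x^\alpha u_x)_x-\beta x^{\alpha-1}u_x-\frac{\mu}{x^{2-\alpha}}u ,$$ $$\mathcal A^2u:=x^{2\alpha}u_{xxxx}+\rho_1x^{2\alpha-1}u_{xxx}+\rho_2x^{2\alpha-2}u_{xx}+\rho_3x^{2\alpha-3}u_x+\frac{\rho_4}{x^{4-2\alpha}}u ,$$ with derivatives in the weak sense, $\rho_1=4\alpha+2\beta$, $\rho_2=(2\alpha+\beta)(2\alpha+\beta-1)+(\alpha+\beta)(\alpha-1)+2\mu$, $\rho_3=[(\alpha+\beta)(\alpha-1)+2\mu](2\alpha+\beta-2)$, $\rho_4=\mu[(\alpha-2)(2\alpha+\beta-3)+\mu]$. Let $$H^1_{\alpha,\beta}=\{u\in L^2_\beta(0,1)\cap H^1_{loc}(0,1): x^{\alpha/2}u_x\in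 L^2_\beta(0,1)\},$$ $$H^1_{\alpha,\beta,0}=\{u\in H^1_{\alpha,\beta}:u(0)=u(1)=0\},\qquad H^1_{\alpha,\beta,N}=\{u\in H^1_{\alpha,\beta}:u(1)=0\},$$ where the values at $0$ and $1$ are limits of the continuous representative on $(0,1)$, and for $*\in\{0,N\}$ let $$D_*(\mathcal A)=\{u\in H^1_{\alpha,\beta,*}\cap H^2_{loc}(0,1):\mathcal A u\in L^2_\beta(0,1)\},\qquad D_*(\mathcal A^2)=\{u\in D_*(\mathcal A):\mathcal A u\in D_*(\mathcal A)\}.$$ Put $\kappa_\alpha=\frac{2-\alpha}{2}$, $\nu=\sqrt{\mu(\alpha+\beta)-\mu}/\kappa_\alpha$, let $J_\nu(x)=\sum_{m\ge0}\frac{(-1)^m}{m!\,\Gamma(m+\nu+1)}\left(\frac x2\right)^{2m+\nu}$ be the Bessel function of the first kind, let $0<j_{\nu,1}<j_{\nu,2}<\dots$ be its positive zeros (they form an infinite increasing sequence $(j_{\nu,k})_{k\ge1}$), and $$\Phi_k(x)=\frac{(2\kappa_\alpha)^{1/2}}{|J_\nu'(j_{\nu,k})|}\,x^{(1-\alpha-\beta)/2}J_\nu\!\left(j_{\nu,k}x^{\kappa_\alpha}\right),\qquad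 k\ge1.$$ 1. Suppose $\alpha+\beta<1$. Then $$D_0(\mathcal A^2)=\{u\in H^1_{\alpha,\beta,0}\cap H^4_{loc}(0,1):[\mathcal A u](0)=[(x^{\alpha+\beta}u_x)_x](1)=0,\ \mathcal A u,\ x^{\alpha/2}(\mathcal A u)_x,\ \mathcal A^2u\in L^2_\beta(0,1)\},$$ $\mathcal A(\mathcal A u)=\mathcal A^2u$ for $u\in D_0(\mathcal A^2)$, the set $D_0(\mathcal A^2)$ is dense in $L^2_\beta(0,1)$, and $-\mathcal A^2:D_0(\mathcal A^2)\subset L^2_\beta(0,1)\to L^2_\beta(0,1)$ is self-adjoint and negative, i.e. $\langle-\mathcal A^2u,u\rangle_\beta<0$ for every $0\ne u\in D_0(\mathcal A^2)$. Furthermore $(\Phi_k)_{k\ge1}$ is an orthonormal basis of $L^2_\beta(0,1)$ with $\Phi_k\in D_0(\mathcal A^2)$ and $$\mathcal A^2\Phi_k=\kappa_\alpha^4 j_{\nu,k}^4\,\Phi_k,\qquad k\ge1.$$ 2. Suppose $\alpha+\beta>1$. Then $$D_N(\mathcal A^2)=\{u\in H^1_{\alpha,\beta,N}\cap H^4_{loc}(0,1):\mathcal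 A u\in H^1_{\alpha,\beta,N},\ \mathcal A u,\ \mathcal A^2u\in L^2_\beta(0,1)\},$$ $\mathcal A(\mathcal A u)=\mathcal A^2u$ for $u\in D_N(\mathcal A^2)$, the set $D_N(\mathcal A^2)$ is dense in $L^2_\beta(0,1)$, $-\mathcal A^2:D_N(\mathcal A^2)\subset L^2_\beta(0,1)\to L^2_\beta(0,1)$ is self-adjoint and negative in the same sense, and $(\Phi_k)_{k\ge1}$ is an orthonormal basis of $L^2_\beta(0,1)$ with $\Phi_k\in D_N(\mathcal A^2)$ and $\mathcal A^2\Phi_k=\kappa_\alpha^4 j_{\nu,k}^4\,\Phi_k$ for $k\ge1$. -/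

import Mathlib

open MeasureTheory Set Filter Topology
open scoped ContDiff

noncomputable section

namespace DegenerateBessel

/-! ### Weak derivatives and local Sobolev spaces on `(0,1)` -/

/-- `g` is a weak derivative of `f` on `(0,1)`: both are locally integrable on `(0,1)` and
`∫ f φ' = - ∫ g φ` for every smooth `φ` with compact support inside `(0,1)`. -/
structure IsWeakDeriv (f g : ℝ → ℝ) : Prop where
  left : LocallyIntegrableOn f (Ioo 0 1)
  right : LocallyIntegrableOn g (Ioo 0 1)
  integral_eq : ∀ φ : ℝ → ℝ, ContDiff ℝ ∞ φ → HasCompactSupport φ → tsupport φ ⊆ Ioo 0 1 →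
    ∫ x, f x * deriv φ x = - ∫ x, g x * φ x

open Classical in
/-- The weak derivative on `(0,1)` (determined almost everywhere on `(0,1)` when it exists,
and `0` by convention otherwise). -/
def weakDeriv (f : ℝ → ℝ) : ℝ → ℝ :=
  if h : ∃ g, IsWeakDeriv f g then h.choose else 0

/-- `f ∈ L²_loc(0,1)`. -/
def MemL2loc (f : ℝ → ℝ) : Prop :=
  ∀ K ⊆ Ioo (0 : ℝ) 1, IsCompact K → MemLp f 2 (volume.restrict K)

/-- `f ∈ H^k_loc(0,1)`: `f` and its weak derivatives up to order `k` exist and lie in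
`L²_loc(0,1)`. -/
def MemHloc : ℕ → (ℝ → ℝ) → Prop
  | 0, f => MemL2loc f
  | k + 1, f => MemL2loc f ∧ ∃ g, IsWeakDeriv f g ∧ MemHloc k g

/-- The continuous representative of `f` on `(0,1)` exists and tends to `L` along `l`
(used with `l = 𝓝[>] 0` and `l = 𝓝[<] 1`, i.e. for the boundary values `f(0)` and `f(1)`). -/
def HasBoundaryValue (f : ℝ → ℝ) (l : Filter ℝ) (L : ℝ) : Prop :=
  ∃ c : ℝ → ℝ, ContinuousOn c (Ioo 0 1) ∧ f =ᵐ[volume.restrict (Ioo 0 1)] c ∧ Tendsto c l (𝓝 L)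

/-! ### Weighted spaces -/

/-- The measure `x^β dx` on `(0,1)`. -/
def wMeasure (β : ℝ) : Measure ℝ :=
  (volume.restrict (Ioo 0 1)).withDensity fun x => ENNReal.ofReal (x ^ β)

/-- The Hilbert space `L²_β(0,1) = L²((0,1); x^β dx)` of real functions. -/
abbrev L2w (β : ℝ) := Lp ℝ 2 (wMeasure β)

/-- `f ∈ H¹_{α,β}(0,1)`. -/
def MemH1 (α β : ℝ) (f : ℝ → ℝ) : Prop :=
  MemLp f 2 (wMeasure β) ∧ MemHloc 1 f ∧
    MemLp (fun x => x ^ (α / 2) * weakDeriv f x) 2 (wMeasure β)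

/-- `f ∈ H¹_{α,β,0}(0,1)`: `f ∈ H¹_{α,β}(0,1)` and `f(0) = f(1) = 0`. -/
def MemH1D (α β : ℝ) (f : ℝ → ℝ) : Prop :=
  MemH1 α β f ∧ HasBoundaryValue f (𝓝[>] 0) 0 ∧ HasBoundaryValue f (𝓝[<] 1) 0

/-- `f ∈ H¹_{α,β,N}(0,1)`: `f ∈ H¹_{α,β}(0,1)` and `f(1) = 0`. -/
def MemH1N (α β : ℝ) (f : ℝ → ℝ) : Prop :=
  MemH1 α β f ∧ HasBoundaryValue f (𝓝[<] 1) 0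

/-! ### The differential expressions -/

/-- `𝒜 u = -(x^α u_x)_x - β x^{α-1} u_x - μ x^{-(2-α)} u`, with weak derivatives. -/
def exprA (α β μ : ℝ) (u : ℝ → ℝ) : ℝ → ℝ := fun x =>
  -weakDeriv (fun y => y ^ α * weakDeriv u y) x - β * x ^ (α - 1) * weakDeriv u x
    - μ / x ^ (2 - α) * u x

def rho₁ (α β : ℝ) : ℝ := 4 * α + 2 * β

def rho₂ (α β μ : ℝ) : ℝ :=
  (2 * α + β) * (2 * α + β - 1) + (α + β) * (α - 1) + 2 * μ

def rho₃ (α β μ : ℝ) : ℝ := ((α + β) * (α - 1) + 2 * μ) * (2 * α + β - 2)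

def rho₄ (α β μ : ℝ) : ℝ := μ * ((α - 2) * (2 * α + β - 3) + μ)

/-- The fourth order expression
`𝒜² u = x^{2α} u_xxxx + ρ₁ x^{2α-1} u_xxx + ρ₂ x^{2α-2} u_xx + ρ₃ x^{2α-3} u_x + ρ₄ x^{-(4-2α)} u`,
with weak derivatives. -/
def exprA2 (α β μ : ℝ) (u : ℝ → ℝ) : ℝ → ℝ := fun x =>
  x ^ (2 * α) * weakDeriv^[4] u x + rho₁ α β * x ^ (2 * α - 1) * weakDeriv^[3] u x
    + rho₂ α β μ * x ^ (2 * α - 2) * weakDeriv^[2] u x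
    + rho₃ α β μ * x ^ (2 * α - 3) * weakDeriv u x
    + rho₄ α β μ / x ^ (4 - 2 * α) * u x

/-! ### Helper facts: the weak derivative is well defined and linear -/

variable {f f' g g' : ℝ → ℝ}

lemma IsWeakDeriv.weakDeriv (h : IsWeakDeriv f g) : IsWeakDeriv f (weakDeriv f) := by
  have h' : ∃ g, IsWeakDeriv f g := ⟨g, h⟩
  simp only [DegenerateBessel.weakDeriv, dif_pos h']
  exact h'.choose_spec

lemma integrable_mul_test (hf : LocallyIntegrableOn f (Ioo 0 1)) {φ : ℝ → ℝ}
    (hφ : Continuous φ) (hc : HasCompactSupport φ) (hs : tsupport φ ⊆ Ioo 0 1) :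
    Integrable fun x => f x * φ x := by
  have h1 : IntegrableOn f (tsupport φ) := hf.integrableOn_compact_subset hs hc
  have h2 : IntegrableOn (fun x => f x * φ x) (tsupport φ) :=
    h1.mul_continuousOn hφ.continuousOn hc
  refine (integrableOn_iff_integrable_of_support_subset ?_).1 h2
  intro x hx
  refine subset_tsupport φ ?_
  intro h0
  exact hx (by simp [h0])

lemma tsupport_deriv_subset' {φ : ℝ → ℝ} : tsupport (deriv φ) ⊆ tsupport φ :=
  closure_minimal support_deriv_subset isClosed_closure

lemma IsWeakDeriv.unique (h : IsWeakDeriv f g) (h' : IsWeakDeriv f g') :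
    g =ᵐ[volume.restrict (Ioo 0 1)] g' := by
  have := IsOpen.ae_eq_zero_of_integral_contDiff_smul_eq_zero (isOpen_Ioo (a := (0 : ℝ)) (b := 1))
    (h.right.sub h'.right) (fun φ h1 h2 h3 => by
      have e := h.integral_eq φ h1 h2 h3
      rw [h'.integral_eq φ h1 h2 h3] at e
      have i1 := integrable_mul_test h.right h1.continuous h2 h3
      have i2 := integrable_mul_test h'.right h1.continuous h2 h3
      have : ∀ x, φ x • (g - g') x = g x * φ x - g' x * φ x := fun x => by
        simp; ring
      simp_rw [this]
      rw [integral_sub i1 i2]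
      linarith)
  rw [Filter.EventuallyEq, ae_restrict_iff' measurableSet_Ioo]
  filter_upwards [this] with x hx hm
  have := hx hm
  simpa [sub_eq_zero] using this

lemma locInt_congr (h : f =ᵐ[volume.restrict (Ioo 0 1)] f')
    (hf : LocallyIntegrableOn f (Ioo 0 1)) : LocallyIntegrableOn f' (Ioo 0 1) := by
  rw [locallyIntegrableOn_iff isOpen_Ioo.isLocallyClosed] at hf ⊢
  intro k hk hc
  exact (hf k hk hc).congr_fun_ae (ae_mono (Measure.restrict_mono hk le_rfl) h)

lemma integral_test_congr (h : f =ᵐ[volume.restrict (Ioo 0 1)] f') {φ : ℝ → ℝ}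
    (hs : tsupport φ ⊆ Ioo 0 1) : ∫ x, f x * φ x = ∫ x, f' x * φ x := by
  refine integral_congr_ae ?_
  rw [Filter.EventuallyEq, ae_restrict_iff' measurableSet_Ioo] at h
  filter_upwards [h] with x hx
  by_cases hm : x ∈ Ioo (0 : ℝ) 1
  · rw [hx hm]
  · rw [image_eq_zero_of_notMem_tsupport fun h => hm (hs h)]; simp

lemma IsWeakDeriv.congr (h : IsWeakDeriv f g) (hf : f =ᵐ[volume.restrict (Ioo 0 1)] f')
    (hg : g =ᵐ[volume.restrict (Ioo 0 1)] g') : IsWeakDeriv f' g' where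
  left := locInt_congr hf h.left
  right := locInt_congr hg h.right
  integral_eq φ h1 h2 h3 := by
    rw [← integral_test_congr hf (tsupport_deriv_subset'.trans h3), ← integral_test_congr hg h3]
    exact h.integral_eq φ h1 h2 h3

lemma IsWeakDeriv.add (h : IsWeakDeriv f g) (h' : IsWeakDeriv f' g') :
    IsWeakDeriv (f + f') (g + g') where
  left := h.left.add h'.left
  right := h.right.add h'.right
  integral_eq φ h1 h2 h3 := by
    have hd : Continuous (deriv φ) := h1.continuous_deriv (by simp)
    simp only [Pi.add_apply, add_mul]
    rw [integral_add (integrable_mul_test h.left hd h2.deriv (tsupport_deriv_subset'.trans h3))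
        (integrable_mul_test h'.left hd h2.deriv (tsupport_deriv_subset'.trans h3)),
      integral_add (integrable_mul_test h.right h1.continuous h2 h3)
        (integrable_mul_test h'.right h1.continuous h2 h3),
      h.integral_eq φ h1 h2 h3, h'.integral_eq φ h1 h2 h3]
    ring

lemma IsWeakDeriv.const_smul (h : IsWeakDeriv f g) (c : ℝ) : IsWeakDeriv (c • f) (c • g) where
  left := h.left.smul c
  right := h.right.smul c
  integral_eq φ h1 h2 h3 := by
    simp only [Pi.smul_apply, smul_eq_mul, mul_assoc]
    rw [integral_const_mul, integral_const_mul, h.integral_eq φ h1 h2 h3]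
    ring

lemma isWeakDeriv_zero : IsWeakDeriv 0 0 where
  left := locallyIntegrableOn_zero
  right := locallyIntegrableOn_zero
  integral_eq φ _ _ _ := by simp

lemma locInt_rpow_mul (a : ℝ) (hf : LocallyIntegrableOn f (Ioo 0 1)) :
    LocallyIntegrableOn (fun x => x ^ a * f x) (Ioo 0 1) := by
  rw [locallyIntegrableOn_iff isOpen_Ioo.isLocallyClosed] at hf ⊢
  intro k hk hc
  refine (hf k hk hc).continuousOn_mul ?_ hc
  exact fun x hx => (Real.continuousAt_rpow_const x a (Or.inl (hk hx).1.ne')).continuousWithinAt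

/-- Product rule with a power weight. -/
lemma IsWeakDeriv.rpow_mul (h : IsWeakDeriv f g) (a : ℝ) :
    IsWeakDeriv (fun x => x ^ a * f x) (fun x => x ^ a * g x + a * (x ^ (a - 1) * f x)) where
  left := locInt_rpow_mul a h.left
  right := (locInt_rpow_mul a h.right).add ((locInt_rpow_mul (a - 1) h.left).smul a)
  integral_eq φ h1 h2 h3 := by
    set ψ : ℝ → ℝ := fun x => x ^ a * φ x with hψ
    have hsub : tsupport ψ ⊆ tsupport φ := tsupport_mul_subset_right
    have hψc : ContDiff ℝ ∞ ψ := by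
      rw [contDiff_iff_contDiffAt]
      intro x
      by_cases hx : x ∈ tsupport φ
      · exact (Real.contDiffAt_rpow_const_of_ne (h3 hx).1.ne').mul h1.contDiffAt
      · have : ψ =ᶠ[𝓝 x] fun _ => 0 := by
          filter_upwards [notMem_tsupport_iff_eventuallyEq.1 hx] with y hy
          simp [hψ, hy]
        exact contDiffAt_const.congr_of_eventuallyEq this
    have hψs : HasCompactSupport ψ := h2.mul_left
    have e := h.integral_eq ψ hψc hψs (hsub.trans h3)
    have hd : Continuous (deriv φ) := h1.continuous_deriv (by simp)
    have i1 := integrable_mul_test (locInt_rpow_mul a h.left) hd h2.deriv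
      (tsupport_deriv_subset'.trans h3)
    have i2 := integrable_mul_test ((locInt_rpow_mul (a - 1) h.left).smul a) h1.continuous h2 h3
    have i3 := integrable_mul_test (locInt_rpow_mul a h.right) h1.continuous h2 h3
    have e1 : ∀ x, f x * deriv ψ x
        = x ^ a * f x * deriv φ x + (a • fun x => x ^ (a - 1) * f x) x * φ x := by
      intro x
      by_cases hx : x ∈ tsupport φ
      · have hx0 : x ≠ 0 := (h3 hx).1.ne'
        have : HasDerivAt ψ (a * x ^ (a - 1) * φ x + x ^ a * deriv φ x) x :=
          (Real.hasDerivAt_rpow_const (Or.inl hx0)).mul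
            ((h1.differentiable (by simp)) x).hasDerivAt
        rw [this.deriv]
        simp only [Pi.smul_apply, smul_eq_mul]
        ring
      · rw [image_eq_zero_of_notMem_tsupport hx,
          image_eq_zero_of_notMem_tsupport fun h => hx (tsupport_deriv_subset' h),
          image_eq_zero_of_notMem_tsupport fun h => hx (hsub (tsupport_deriv_subset' h))]
        simp
    have e2 : ∀ x, (x ^ a * g x + a * (x ^ (a - 1) * f x)) * φ x
        = x ^ a * g x * φ x + (a • fun x => x ^ (a - 1) * f x) x * φ x := by
      intro x
      simp only [Pi.smul_apply, smul_eq_mul]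
      ring
    have e3 : ∀ x, g x * ψ x = x ^ a * g x * φ x := fun x => by simp only [hψ]; ring
    simp_rw [e1, e3] at e
    simp_rw [e2]
    rw [integral_add i1 i2] at e
    rw [integral_add i3 i2]
    linarith

lemma ae_w_iff {β : ℝ} :
    f =ᵐ[wMeasure β] g ↔ f =ᵐ[volume.restrict (Ioo 0 1)] g := by
  constructor
  · intro h
    have hac : volume.restrict (Ioo (0 : ℝ) 1) ≪ wMeasure β := by
      refine withDensity_absolutelyContinuous' (by fun_prop) ?_
      filter_upwards [ae_restrict_mem measurableSet_Ioo] with x hx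
      simpa using Real.rpow_pos_of_pos hx.1 β
    exact hac.ae_eq h
  · exact fun h => (withDensity_absolutelyContinuous _ _).ae_eq h

lemma weakDeriv_congr (h : f =ᵐ[volume.restrict (Ioo 0 1)] f') : weakDeriv f = weakDeriv f' := by
  have : IsWeakDeriv f = IsWeakDeriv f' := by
    funext g
    exact propext ⟨fun H => H.congr h .rfl, fun H => H.congr h.symm .rfl⟩
  unfold weakDeriv
  rw [this]

lemma weakDeriv_add (h : ∃ g, IsWeakDeriv f g) (h' : ∃ g, IsWeakDeriv f' g) :
    weakDeriv (f + f') =ᵐ[volume.restrict (Ioo 0 1)] weakDeriv f + weakDeriv f' := by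
  obtain ⟨g, hg⟩ := h
  obtain ⟨g', hg'⟩ := h'
  have H := hg.weakDeriv.add hg'.weakDeriv
  exact H.weakDeriv.unique H

lemma weakDeriv_smul (c : ℝ) (h : ∃ g, IsWeakDeriv f g) :
    weakDeriv (c • f) =ᵐ[volume.restrict (Ioo 0 1)] c • weakDeriv f := by
  obtain ⟨g, hg⟩ := h
  have H := hg.weakDeriv.const_smul c
  exact H.weakDeriv.unique H

lemma MemL2loc.congr (h : f =ᵐ[volume.restrict (Ioo 0 1)] f') (hf : MemL2loc f) : MemL2loc f' :=
  fun K hK hc => (memLp_congr_ae (ae_mono (Measure.restrict_mono hK le_rfl) h)).1 (hf K hK hc)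

lemma MemHloc.congr {k : ℕ} (h : f =ᵐ[volume.restrict (Ioo 0 1)] f') (hf : MemHloc k f) :
    MemHloc k f' := by
  cases k with
  | zero => exact MemL2loc.congr h hf
  | succ k =>
    obtain ⟨h0, g, hg, hk⟩ := hf
    exact ⟨h0.congr h, g, hg.congr h .rfl, hk⟩

lemma MemHloc.add {k : ℕ} : ∀ {f f' : ℝ → ℝ}, MemHloc k f → MemHloc k f' →
    MemHloc k (f + f') := by
  induction k with
  | zero => exact fun hf hf' K hK hc => (hf K hK hc).add (hf' K hK hc)
  | succ k ih =>
    rintro f f' ⟨h0, g, hg, hk⟩ ⟨h0', g', hg', hk'⟩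
    exact ⟨fun K hK hc => (h0 K hK hc).add (h0' K hK hc), g + g', hg.add hg', ih hk hk'⟩

lemma MemHloc.const_smul {k : ℕ} (c : ℝ) : ∀ {f : ℝ → ℝ}, MemHloc k f → MemHloc k (c • f) := by
  induction k with
  | zero => exact fun hf K hK hc => (hf K hK hc).const_smul c
  | succ k ih =>
    rintro f ⟨h0, g, hg, hk⟩
    exact ⟨fun K hK hc => (h0 K hK hc).const_smul c, c • g, hg.const_smul c, ih hk⟩

lemma memHloc_zero (k : ℕ) : MemHloc k 0 := by
  induction k with
  | zero => exact fun K _ _ => MemLp.zero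
  | succ k ih => exact ⟨fun K _ _ => MemLp.zero, 0, isWeakDeriv_zero, ih⟩

lemma MemHloc.exists_weakDeriv {k : ℕ} (h : MemHloc (k + 1) f) : ∃ g, IsWeakDeriv f g :=
  ⟨_, h.2.choose_spec.1⟩

lemma MemHloc.exists_weakDeriv_rpow (h : MemHloc 2 f) (a : ℝ) :
    ∃ g, IsWeakDeriv (fun y => y ^ a * weakDeriv f y) g := by
  obtain ⟨-, g, hg, -, g', hg', -⟩ := h
  exact ⟨_, (hg'.congr (hg.unique hg.weakDeriv) .rfl).rpow_mul a⟩

lemma HasBoundaryValue.congr {l : Filter ℝ} {L : ℝ} (h : f =ᵐ[volume.restrict (Ioo 0 1)] f')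
    (hf : HasBoundaryValue f l L) : HasBoundaryValue f' l L := by
  obtain ⟨c, h1, h2, h3⟩ := hf
  exact ⟨c, h1, h.symm.trans h2, h3⟩

lemma HasBoundaryValue.add {l : Filter ℝ} (hf : HasBoundaryValue f l 0)
    (hf' : HasBoundaryValue f' l 0) : HasBoundaryValue (f + f') l 0 := by
  obtain ⟨c, h1, h2, h3⟩ := hf
  obtain ⟨c', h1', h2', h3'⟩ := hf'
  exact ⟨c + c', h1.add h1', h2.add h2', by
    have := h3.add h3'
    rwa [add_zero] at this⟩

lemma HasBoundaryValue.const_smul {l : Filter ℝ} (a : ℝ) (hf : HasBoundaryValue f l 0) :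
    HasBoundaryValue (a • f) l 0 := by
  obtain ⟨c, h1, h2, h3⟩ := hf
  exact ⟨a • c, h1.const_smul a, h2.const_smul a, by
    have := h3.const_smul a
    rwa [smul_zero] at this⟩

lemma hasBoundaryValue_zero (l : Filter ℝ) : HasBoundaryValue 0 l 0 :=
  ⟨0, continuousOn_const, .rfl, tendsto_const_nhds⟩

lemma weakDeriv_zero : weakDeriv 0 =ᵐ[volume.restrict (Ioo 0 1)] 0 :=
  isWeakDeriv_zero.weakDeriv.unique isWeakDeriv_zero

variable {α β μ : ℝ}

lemma MemH1.congr (h : f =ᵐ[volume.restrict (Ioo 0 1)] f') (hf : MemH1 α β f) :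
    MemH1 α β f' :=
  ⟨(memLp_congr_ae (ae_w_iff.2 h)).1 hf.1, hf.2.1.congr h, by
    rw [← weakDeriv_congr h]; exact hf.2.2⟩

lemma MemH1.add (hf : MemH1 α β f) (hf' : MemH1 α β f') : MemH1 α β (f + f') := by
  refine ⟨hf.1.add hf'.1, hf.2.1.add hf'.2.1, (memLp_congr_ae (ae_w_iff.2 ?_)).1
    (hf.2.2.add hf'.2.2)⟩
  filter_upwards [weakDeriv_add hf.2.1.exists_weakDeriv hf'.2.1.exists_weakDeriv] with x hx
  simp only [hx, Pi.add_apply]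
  ring

lemma MemH1.const_smul (c : ℝ) (hf : MemH1 α β f) : MemH1 α β (c • f) := by
  refine ⟨hf.1.const_smul c, hf.2.1.const_smul c, (memLp_congr_ae (ae_w_iff.2 ?_)).1
    (hf.2.2.const_smul c)⟩
  filter_upwards [weakDeriv_smul c hf.2.1.exists_weakDeriv] with x hx
  simp only [hx, Pi.smul_apply, smul_eq_mul]
  ring

lemma memH1_zero : MemH1 α β 0 := by
  refine ⟨MemLp.zero, memHloc_zero 1, (memLp_congr_ae (ae_w_iff.2 ?_)).1 MemLp.zero⟩
  filter_upwards [weakDeriv_zero] with x hx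
  simp [hx]

lemma exprA_congr (h : f =ᵐ[volume.restrict (Ioo 0 1)] f') :
    exprA α β μ f =ᵐ[volume.restrict (Ioo 0 1)] exprA α β μ f' := by
  filter_upwards [h] with x hx
  simp only [exprA, weakDeriv_congr h, hx]

lemma exprA_add (hf : MemHloc 2 f) (hf' : MemHloc 2 f') :
    exprA α β μ (f + f') =ᵐ[volume.restrict (Ioo 0 1)] exprA α β μ f + exprA α β μ f' := by
  have h1 := weakDeriv_add hf.exists_weakDeriv hf'.exists_weakDeriv
  have h2 := weakDeriv_add (hf.exists_weakDeriv_rpow α) (hf'.exists_weakDeriv_rpow α)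
  have h3 : (fun y => y ^ α * weakDeriv (f + f') y) =ᵐ[volume.restrict (Ioo 0 1)]
      (fun y => y ^ α * weakDeriv f y) + fun y => y ^ α * weakDeriv f' y := by
    filter_upwards [h1] with x hx
    simp only [hx, Pi.add_apply]
    ring
  rw [← weakDeriv_congr h3] at h2
  filter_upwards [h1, h2] with x hx1 hx2
  simp only [exprA, hx1, hx2, Pi.add_apply]
  ring

lemma exprA_smul (c : ℝ) (hf : MemHloc 2 f) :
    exprA α β μ (c • f) =ᵐ[volume.restrict (Ioo 0 1)] c • exprA α β μ f := by
  have h1 := weakDeriv_smul c hf.exists_weakDeriv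
  have h2 := weakDeriv_smul c (hf.exists_weakDeriv_rpow α)
  have h3 : (fun y => y ^ α * weakDeriv (c • f) y) =ᵐ[volume.restrict (Ioo 0 1)]
      c • (fun y => y ^ α * weakDeriv f y) := by
    filter_upwards [h1] with x hx
    simp only [hx, Pi.smul_apply, smul_eq_mul]
    ring
  rw [← weakDeriv_congr h3] at h2
  filter_upwards [h1, h2] with x hx1 hx2
  simp only [exprA, hx1, hx2, Pi.smul_apply, smul_eq_mul]
  ring

lemma exprA_zero : exprA α β μ 0 =ᵐ[volume.restrict (Ioo 0 1)] 0 := by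
  simpa using exprA_smul (α := α) (β := β) (μ := μ) 0 (memHloc_zero 2)

/-! ### The spaces and operators in `L²_β(0,1)` -/

/-- `H¹_{α,β,0}(0,1)` as a subspace of `L²_β(0,1)`. -/
def H1D (α β : ℝ) : Submodule ℝ (L2w β) where
  carrier := {u | MemH1D α β u}
  add_mem' {u v} hu hv := by
    have h := (ae_w_iff.1 (Lp.coeFn_add u v)).symm
    exact ⟨(hu.1.add hv.1).congr h, (hu.2.1.add hv.2.1).congr h, (hu.2.2.add hv.2.2).congr h⟩
  zero_mem' := by
    have h := (ae_w_iff.1 (Lp.coeFn_zero ℝ 2 (wMeasure β))).symm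
    exact ⟨memH1_zero.congr h, (hasBoundaryValue_zero _).congr h,
      (hasBoundaryValue_zero _).congr h⟩
  smul_mem' c u hu := by
    have h := (ae_w_iff.1 (Lp.coeFn_smul c u)).symm
    exact ⟨(hu.1.const_smul c).congr h, (hu.2.1.const_smul c).congr h,
      (hu.2.2.const_smul c).congr h⟩

/-- `H¹_{α,β,N}(0,1)` as a subspace of `L²_β(0,1)`. -/
def H1N (α β : ℝ) : Submodule ℝ (L2w β) where
  carrier := {u | MemH1N α β u}
  add_mem' {u v} hu hv := by
    have h := (ae_w_iff.1 (Lp.coeFn_add u v)).symm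
    exact ⟨(hu.1.add hv.1).congr h, (hu.2.add hv.2).congr h⟩
  zero_mem' := by
    have h := (ae_w_iff.1 (Lp.coeFn_zero ℝ 2 (wMeasure β))).symm
    exact ⟨memH1_zero.congr h, (hasBoundaryValue_zero _).congr h⟩
  smul_mem' c u hu := by
    have h := (ae_w_iff.1 (Lp.coeFn_smul c u)).symm
    exact ⟨(hu.1.const_smul c).congr h, (hu.2.const_smul c).congr h⟩

/-- The operator `𝒜` in `L²_β(0,1)` with domain `{u ∈ V ∩ H²_loc(0,1) : 𝒜 u ∈ L²_β(0,1)}`. -/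
def opA (α β μ : ℝ) (V : Submodule ℝ (L2w β)) : L2w β →ₗ.[ℝ] L2w β where
  domain :=
    { carrier := {u | u ∈ V ∧ MemHloc 2 u ∧ MemLp (exprA α β μ u) 2 (wMeasure β)}
      add_mem' := by
        intro u v hu hv
        have h := (ae_w_iff.1 (Lp.coeFn_add u v)).symm
        refine ⟨V.add_mem hu.1 hv.1, (hu.2.1.add hv.2.1).congr h, ?_⟩
        exact (memLp_congr_ae (ae_w_iff.2
          ((exprA_add hu.2.1 hv.2.1).symm.trans (exprA_congr h)))).1 (hu.2.2.add hv.2.2)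
      zero_mem' := by
        have h := (ae_w_iff.1 (Lp.coeFn_zero ℝ 2 (wMeasure β))).symm
        refine ⟨V.zero_mem, (memHloc_zero 2).congr h, ?_⟩
        exact (memLp_congr_ae (ae_w_iff.2 (exprA_zero.symm.trans (exprA_congr h)))).1 MemLp.zero
      smul_mem' := by
        intro c u hu
        have h := (ae_w_iff.1 (Lp.coeFn_smul c u)).symm
        refine ⟨V.smul_mem c hu.1, (hu.2.1.const_smul c).congr h, ?_⟩
        exact (memLp_congr_ae (ae_w_iff.2
          ((exprA_smul c hu.2.1).symm.trans (exprA_congr h)))).1 (hu.2.2.const_smul c) }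
  toFun :=
    { toFun := fun u => MemLp.toLp (exprA α β μ (u : L2w β)) u.2.2.2
      map_add' := by
        rintro ⟨u, hu⟩ ⟨v, hv⟩
        refine (MemLp.toLp_eq_toLp_iff _ (hu.2.2.add hv.2.2)).2 (ae_w_iff.2 ?_)
        exact (exprA_congr (ae_w_iff.1 (Lp.coeFn_add u v))).trans (exprA_add hu.2.1 hv.2.1)
      map_smul' := by
        rintro c ⟨u, hu⟩
        refine (MemLp.toLp_eq_toLp_iff _ (hu.2.2.const_smul c)).2 (ae_w_iff.2 ?_)
        exact (exprA_congr (ae_w_iff.1 (Lp.coeFn_smul c u))).trans (exprA_smul c hu.2.1) }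

/-- The square `T²` of an unbounded operator, with domain `{u ∈ D(T) : T u ∈ D(T)}`. -/
def opSq {E : Type*} [AddCommGroup E] [Module ℝ E] (T : E →ₗ.[ℝ] E) : E →ₗ.[ℝ] E where
  domain :=
    { carrier := {u | ∃ h : u ∈ T.domain, T ⟨u, h⟩ ∈ T.domain}
      add_mem' := by
        rintro u v ⟨hu, hu'⟩ ⟨hv, hv'⟩
        exact ⟨T.domain.add_mem hu hv, by
          have := T.domain.add_mem hu' hv'
          rwa [← T.map_add] at this⟩
      zero_mem' := ⟨T.domain.zero_mem, by
        have : T ⟨0, T.domain.zero_mem⟩ = 0 := T.map_zero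
        rw [this]
        exact T.domain.zero_mem⟩
      smul_mem' := by
        rintro c u ⟨hu, hu'⟩
        exact ⟨T.domain.smul_mem c hu, by
          have := T.domain.smul_mem c hu'
          rwa [← T.map_smul] at this⟩ }
  toFun :=
    { toFun := fun u => T ⟨T ⟨u, u.2.choose⟩, u.2.choose_spec⟩
      map_add' := by
        rintro ⟨u, hu, hu'⟩ ⟨v, hv, hv'⟩
        rw [← T.map_add]
        congr 2
        exact T.map_add ⟨u, hu⟩ ⟨v, hv⟩
      map_smul' := by
        rintro c ⟨u, hu, hu'⟩
        rw [RingHom.id_apply, ← T.map_smul]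
        congr 2
        exact T.map_smul c ⟨u, hu⟩ }

/-- `𝒜²` with domain `D₀(𝒜²) = {u ∈ D₀(𝒜) : 𝒜 u ∈ D₀(𝒜)}`. -/
def A2D (α β μ : ℝ) : L2w β →ₗ.[ℝ] L2w β := opSq (opA α β μ (H1D α β))

/-- `𝒜²` with domain `D_N(𝒜²) = {u ∈ D_N(𝒜) : 𝒜 u ∈ D_N(𝒜)}`. -/
def A2N (α β μ : ℝ) : L2w β →ₗ.[ℝ] L2w β := opSq (opA α β μ (H1N α β))

/-! ### Bessel functions and the family `Φ_k` -/

/-- The Bessel function of the first kind `J_ν(x)`, for `x ≥ 0`. -/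
def besselJ (ν x : ℝ) : ℝ :=
  ∑' m : ℕ, (-1 : ℝ) ^ m / (m.factorial * Real.Gamma (m + ν + 1)) * (x / 2) ^ (2 * m + ν : ℝ)

/-- The positive zeros of `J_ν` listed increasingly, counted from `0`: `besselZero ν k` is
`j_{ν,k+1}`, the least zero of `J_ν` larger than the previous one (than `0` for `k = 0`). -/
def besselZero (ν : ℝ) : ℕ → ℝ
  | 0 => sInf {x | 0 < x ∧ besselJ ν x = 0}
  | k + 1 => sInf {x | besselZero ν k < x ∧ besselJ ν x = 0}

/-- `μ(δ) = (1-δ)²/4`. -/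
def muCrit (δ : ℝ) : ℝ := (1 - δ) ^ 2 / 4

/-- `κ_α = (2-α)/2`. -/
def kappa (α : ℝ) : ℝ := (2 - α) / 2

/-- `ν = √(μ(α+β) - μ) / κ_α`. -/
def nu (α β μ : ℝ) : ℝ := √(muCrit (α + β) - μ) / kappa α

/-- `Phi α β μ k` is `Φ_{k+1}`, where
`Φ_k(x) = (2κ_α)^{1/2} / |J_ν'(j_{ν,k})| * x^{(1-α-β)/2} * J_ν(j_{ν,k} x^{κ_α})`. -/
def Phi (α β μ : ℝ) (k : ℕ) (x : ℝ) : ℝ :=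
  (2 * kappa α) ^ (1 / 2 : ℝ) / |deriv (besselJ (nu α β μ)) (besselZero (nu α β μ) k)|
    * x ^ ((1 - α - β) / 2) * besselJ (nu α β μ) (besselZero (nu α β μ) k * x ^ kappa α)

end DegenerateBessel

end

/-!
# Spectral theory of `-𝒜²` for a degenerate-singular operator

The homogeneous equation `𝒜 u = 0` has the solutions `x^p` and `x^q`, where `p, q = γ ± σ`, `γ =
(1-α-β)/2` and `σ = √(μ(α+β)-μ) > 0`. They give an explicit Green function `(x^p (y^q - y^p)) /
(2σ)` for `x < y`, extended symmetrically, and an integral operator `greenOp` in `L²_β(0,1)`.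
Cauchy–Schwarz gives the pointwise bound `|u(x)| ≤ C ‖f‖ x^{γ+ε}` for `u = greenOp f`
(`abs_green_le`), which dominates in `L²_β`; so `greenOp` is bounded and compact
(`isCompactOperator_greenOp`), and it is symmetric by Fubini's theorem (`isSymmetric_greenOp`). The
same bound, with its analogue for `u'`, puts the range of `greenOp` into `D_N(𝒜)`, and into
`D_0(𝒜)` if `α + β < 1`, since then `γ > 0`. Conversely, finite energy (or the boundary value at
`0`) excludes the solution `x^q`, and the boundary value at `1` excludes `x^p`. So `greenOp` is the
inverse of `𝒜`, with domain `D_0(𝒜)` if `α + β < 1` and with domain `D_N(𝒜)` if `α + β ≥ 1`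
(`isBoundedInverse_H1D`, `isBoundedInverse_H1N`).

The rest is operator theory. `𝒜²` is the inverse of the injective bounded symmetric operator
`greenOp * greenOp`, so it is densely defined, self-adjoint, and positive, since `⟨𝒜² u, u⟩ = ‖𝒜
u‖²`. The spectral theorem for compact operators says that the eigenvectors of `greenOp` are
complete, and they can be computed: writing `J_ν(x) = (x/2)^ν E_ν(x²/4)` with `E_ν` entire
(`besselE`), the function `ψ_τ = x^p E_ν(τ x^{2κ})` (`psi`) solves `𝒜 ψ = 4κ²τ ψ`, and it lies in
the domain when `E_ν(τ) = 0`. A weighted Wronskian, constant on `(0,1)` and null at `0`, shows that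
every eigenvector is a multiple of some `ψ_τ` (`exists_eq_smul_psi`), and the boundary value at `1`
forces `E_ν(τ) = 0`. With `τ = j²/4` these are the functions `Φ_k` up to a factor, which the first
integral `(x v')² + (4κ²τx^{2κ} - σ²) v²`, `v = x^{-γ} ψ_τ`, identifies as the normalizing one
(`integral_psi_sq`). That `J_ν` has infinitely many positive zeros is a consequence of
completeness, because `L²_β(0,1)` has infinite dimension.

The second description of the domains is interior regularity: if `u` and `𝒜 u` lie in `H²_loc`,
then `u` lies in `H⁴_loc`, because `𝒜 u` can be solved for `u''`; and then `𝒜(𝒜 u)` expands to the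
fourth order expression (`exprA_exprA_ae_eq`). The boundary value of `(x^{α+β} u')'` at `1`
replaces that of `𝒜 u` because the two differ by a multiple of `u`, up to a power of `x`.
-/

open MeasureTheory Set Filter Topology
open scoped ContDiff

noncomputable section

namespace DegenerateBessel

variable {f f' g g' : ℝ → ℝ} {α β μ : ℝ}

/-! ### Weak derivatives: constants, primitives and classical derivatives -/

lemma exists_Icc_of_isCompact_subset_Ioo {K : Set ℝ} (hK : IsCompact K) (hs : K ⊆ Ioo 0 1) :
    ∃ a b : ℝ, 0 < a ∧ a < b ∧ b < 1 ∧ K ⊆ Icc a b := by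
  rcases K.eq_empty_or_nonempty with rfl | hne
  · exact ⟨1 / 4, 1 / 2, by norm_num, by norm_num, by norm_num, empty_subset _⟩
  obtain ⟨a, ha, hal⟩ := hK.exists_isLeast hne
  obtain ⟨b, hb, hbu⟩ := hK.exists_isGreatest hne
  refine ⟨a / 2, b, by linarith [(hs ha).1], by linarith [(hs ha).1, hal hb], (hs hb).2, ?_⟩
  exact fun x hx => ⟨by linarith [(hs ha).1, hal hx], hbu hx⟩

/-- A test function of mean zero is the derivative of a test function. -/
lemma exists_test_primitive {χ : ℝ → ℝ} (hχ : ContDiff ℝ ∞ χ) (hc : HasCompactSupport χ)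
    (hs : tsupport χ ⊆ Ioo 0 1) (h0 : ∫ x, χ x = 0) :
    ∃ φ : ℝ → ℝ, ContDiff ℝ ∞ φ ∧ HasCompactSupport φ ∧ tsupport φ ⊆ Ioo 0 1 ∧ deriv φ = χ := by
  obtain ⟨a, b, ha, hab, hb, hK⟩ := exists_Icc_of_isCompact_subset_Ioo hc hs
  have hz : ∀ x, x ∉ Icc a b → χ x = 0 := fun x hx =>
    image_eq_zero_of_notMem_tsupport fun h => hx (hK h)
  have hd : ∀ x, HasDerivAt (fun x => ∫ t in a..x, χ t) (χ x) x := fun x =>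
    intervalIntegral.integral_hasDerivAt_right (hχ.continuous.intervalIntegrable _ _)
      (hχ.continuous.stronglyMeasurableAtFilter _ _) hχ.continuous.continuousAt
  have hd' : deriv (fun x => ∫ t in a..x, χ t) = χ := funext fun x => (hd x).deriv
  have hab' : ∫ t in a..b, χ t = 0 := by
    rw [intervalIntegral.integral_of_le hab.le, ← integral_Icc_eq_integral_Ioc,
      setIntegral_eq_integral_of_forall_compl_eq_zero hz, h0]
  have hsupp : Function.support (fun x => ∫ t in a..x, χ t) ⊆ Icc a b := by
    intro x hx
    by_contra hxab
    refine hx ?_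
    rcases lt_or_ge x a with h | h
    · refine intervalIntegral.integral_zero_ae ?_
      have : ∀ᵐ t : ℝ, t ≠ a := by simp [ae_iff, measure_singleton]
      filter_upwards [this] with t hta ht
      rw [uIoc_of_ge h.le] at ht
      exact hz t fun h' => hta (le_antisymm ht.2 h'.1)
    · have hbx : b < x := by
        by_contra h'
        exact hxab ⟨h, not_lt.1 h'⟩
      have e := intervalIntegral.integral_add_adjacent_intervals
        (hχ.continuous.intervalIntegrable (μ := volume) a b)
        (hχ.continuous.intervalIntegrable (μ := volume) b x)
      have e2 : ∫ t in b..x, χ t = 0 := by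
        refine intervalIntegral.integral_zero_ae (ae_of_all _ fun t ht => ?_)
        rw [uIoc_of_le hbx.le] at ht
        exact hz t fun h' => absurd h'.2 (not_le.2 ht.1)
      change ∫ t in a..x, χ t = 0
      rw [← e, hab', e2, add_zero]
  refine ⟨fun x => ∫ t in a..x, χ t, ?_, ?_, ?_, hd'⟩
  · rw [contDiff_infty_iff_deriv, hd']
    exact ⟨fun x => (hd x).differentiableAt, hχ⟩
  · exact HasCompactSupport.of_support_subset_isCompact isCompact_Icc hsupp
  · exact (closure_minimal hsupp isClosed_Icc).trans
      fun x hx => ⟨ha.trans_le hx.1, hx.2.trans_lt hb⟩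

/-- Du Bois-Reymond: a function with vanishing weak derivative is constant. -/
lemma IsWeakDeriv.ae_eq_const (h : IsWeakDeriv f 0) :
    ∃ c, f =ᵐ[volume.restrict (Ioo 0 1)] fun _ => c := by
  let B : ContDiffBump (1 / 2 : ℝ) := ⟨1 / 8, 1 / 4, by norm_num, by norm_num⟩
  set η : ℝ → ℝ := B.normed volume with hη
  have η1 : ContDiff ℝ ∞ η := B.contDiff_normed
  have η2 : HasCompactSupport η := B.hasCompactSupport_normed
  have η3 : tsupport η ⊆ Ioo 0 1 := by
    rw [hη, B.tsupport_normed_eq, Real.closedBall_eq_Icc]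
    intro x hx
    simp only [B] at hx
    constructor <;> linarith [hx.1, hx.2]
  refine ⟨∫ x, f x * η x, ?_⟩
  have key := IsOpen.ae_eq_zero_of_integral_contDiff_smul_eq_zero
    (isOpen_Ioo (a := (0 : ℝ)) (b := 1)) (h.left.sub
      (locallyIntegrableOn_const (∫ x, f x * η x))) (fun ψ h1 h2 h3 => by
      set m := ∫ x, ψ x with hm
      have iψ : Integrable ψ := h1.continuous.integrable_of_hasCompactSupport h2
      have iη : Integrable η := η1.continuous.integrable_of_hasCompactSupport η2
      have i1 := integrable_mul_test h.left h1.continuous h2 h3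
      have i2 := integrable_mul_test h.left η1.continuous η2 η3
      obtain ⟨φ, p1, p2, p3, p4⟩ := exists_test_primitive (χ := ψ - m • η)
        (h1.sub (contDiff_const.smul η1)) (h2.sub (η2.smul_left (f := fun _ => m)))
        ((tsupport_sub ψ (m • η)).trans (union_subset h3
          ((tsupport_smul_subset_right (fun _ => m) η).trans η3))) (by
          simp only [Pi.sub_apply, Pi.smul_apply, smul_eq_mul]
          rw [integral_sub iψ (iη.const_mul m), integral_const_mul, hη, B.integral_normed, ← hm]
          ring)
      have e := h.integral_eq φ p1 p2 p3
      rw [p4] at e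
      have e1 : ∀ x, f x * (ψ - m • η) x = f x * ψ x - m * (f x * η x) := fun x => by
        simp only [Pi.sub_apply, Pi.smul_apply, smul_eq_mul]; ring
      simp_rw [e1] at e
      rw [integral_sub i1 (i2.const_mul m), integral_const_mul] at e
      have e2 : ∀ x, ψ x • (f x - ∫ x, f x * η x)
          = f x * ψ x - (∫ x, f x * η x) * ψ x := fun x => by
        rw [smul_eq_mul]; ring
      simp only [Pi.sub_apply]
      simp_rw [e2]
      rw [integral_sub i1 (iψ.const_mul _), integral_const_mul, ← hm]
      simp only [Pi.zero_apply, zero_mul, integral_zero, neg_zero] at e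
      linarith)
  rw [Filter.EventuallyEq, ae_restrict_iff' measurableSet_Ioo]
  filter_upwards [key] with x hx hm
  have := hx hm
  simpa [sub_eq_zero] using this

lemma LocallyIntegrableOn.intervalIntegrable_Ioo (hg : LocallyIntegrableOn g (Ioo 0 1)) {x y : ℝ}
    (hx : x ∈ Ioo (0 : ℝ) 1) (hy : y ∈ Ioo (0 : ℝ) 1) : IntervalIntegrable g volume x y := by
  rw [intervalIntegrable_iff]
  exact (hg.integrableOn_compact_subset (ordConnected_Ioo.uIcc_subset hx hy)
    isCompact_uIcc).mono_set uIoc_subset_uIcc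

/-- An antiderivative on `(0,1)` in the sense of the Lebesgue integral is continuous there. -/
lemma continuousOn_of_sub_eq_integral (hg : LocallyIntegrableOn g (Ioo 0 1))
    (h : ∀ x ∈ Ioo (0 : ℝ) 1, ∀ y ∈ Ioo (0 : ℝ) 1, f y - f x = ∫ t in x..y, g t) :
    ContinuousOn f (Ioo 0 1) := by
  intro x hx
  refine ContinuousAt.continuousWithinAt ?_
  have ha : x / 2 ∈ Ioo (0 : ℝ) 1 := ⟨by linarith [hx.1], by linarith [hx.1, hx.2]⟩
  have hb : (x + 1) / 2 ∈ Ioo (0 : ℝ) 1 := ⟨by linarith [hx.1], by linarith [hx.1, hx.2]⟩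
  have hab : x / 2 ≤ (x + 1) / 2 := by linarith [hx.1]
  have hi : IntegrableOn g (uIcc (x / 2) ((x + 1) / 2)) := by
    rw [uIcc_of_le hab]
    exact (intervalIntegrable_iff_integrableOn_Icc_of_le hab).1
      (LocallyIntegrableOn.intervalIntegrable_Ioo hg ha hb)
  have hc : ContinuousOn (fun y => ∫ t in (x / 2)..y, g t) (Icc (x / 2) ((x + 1) / 2)) := by
    have := intervalIntegral.continuousOn_primitive_interval hi
    rwa [uIcc_of_le hab] at this
  have hn : Icc (x / 2) ((x + 1) / 2) ∈ 𝓝 x :=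
    Icc_mem_nhds (by linarith [hx.1]) (by linarith [hx.2])
  have h2 : ContinuousAt (fun y => f (x / 2) + ∫ t in (x / 2)..y, g t) x :=
    continuousAt_const.add (hc.continuousAt hn)
  refine h2.congr ?_
  filter_upwards [hn] with y hy
  have := h _ ha y ⟨ha.1.trans_le hy.1, hy.2.trans_lt hb.2⟩
  linarith

/-- An antiderivative in the sense of the Lebesgue integral is one in the weak sense. -/
lemma isWeakDeriv_of_sub_eq_integral (hg : LocallyIntegrableOn g (Ioo 0 1))
    (h : ∀ x ∈ Ioo (0 : ℝ) 1, ∀ y ∈ Ioo (0 : ℝ) 1, f y - f x = ∫ t in x..y, g t) :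
    IsWeakDeriv f g where
  left := (continuousOn_of_sub_eq_integral hg h).locallyIntegrableOn measurableSet_Ioo
  right := hg
  integral_eq φ h1 h2 h3 := by
    obtain ⟨a, b, ha, hab, hb, hK⟩ := exists_Icc_of_isCompact_subset_Ioo
      h2 h3
    have hz : ∀ x, x ∉ Ioc a b → φ x = 0 ∧ deriv φ x = 0 := by
      -- `φ` is continuous and vanishes to the left of `a`, hence also at `a`.
      have hz' : ∀ x, x ∉ Icc a b → x ∉ tsupport φ := fun x hx h => hx (hK h)
      intro x hx
      by_cases hxa : x = a
      · have hφa : ∀ ψ : ℝ → ℝ, Continuous ψ → (∀ x, x ∉ Icc a b → ψ x = 0) → ψ a = 0 := by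
          intro ψ hψ h0
          have t1 : Tendsto ψ (𝓝[<] a) (𝓝 (ψ a)) := hψ.continuousAt.mono_left nhdsWithin_le_nhds
          have t2 : Tendsto ψ (𝓝[<] a) (𝓝 0) := by
            refine tendsto_const_nhds.congr' ?_
            filter_upwards [self_mem_nhdsWithin] with y hy
            exact (h0 y fun h => absurd h.1 (not_le.2 hy)).symm
          exact tendsto_nhds_unique t1 t2
        subst hxa
        exact ⟨hφa φ h1.continuous fun y hy => image_eq_zero_of_notMem_tsupport (hz' y hy),
          hφa _ (h1.continuous_deriv (by simp)) fun y hy => image_eq_zero_of_notMem_tsupport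
            fun h => hz' y hy (tsupport_deriv_subset' h)⟩
      · have hx' : x ∉ Icc a b := fun h => hx ⟨lt_of_le_of_ne h.1 (Ne.symm hxa), h.2⟩
        exact ⟨image_eq_zero_of_notMem_tsupport (hz' x hx'),
          image_eq_zero_of_notMem_tsupport fun h => hz' x hx' (tsupport_deriv_subset' h)⟩
    have hφa : φ a = 0 := (hz a fun h => absurd h.1 (lt_irrefl a)).1
    have hφb : φ b = 0 := by
      have t1 : Tendsto φ (𝓝[>] b) (𝓝 (φ b)) :=
        h1.continuous.continuousAt.mono_left nhdsWithin_le_nhds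
      have t2 : Tendsto φ (𝓝[>] b) (𝓝 0) := by
        refine tendsto_const_nhds.congr' ?_
        filter_upwards [self_mem_nhdsWithin] with y hy
        exact (hz y fun h => absurd h.2 (not_le.2 hy)).1.symm
      exact tendsto_nhds_unique t1 t2
    have ma : a ∈ Ioo (0 : ℝ) 1 := ⟨ha, hab.trans hb⟩
    have mb : b ∈ Ioo (0 : ℝ) 1 := ⟨ha.trans hab, hb⟩
    have gi := LocallyIntegrableOn.intervalIntegrable_Ioo hg ma mb
    have A1 := gi.absolutelyContinuousOnInterval_intervalIntegral left_mem_uIcc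
    have A2 : AbsolutelyContinuousOnInterval φ a b :=
      (h1.of_le (by simp)).contDiffOn.absolutelyContinuousOnInterval
    have e := A1.integral_mul_deriv_eq_deriv_mul A2
    rw [hφa, hφb] at e
    have e1 : ∫ x, f x * deriv φ x = ∫ x in a..b, f x * deriv φ x := by
      rw [intervalIntegral.integral_of_le hab.le, setIntegral_eq_integral_of_forall_compl_eq_zero]
      exact fun x hx => by rw [(hz x hx).2, mul_zero]
    have e2 : ∫ x, g x * φ x = ∫ x in a..b, g x * φ x := by
      rw [intervalIntegral.integral_of_le hab.le, setIntegral_eq_integral_of_forall_compl_eq_zero]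
      exact fun x hx => by rw [(hz x hx).1, mul_zero]
    have e3 : ∫ x in a..b, deriv (fun x => ∫ v in a..x, g v) x * φ x = ∫ x in a..b, g x * φ x := by
      refine intervalIntegral.integral_congr_ae ?_
      filter_upwards [gi.ae_hasDerivAt_integral] with x hx hm
      rw [(hx (uIoc_subset_uIcc hm) a left_mem_uIcc).deriv]
    have hdc : Continuous (deriv φ) := h1.continuous_deriv (by simp)
    have e4 : ∫ x in a..b, f x * deriv φ x
        = ∫ x in a..b, (f a * deriv φ x + (∫ v in a..x, g v) * deriv φ x) := by
      refine intervalIntegral.integral_congr fun x hx => ?_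
      rw [uIcc_of_le hab.le] at hx
      have := h a ma x ⟨ha.trans_le hx.1, hx.2.trans_lt hb⟩
      simp only [← this]
      ring
    have e5 : ∫ x in a..b, deriv φ x = 0 := by
      rw [intervalIntegral.integral_deriv_eq_sub (fun x _ => h1.differentiable (by simp) x)
        (hdc.intervalIntegrable _ _), hφa, hφb, sub_zero]
    rw [e1, e2, e4, intervalIntegral.integral_add ((hdc.intervalIntegrable _ _).const_mul _)
      ((hdc.intervalIntegrable _ _).continuousOn_mul A1.continuousOn),
      intervalIntegral.integral_const_mul, e5, e, e3]
    ring

/-- A continuous classical derivative is a weak derivative. -/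
lemma isWeakDeriv_of_hasDerivAt (h : ∀ x ∈ Ioo (0 : ℝ) 1, HasDerivAt f (g x) x)
    (hg : ContinuousOn g (Ioo 0 1)) : IsWeakDeriv f g := by
  have hl := hg.locallyIntegrableOn (μ := volume) measurableSet_Ioo
  refine isWeakDeriv_of_sub_eq_integral hl
    fun x hx y hy => ?_
  exact (intervalIntegral.integral_eq_sub_of_hasDerivAt
    (fun t ht => h t (ordConnected_Ioo.uIcc_subset hx hy ht))
    (LocallyIntegrableOn.intervalIntegrable_Ioo hl hx hy)).symm

/-! ### The local Sobolev scale and the differential expressions -/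

lemma MemL2loc.rpow_mul (a : ℝ) (hf : MemL2loc f) : MemL2loc fun x => x ^ a * f x := by
  intro K hK hc
  have hcont : ContinuousOn (fun x : ℝ => x ^ a) K := fun x hx =>
    (Real.continuousAt_rpow_const x a (Or.inl (hK hx).1.ne')).continuousWithinAt
  obtain ⟨C, hC⟩ := hc.exists_bound_of_continuousOn hcont
  refine (hf K hK hc).of_le_mul (c := C)
    ((hcont.aestronglyMeasurable hc.measurableSet).mul (hf K hK hc).1) ?_
  filter_upwards [ae_restrict_mem hc.measurableSet] with x hx
  rw [norm_mul]
  exact mul_le_mul_of_nonneg_right (hC x hx) (norm_nonneg _)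

lemma memL2loc_of_continuousOn (hf : ContinuousOn f (Ioo 0 1)) : MemL2loc f := by
  intro K hK hc
  obtain ⟨C, hC⟩ := hc.exists_bound_of_continuousOn (hf.mono hK)
  have : IsFiniteMeasure (volume.restrict K) := ⟨by
    rw [Measure.restrict_apply_univ]; exact hc.measure_lt_top⟩
  refine MemLp.of_bound ((hf.mono hK).aestronglyMeasurable hc.measurableSet) C ?_
  filter_upwards [ae_restrict_mem hc.measurableSet] with x hx using hC x hx

lemma MemHloc.of_succ {k : ℕ} : ∀ {f : ℝ → ℝ}, MemHloc (k + 1) f → MemHloc k f := by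
  induction k with
  | zero => exact fun h => h.1
  | succ k ih =>
    rintro f ⟨h0, g, hg, hk⟩
    exact ⟨h0, g, hg, ih hk⟩

lemma MemHloc.isWeakDeriv {k : ℕ} (h : MemHloc (k + 1) f) : IsWeakDeriv f (weakDeriv f) := by
  obtain ⟨g, hg⟩ := h.exists_weakDeriv
  exact hg.weakDeriv

lemma MemHloc.weakDeriv {k : ℕ} (h : MemHloc (k + 1) f) : MemHloc k (weakDeriv f) := by
  obtain ⟨-, g, hg, hk⟩ := h
  exact hk.congr (hg.unique hg.weakDeriv)

lemma MemHloc.rpow_mul {k : ℕ} : ∀ {f : ℝ → ℝ} (a : ℝ), MemHloc k f →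
    MemHloc k fun x => x ^ a * f x := by
  induction k with
  | zero => exact fun a h => MemL2loc.rpow_mul a h
  | succ k ih =>
    rintro f a h
    have h' := h.of_succ
    obtain ⟨h0, g, hg, hk⟩ := h
    exact ⟨h0.rpow_mul a, _, hg.rpow_mul a, (ih a hk).add ((ih (a - 1) h').const_smul a)⟩

/-- Product rule with a multiple of a power. -/
lemma IsWeakDeriv.const_rpow_mul (h : IsWeakDeriv f g) (c a : ℝ) :
    IsWeakDeriv (fun x => c * x ^ a * f x)
      (fun x => c * x ^ a * g x + c * a * x ^ (a - 1) * f x) :=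
  ((h.rpow_mul a).const_smul c).congr
    (.of_eq (by ext x; simp only [Pi.smul_apply, smul_eq_mul]; ring))
    (.of_eq (by ext x; simp only [Pi.smul_apply, smul_eq_mul]; ring))

lemma MemHloc.const_rpow_mul {k : ℕ} (h : MemHloc k f) (c a : ℝ) :
    MemHloc k fun x => c * x ^ a * f x :=
  ((h.rpow_mul a).const_smul c).congr
    (.of_eq (by ext x; simp only [Pi.smul_apply, smul_eq_mul]; ring))

lemma IsWeakDeriv.ae_eq_weakDeriv (h : IsWeakDeriv f g) :
    DegenerateBessel.weakDeriv f =ᵐ[volume.restrict (Ioo 0 1)] g :=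
  h.weakDeriv.unique h

/-- `𝒜 f` in non-divergence form. -/
lemma exprA_ae_eq {h : ℝ → ℝ} (h1 : IsWeakDeriv f g) (h2 : IsWeakDeriv g h) :
    exprA α β μ f =ᵐ[volume.restrict (Ioo 0 1)]
      ((fun x => (-1) * x ^ α * h x) + fun x => (-(α + β)) * x ^ (α - 1) * g x)
        + fun x => (-μ) * x ^ (α - 2) * f x := by
  have e1 := h1.ae_eq_weakDeriv
  have e2 : weakDeriv (fun y => y ^ α * weakDeriv f y) =ᵐ[volume.restrict (Ioo 0 1)] _ :=
    ((h2.congr e1.symm .rfl).rpow_mul α).ae_eq_weakDeriv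
  filter_upwards [e1, e2, ae_restrict_mem measurableSet_Ioo] with x hx1 hx2 hx
  simp only [exprA, hx1, hx2, Pi.add_apply]
  rw [show α - 2 = -(2 - α) by ring, Real.rpow_neg hx.1.le]
  ring

lemma MemHloc.exprA_ae_eq (hf : MemHloc 2 f) :
    exprA α β μ f =ᵐ[volume.restrict (Ioo 0 1)]
      ((fun x => (-1) * x ^ α * DegenerateBessel.weakDeriv (DegenerateBessel.weakDeriv f) x)
        + fun x => (-(α + β)) * x ^ (α - 1) * DegenerateBessel.weakDeriv f x)
        + fun x => (-μ) * x ^ (α - 2) * f x :=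
  DegenerateBessel.exprA_ae_eq hf.isWeakDeriv hf.weakDeriv.isWeakDeriv

lemma MemHloc.exprA {k : ℕ} (hf : MemHloc (k + 2) f) :
    MemHloc k (DegenerateBessel.exprA α β μ f) := by
  have hf' : MemHloc 2 f := by
    induction k with
    | zero => exact hf
    | succ k ih => exact ih hf.of_succ
  refine MemHloc.congr hf'.exprA_ae_eq.symm ?_
  exact ((hf.weakDeriv.weakDeriv.const_rpow_mul _ _).add
    (hf.weakDeriv.of_succ.const_rpow_mul _ _)).add (hf.of_succ.of_succ.const_rpow_mul _ _)

/-- Interior regularity: one may solve `𝒜 f` for the second derivative of `f`. -/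
lemma MemHloc.of_exprA {k : ℕ} (hf : MemHloc 2 f) (hf' : MemHloc (k + 1) f)
    (hA : MemHloc k (DegenerateBessel.exprA α β μ f)) : MemHloc (k + 2) f := by
  refine ⟨hf.1, _, hf.isWeakDeriv, hf.weakDeriv.1, _, hf.weakDeriv.isWeakDeriv, ?_⟩
  have H := ((hA.const_rpow_mul (-1) (-α)).add
    (hf'.weakDeriv.const_rpow_mul (-(α + β)) (-1))).add (hf'.of_succ.const_rpow_mul (-μ) (-2))
  refine H.congr ?_
  filter_upwards [hf.exprA_ae_eq (α := α) (β := β) (μ := μ), ae_restrict_mem measurableSet_Ioo]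
    with x hx hm
  have hX : x ^ α ≠ 0 := (Real.rpow_pos_of_pos hm.1 α).ne'
  have hx0 : x ≠ 0 := hm.1.ne'
  simp only [Pi.add_apply, hx, Real.rpow_neg hm.1.le, Real.rpow_sub hm.1, Real.rpow_one,
    Real.rpow_two]
  field_simp
  ring

/-- Formally, `𝒜 (𝒜 f)` is the fourth order expression. -/
lemma exprA_exprA_ae_eq (hf : MemHloc 4 f) :
    exprA α β μ (exprA α β μ f) =ᵐ[volume.restrict (Ioo 0 1)] exprA2 α β μ f := by
  have d1 := hf.isWeakDeriv
  have d2 := hf.weakDeriv.isWeakDeriv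
  have d3 := hf.weakDeriv.weakDeriv.isWeakDeriv
  have d4 := hf.weakDeriv.weakDeriv.weakDeriv.isWeakDeriv
  have e0 := hf.of_succ.of_succ.exprA_ae_eq (α := α) (β := β) (μ := μ)
  have V1 := ((d3.const_rpow_mul (-1) α).add (d2.const_rpow_mul (-(α + β)) (α - 1))).add
    (d1.const_rpow_mul (-μ) (α - 2))
  have V2 := (((d4.const_rpow_mul (-1) α).add (d3.const_rpow_mul (-1 * α) (α - 1))).add
    ((d3.const_rpow_mul (-(α + β)) (α - 1)).add
      (d2.const_rpow_mul (-(α + β) * (α - 1)) (α - 1 - 1)))).add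
    ((d2.const_rpow_mul (-μ) (α - 2)).add (d1.const_rpow_mul (-μ * (α - 2)) (α - 2 - 1)))
  have e1 := exprA_ae_eq (α := α) (β := β) (μ := μ) V1 V2
  refine (exprA_congr e0).trans (e1.trans ?_)
  filter_upwards [ae_restrict_mem measurableSet_Ioo] with x hm
  have hX : x ^ α ≠ 0 := (Real.rpow_pos_of_pos hm.1 α).ne'
  have hx0 : x ≠ 0 := hm.1.ne'
  have h2α : x ^ (2 * α) = x ^ α * x ^ α := by rw [two_mul, Real.rpow_add hm.1]
  have h3 : x ^ (3 : ℝ) = x ^ 3 := by exact_mod_cast Real.rpow_natCast x 3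
  have h4 : x ^ (4 : ℝ) = x ^ 4 := by exact_mod_cast Real.rpow_natCast x 4
  simp only [Pi.add_apply, exprA2, Function.iterate_succ, Function.iterate_zero,
    Function.comp_apply, id, Real.rpow_sub hm.1, Real.rpow_one, Real.rpow_two, h2α, h3, h4,
    rho₁, rho₂, rho₃, rho₄]
  field_simp
  ring

/-! ### Boundary values -/

lemma HasBoundaryValue.rpow_mul_left_one (a : ℝ) (hf : HasBoundaryValue f (𝓝[<] 1) 0) :
    HasBoundaryValue (fun x => x ^ a * f x) (𝓝[<] 1) 0 := by
  obtain ⟨c, h1, h2, h3⟩ := hf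
  refine ⟨fun x => x ^ a * c x, ContinuousOn.mul ?_ h1, ?_, ?_⟩
  · exact fun x hx => (Real.continuousAt_rpow_const x a (Or.inl hx.1.ne')).continuousWithinAt
  · filter_upwards [h2] with x hx
    rw [hx]
  · have : Tendsto (fun x : ℝ => x ^ a) (𝓝[<] 1) (𝓝 (1 ^ a)) :=
      (Real.continuousAt_rpow_const 1 a (Or.inl one_ne_zero)).mono_left nhdsWithin_le_nhds
    simpa using this.mul h3

lemma Ioo_mem_nhdsGT_zero : Ioo (0 : ℝ) 1 ∈ 𝓝[>] (0 : ℝ) := Ioo_mem_nhdsGT one_pos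

lemma Ioo_mem_nhdsLT_one : Ioo (0 : ℝ) 1 ∈ 𝓝[<] (1 : ℝ) := Ioo_mem_nhdsLT one_pos

/-- Any continuous representative has the boundary value as its limit. -/
lemma HasBoundaryValue.tendsto {l : Filter ℝ} {L : ℝ} (hf : HasBoundaryValue f l L)
    (hl : Ioo (0 : ℝ) 1 ∈ l) {c : ℝ → ℝ} (hc : ContinuousOn c (Ioo 0 1))
    (h : f =ᵐ[volume.restrict (Ioo 0 1)] c) : Tendsto c l (𝓝 L) := by
  obtain ⟨c', h1, h2, h3⟩ := hf
  have he : EqOn c' c (Ioo 0 1) :=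
    Measure.eqOn_open_of_ae_eq (h2.symm.trans h) isOpen_Ioo h1 hc
  exact h3.congr' (eventually_of_mem hl he)

/-- If `f(1) = 0`, then `[𝒜 f](1) = 0` if and only if `[(x^{α+β} f_x)_x](1) = 0`. -/
lemma hasBoundaryValue_exprA_iff (hf : MemHloc 2 f) (h0 : HasBoundaryValue f (𝓝[<] 1) 0) :
    HasBoundaryValue (exprA α β μ f) (𝓝[<] 1) 0 ↔
      HasBoundaryValue (weakDeriv fun x => x ^ (α + β) * weakDeriv f x) (𝓝[<] 1) 0 := by
  have e1 := hf.exprA_ae_eq (α := α) (β := β) (μ := μ)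
  have e2 := (hf.weakDeriv.isWeakDeriv.rpow_mul (α + β)).ae_eq_weakDeriv
  constructor
  · intro h
    refine HasBoundaryValue.congr ?_
      (((h.rpow_mul_left_one β).add ((h0.rpow_mul_left_one (α + β - 2)).const_smul μ)).const_smul
        (-1))
    filter_upwards [e1, e2, ae_restrict_mem measurableSet_Ioo] with x hx1 hx2 hm
    have hX : x ^ α ≠ 0 := (Real.rpow_pos_of_pos hm.1 α).ne'
    have hx0 : x ≠ 0 := hm.1.ne'
    simp only [hx1, hx2, Pi.add_apply, Pi.smul_apply, smul_eq_mul, Real.rpow_sub hm.1,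
      Real.rpow_add hm.1, Real.rpow_one, Real.rpow_two]
    field_simp
    ring
  · intro h
    refine HasBoundaryValue.congr ?_
      (((h.rpow_mul_left_one (-β)).add ((h0.rpow_mul_left_one (α - 2)).const_smul μ)).const_smul
        (-1))
    filter_upwards [e1, e2, ae_restrict_mem measurableSet_Ioo] with x hx1 hx2 hm
    have hX : x ^ α ≠ 0 := (Real.rpow_pos_of_pos hm.1 α).ne'
    have hX' : x ^ β ≠ 0 := (Real.rpow_pos_of_pos hm.1 β).ne'
    have hx0 : x ≠ 0 := hm.1.ne'
    simp only [hx1, hx2, Pi.add_apply, Pi.smul_apply, smul_eq_mul, Real.rpow_sub hm.1,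
      Real.rpow_add hm.1, Real.rpow_one, Real.rpow_two, Real.rpow_neg hm.1.le]
    field_simp
    ring

/-! ### The second description of the domain of the square -/

lemma opA_coeFn {V : Submodule ℝ (L2w β)} (u : (opA α β μ V).domain) :
    opA α β μ V u =ᵐ[volume.restrict (Ioo 0 1)] exprA α β μ (u : L2w β) :=
  ae_w_iff.1 (MemLp.coeFn_toLp u.2.2.2)

lemma mem_opSq_opA_domain_iff {V : Submodule ℝ (L2w β)} (u : L2w β) :
    u ∈ (opSq (opA α β μ V)).domain ↔
      u ∈ V ∧ MemHloc 4 u ∧ (∃ h : MemLp (exprA α β μ u) 2 (wMeasure β), h.toLp _ ∈ V) ∧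
        MemLp (exprA2 α β μ u) 2 (wMeasure β) := by
  constructor
  · rintro ⟨h, h'⟩
    have hc := opA_coeFn ⟨u, h⟩
    have H2 : MemHloc 2 (exprA α β μ u) := h'.2.1.congr hc
    have H4 : MemHloc 4 u := h.2.1.of_exprA (h.2.1.of_exprA h.2.1 H2.of_succ) H2
    exact ⟨h.1, H4, ⟨h.2.2, h'.1⟩, (memLp_congr_ae (ae_w_iff.2
      ((exprA_congr hc).trans (exprA_exprA_ae_eq H4)))).1 h'.2.2⟩
  · rintro ⟨h1, h2, ⟨h3, h4⟩, h5⟩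
    have hu : u ∈ (opA α β μ V).domain := ⟨h1, h2.of_succ.of_succ, h3⟩
    have hc := opA_coeFn ⟨u, hu⟩
    exact ⟨hu, h4, h2.exprA.congr hc.symm, (memLp_congr_ae (ae_w_iff.2
      ((exprA_congr hc).trans (exprA_exprA_ae_eq h2)))).2 h5⟩

lemma opSq_opA_coeFn {V : Submodule ℝ (L2w β)} (u : (opSq (opA α β μ V)).domain) :
    opSq (opA α β μ V) u =ᵐ[wMeasure β] exprA2 α β μ (u : L2w β) := by
  have H4 := ((mem_opSq_opA_domain_iff (u : L2w β)).1 u.2).2.1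
  obtain ⟨u, h, h'⟩ := u
  exact ae_w_iff.2 ((opA_coeFn ⟨_, h'⟩).trans
    ((exprA_congr (opA_coeFn ⟨u, h⟩)).trans (exprA_exprA_ae_eq H4)))

lemma toLp_mem_H1N_iff (h : MemLp f 2 (wMeasure β)) : h.toLp f ∈ H1N α β ↔ MemH1N α β f := by
  have e := ae_w_iff.1 h.coeFn_toLp
  exact ⟨fun H => ⟨H.1.congr e, H.2.congr e⟩, fun H => ⟨H.1.congr e.symm, H.2.congr e.symm⟩⟩

lemma toLp_mem_H1D_iff (h : MemLp f 2 (wMeasure β)) : h.toLp f ∈ H1D α β ↔ MemH1D α β f := by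
  have e := ae_w_iff.1 h.coeFn_toLp
  exact ⟨fun H => ⟨H.1.congr e, H.2.1.congr e, H.2.2.congr e⟩,
    fun H => ⟨H.1.congr e.symm, H.2.1.congr e.symm, H.2.2.congr e.symm⟩⟩

lemma mem_A2D_domain_iff (u : L2w β) : u ∈ (A2D α β μ).domain ↔
    MemH1D α β u ∧ MemHloc 4 u ∧
      HasBoundaryValue (exprA α β μ u) (𝓝[>] 0) 0 ∧
      HasBoundaryValue (weakDeriv fun x => x ^ (α + β) * weakDeriv u x) (𝓝[<] 1) 0 ∧
      MemLp (exprA α β μ u) 2 (wMeasure β) ∧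
      MemLp (fun x => x ^ (α / 2) * weakDeriv (exprA α β μ u) x) 2 (wMeasure β) ∧
      MemLp (exprA2 α β μ u) 2 (wMeasure β) := by
  rw [A2D, mem_opSq_opA_domain_iff]
  constructor
  · rintro ⟨h1, h2, ⟨h3, h4⟩, h5⟩
    rw [toLp_mem_H1D_iff] at h4
    exact ⟨h1, h2, h4.2.1, (hasBoundaryValue_exprA_iff h2.of_succ.of_succ h1.2.2).1 h4.2.2, h3,
      h4.1.2.2, h5⟩
  · rintro ⟨h1, h2, h3, h4, h5, h6, h7⟩
    refine ⟨h1, h2, ⟨h5, (toLp_mem_H1D_iff h5).2 ⟨⟨h5, h2.exprA.of_succ, h6⟩, h3, ?_⟩⟩, h7⟩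
    exact (hasBoundaryValue_exprA_iff h2.of_succ.of_succ h1.2.2).2 h4

lemma mem_A2N_domain_iff (u : L2w β) : u ∈ (A2N α β μ).domain ↔
    MemH1N α β u ∧ MemHloc 4 u ∧ MemH1N α β (exprA α β μ u) ∧
      MemLp (exprA α β μ u) 2 (wMeasure β) ∧ MemLp (exprA2 α β μ u) 2 (wMeasure β) := by
  rw [A2N, mem_opSq_opA_domain_iff]
  constructor
  · rintro ⟨h1, h2, ⟨h3, h4⟩, h5⟩
    exact ⟨h1, h2, (toLp_mem_H1N_iff h3).1 h4, h3, h5⟩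
  · rintro ⟨h1, h2, h3, h4, h5⟩
    exact ⟨h1, h2, ⟨h4, (toLp_mem_H1N_iff h4).2 h3⟩, h5⟩

/-! ### Unbounded operators with a bounded symmetric inverse -/

section Abstract

variable {E : Type*} [NormedAddCommGroup E] [InnerProductSpace ℝ E]

/-- `T` is an everywhere defined two-sided inverse of the unbounded operator `A`. -/
structure IsBoundedInverse (A : E →ₗ.[ℝ] E) (T : E →L[ℝ] E) : Prop where
  mem : ∀ f, T f ∈ A.domain
  right : ∀ f, A ⟨T f, mem f⟩ = f
  left : ∀ u : A.domain, T (A u) = u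

lemma IsBoundedInverse.opSq {A : E →ₗ.[ℝ] E} {T : E →L[ℝ] E} (h : IsBoundedInverse A T) :
    IsBoundedInverse (opSq A) (T * T) where
  mem f := ⟨h.mem (T f), by
    have : A ⟨T (T f), h.mem (T f)⟩ = T f := h.right (T f)
    exact (congrArg (· ∈ A.domain) this).mpr (h.mem f)⟩
  right f := by
    change A ⟨A ⟨T (T f), _⟩, _⟩ = f
    have e : ∀ (v : E) (hv : v ∈ A.domain), v = T f → A ⟨v, hv⟩ = f := by
      rintro v hv rfl
      exact h.right f
    exact e _ _ (h.right (T f))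
  left := by
    rintro ⟨u, hu, hu'⟩
    change T (T (A ⟨A ⟨u, hu⟩, hu'⟩)) = u
    rw [h.left, h.left]

lemma IsBoundedInverse.injective {A : E →ₗ.[ℝ] E} {T : E →L[ℝ] E} (h : IsBoundedInverse A T) :
    Function.Injective T := by
  intro f g hfg
  rw [← h.right f, ← h.right g]
  congr 2

lemma IsBoundedInverse.exists_eq {A : E →ₗ.[ℝ] E} {T : E →L[ℝ] E} (h : IsBoundedInverse A T)
    (u : A.domain) : ∃ f, u = ⟨T f, h.mem f⟩ :=
  ⟨A u, Subtype.ext (h.left u).symm⟩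

/-- The range of an injective symmetric operator is dense. -/
lemma IsBoundedInverse.dense [CompleteSpace E] {A : E →ₗ.[ℝ] E} {T : E →L[ℝ] E}
    (h : IsBoundedInverse A T) (hT : (T : E →ₗ[ℝ] E).IsSymmetric) :
    Dense (A.domain : Set E) := by
  rw [Submodule.dense_iff_topologicalClosure_eq_top, Submodule.topologicalClosure_eq_top_iff,
    Submodule.eq_bot_iff]
  intro x hx
  refine h.injective ?_
  rw [map_zero]
  refine ext_inner_right ℝ fun v => ?_
  rw [inner_zero_left]
  have e : inner ℝ (T x) v = inner ℝ x (T v) := hT x v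
  rw [e, real_inner_comm]
  exact (Submodule.mem_orthogonal _ _).1 hx _ (h.mem v)

/-- The negative of the inverse of an injective bounded symmetric operator is self-adjoint. -/
lemma IsBoundedInverse.isSelfAdjoint_neg [CompleteSpace E] {A : E →ₗ.[ℝ] E} {T : E →L[ℝ] E}
    (h : IsBoundedInverse A T) (hT : (T : E →ₗ[ℝ] E).IsSymmetric) :
    IsSelfAdjoint (-A) := by
  have hd : Dense ((-A).domain : Set E) := h.dense hT
  have hT' : ∀ x y, inner ℝ (T x) y = inner ℝ x (T y) := hT
  have hneg : ∀ u : A.domain, (-A) u = -(A u) := fun u => LinearPMap.neg_apply A u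
  have hfa : (-A).IsFormalAdjoint (-A) := by
    intro x y
    obtain ⟨f, rfl⟩ := h.exists_eq x
    obtain ⟨g, rfl⟩ := h.exists_eq y
    rw [hneg, hneg, h.right, h.right]
    simp only [inner_neg_left, inner_neg_right]
    rw [hT']
  rw [LinearPMap.isSelfAdjoint_def]
  refine le_antisymm ?_ (hfa.le_adjoint hd)
  have key : ∀ y : (-A).adjoint.domain, (y : E) = T (-((-A).adjoint y)) := by
    intro y
    refine ext_inner_right ℝ fun v => ?_
    have e := LinearPMap.adjoint_isFormalAdjoint hd y ⟨T v, h.mem v⟩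
    rw [hneg, h.right] at e
    rw [hT', inner_neg_left, e, inner_neg_right, neg_neg]
  refine ⟨fun y hy => ?_, fun y z hyz => ?_⟩
  · have := key ⟨y, hy⟩
    simp only at this
    rw [this]
    exact h.mem _
  · have e1 := key y
    have : z = ⟨T (-((-A).adjoint y)), h.mem _⟩ := Subtype.ext (hyz ▸ e1)
    rw [this, hneg, h.right, neg_neg]

/-- The square of a symmetric operator with a bounded inverse is positive. -/
lemma IsBoundedInverse.inner_neg_opSq_lt_zero {A : E →ₗ.[ℝ] E} {T : E →L[ℝ] E}
    (h : IsBoundedInverse A T) (hT : (T : E →ₗ[ℝ] E).IsSymmetric)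
    (u : (-DegenerateBessel.opSq A).domain) (hu : u ≠ 0) :
    inner ℝ ((-DegenerateBessel.opSq A) u) (u : E) < 0 := by
  have hT' : ∀ x y, inner ℝ (T x) y = inner ℝ x (T y) := hT
  obtain ⟨f, rfl⟩ := h.opSq.exists_eq u
  have hneg := LinearPMap.neg_apply (DegenerateBessel.opSq A) ⟨(T * T) f, h.opSq.mem f⟩
  rw [hneg, h.opSq.right, inner_neg_left, neg_lt_zero]
  change 0 < inner ℝ f (T (T f))
  rw [← hT', real_inner_self_eq_norm_sq]
  have : T f ≠ 0 := by
    intro h0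
    refine hu (Subtype.ext ?_)
    change T (T f) = 0
    rw [h0, map_zero]
  positivity

end Abstract

/-! ### Integration against the weight -/

lemma integral_w (h : ℝ → ℝ) :
    ∫ x, h x ∂(wMeasure β) = ∫ x in Ioo 0 1, x ^ β * h x := by
  rw [wMeasure, integral_withDensity_eq_integral_toReal_smul (by fun_prop)
    (ae_of_all _ fun x => ENNReal.ofReal_lt_top)]
  refine setIntegral_congr_fun measurableSet_Ioo fun x hx => ?_
  simp only [smul_eq_mul]
  rw [ENNReal.toReal_ofReal (Real.rpow_nonneg hx.1.le β)]

lemma integrable_w_iff {h : ℝ → ℝ} :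
    Integrable h (wMeasure β) ↔ IntegrableOn (fun x => x ^ β * h x) (Ioo 0 1) := by
  rw [wMeasure, integrable_withDensity_iff_integrable_smul' (by fun_prop)
    (ae_of_all _ fun x => ENNReal.ofReal_lt_top)]
  refine integrableOn_congr_fun (fun x hx => ?_) measurableSet_Ioo
  simp only [smul_eq_mul]
  rw [ENNReal.toReal_ofReal (Real.rpow_nonneg hx.1.le β)]

instance : SFinite (wMeasure β) := by unfold wMeasure; infer_instance

lemma ae_w_mem : ∀ᵐ x ∂(wMeasure β), x ∈ Ioo (0 : ℝ) 1 := by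
  have : ∀ᵐ x ∂(volume.restrict (Ioo (0 : ℝ) 1)), x ∈ Ioo (0 : ℝ) 1 :=
    ae_restrict_mem measurableSet_Ioo
  exact (withDensity_absolutelyContinuous _ _).ae_le this

lemma aestronglyMeasurable_w_iff {h : ℝ → ℝ} :
    AEStronglyMeasurable h (wMeasure β) ↔ AEStronglyMeasurable h (volume.restrict (Ioo 0 1)) := by
  constructor
  · rintro ⟨k, hk, e⟩
    exact ⟨k, hk, ae_w_iff.1 e⟩
  · rintro ⟨k, hk, e⟩
    exact ⟨k, hk, ae_w_iff.2 e⟩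

lemma aestronglyMeasurable_w_of_continuousOn {h : ℝ → ℝ} (hh : ContinuousOn h (Ioo 0 1)) :
    AEStronglyMeasurable h (wMeasure β) :=
  aestronglyMeasurable_w_iff.2 (hh.aestronglyMeasurable measurableSet_Ioo)

lemma continuousOn_rpow_Ioo (a : ℝ) : ContinuousOn (fun x : ℝ => x ^ a) (Ioo 0 1) := fun x hx =>
  (Real.continuousAt_rpow_const x a (Or.inl hx.1.ne')).continuousWithinAt

lemma memLp_two_w_iff {h : ℝ → ℝ} (hm : AEStronglyMeasurable h (wMeasure β)) :
    MemLp h 2 (wMeasure β) ↔ IntegrableOn (fun x => x ^ β * h x ^ 2) (Ioo 0 1) := by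
  rw [memLp_two_iff_integrable_sq hm, integrable_w_iff]

lemma rpow_mul_sq {x : ℝ} (hx : 0 < x) (b r : ℝ) : x ^ b * (x ^ r) ^ 2 = x ^ (2 * r + b) := by
  rw [Real.rpow_add hx, two_mul, Real.rpow_add hx]
  ring

lemma memLp_rpow_w_iff {r : ℝ} :
    MemLp (fun x : ℝ => x ^ r) 2 (wMeasure β) ↔ -1 < 2 * r + β := by
  rw [memLp_two_w_iff (aestronglyMeasurable_w_of_continuousOn (continuousOn_rpow_Ioo r)),
    ← intervalIntegral.integrableOn_Ioo_rpow_iff one_pos]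
  exact integrableOn_congr_fun (fun x hx => rpow_mul_sq hx.1 β r) measurableSet_Ioo

/-- A measurable function bounded by a square integrable power is square integrable. -/
lemma memLp_w_of_le_rpow {h : ℝ → ℝ} (hh : AEStronglyMeasurable h (wMeasure β)) {C r : ℝ}
    (hr : -1 < 2 * r + β) (hb : ∀ x ∈ Ioo (0 : ℝ) 1, |h x| ≤ C * x ^ r) :
    MemLp h 2 (wMeasure β) := by
  refine (memLp_rpow_w_iff.2 hr).of_le_mul (c := C) hh ?_
  filter_upwards [ae_w_mem] with x hx
  rw [Real.norm_eq_abs, Real.norm_eq_abs, abs_of_nonneg (Real.rpow_nonneg hx.1.le r)]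
  exact hb x hx

lemma inner_toLp_w {h : ℝ → ℝ} (hh : MemLp h 2 (wMeasure β)) {k : ℝ → ℝ}
    (hk : MemLp k 2 (wMeasure β)) :
    inner ℝ (hh.toLp h) (hk.toLp k) = ∫ x, h x * k x ∂(wMeasure β) := by
  rw [L2.inner_def]
  refine integral_congr_ae ?_
  filter_upwards [hh.coeFn_toLp, hk.coeFn_toLp] with x hx hy
  rw [hx, hy]
  exact mul_comm _ _

lemma inner_w (u v : L2w β) : inner ℝ u v = ∫ x, u x * v x ∂(wMeasure β) := by
  rw [L2.inner_def]
  exact integral_congr_ae (ae_of_all _ fun x => mul_comm _ _)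

/-- Cauchy–Schwarz in `L²_β(0,1)`. -/
lemma abs_integral_mul_le {h k : ℝ → ℝ} (hh : MemLp h 2 (wMeasure β))
    (hk : MemLp k 2 (wMeasure β)) :
    |∫ x, h x * k x ∂(wMeasure β)| ≤
      √(∫ x, h x ^ 2 ∂(wMeasure β)) * (eLpNorm k 2 (wMeasure β)).toReal := by
  rw [← inner_toLp_w hh hk]
  refine (abs_real_inner_le_norm _ _).trans (le_of_eq ?_)
  rw [Lp.norm_toLp k hk]
  congr 1
  rw [← Real.sqrt_sq (norm_nonneg (hh.toLp h)), ← real_inner_self_eq_norm_sq, inner_toLp_w hh hh]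
  simp only [pow_two]

lemma MemLp.integrable_mul_w {h k : ℝ → ℝ} (hh : MemLp h 2 (wMeasure β))
    (hk : MemLp k 2 (wMeasure β)) : Integrable (fun x => h x * k x) (wMeasure β) :=
  MemLp.integrable_mul hh hk

lemma MemLp.memL2loc {h : ℝ → ℝ} (hh : MemLp h 2 (wMeasure β)) : MemL2loc h := by
  intro K hK hc
  have hm := aestronglyMeasurable_w_iff.1 hh.1
  have hm' : AEStronglyMeasurable h (volume.restrict K) :=
    hm.mono_measure (Measure.restrict_mono hK le_rfl)
  rw [memLp_two_iff_integrable_sq hm']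
  have h1 := ((memLp_two_w_iff hh.1).1 hh).mono_set hK
  have hcont : ContinuousOn (fun x : ℝ => x ^ (-β)) K := (continuousOn_rpow_Ioo _).mono hK
  refine (h1.continuousOn_mul hcont hc).congr_fun (fun x hx => ?_) hc.measurableSet
  have := Real.rpow_pos_of_pos (hK hx).1 β
  simp only [Real.rpow_neg (hK hx).1.le]
  field_simp

lemma MemL2loc.locallyIntegrableOn {h : ℝ → ℝ} (hh : MemL2loc h) :
    LocallyIntegrableOn h (Ioo 0 1) := by
  rw [locallyIntegrableOn_iff isOpen_Ioo.isLocallyClosed]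
  intro K hK hc
  have : IsFiniteMeasure (volume.restrict K) := ⟨by
    rw [Measure.restrict_apply_univ]; exact hc.measure_lt_top⟩
  exact (hh K hK hc).integrable (by norm_num)

lemma setIntegral_Iio_w {h : ℝ → ℝ} {x : ℝ} (hx : x ∈ Ioo (0 : ℝ) 1) :
    ∫ y in Iio x, h y ∂(wMeasure β) = ∫ y in (0 : ℝ)..x, y ^ β * h y := by
  rw [← integral_indicator measurableSet_Iio, integral_w,
    intervalIntegral.integral_of_le hx.1.le, integral_Ioc_eq_integral_Ioo,
    ← integral_indicator measurableSet_Ioo, ← integral_indicator measurableSet_Ioo]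
  congr 1
  ext y
  by_cases h1 : y ∈ Ioo (0 : ℝ) x
  · rw [indicator_of_mem h1, indicator_of_mem (show y ∈ Ioo (0 : ℝ) 1 from ⟨h1.1, h1.2.trans hx.2⟩),
      indicator_of_mem (show y ∈ Iio x from h1.2)]
  · rw [indicator_of_notMem h1]
    by_cases h2 : y ∈ Ioo (0 : ℝ) 1
    · rw [indicator_of_mem h2, indicator_of_notMem (fun h3 : y ∈ Iio x => h1 ⟨h2.1, h3⟩), mul_zero]
    · rw [indicator_of_notMem h2]

lemma setIntegral_Ioi_w {h : ℝ → ℝ} {x : ℝ} (hx : x ∈ Ioo (0 : ℝ) 1) :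
    ∫ y in Ioi x, h y ∂(wMeasure β) = ∫ y in x..1, y ^ β * h y := by
  rw [← integral_indicator measurableSet_Ioi, integral_w,
    intervalIntegral.integral_of_le hx.2.le, integral_Ioc_eq_integral_Ioo,
    ← integral_indicator measurableSet_Ioo, ← integral_indicator measurableSet_Ioo]
  congr 1
  ext y
  by_cases h1 : y ∈ Ioo x 1
  · rw [indicator_of_mem h1, indicator_of_mem (show y ∈ Ioo (0 : ℝ) 1 from ⟨hx.1.trans h1.1, h1.2⟩),
      indicator_of_mem (show y ∈ Ioi x from h1.1)]
  · rw [indicator_of_notMem h1]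
    by_cases h2 : y ∈ Ioo (0 : ℝ) 1
    · rw [indicator_of_mem h2, indicator_of_notMem (fun h3 : y ∈ Ioi x => h1 ⟨h3, h2.2⟩), mul_zero]
    · rw [indicator_of_notMem h2]

lemma IntegrableOn.intervalIntegrable_Iio_w {h : ℝ → ℝ} {x : ℝ} (hx : x ∈ Ioo (0 : ℝ) 1)
    (hh : IntegrableOn h (Iio x) (wMeasure β)) :
    IntervalIntegrable (fun y => y ^ β * h y) volume 0 x := by
  rw [intervalIntegrable_iff_integrableOn_Ioo_of_le hx.1.le]
  rw [← integrable_indicator_iff measurableSet_Iio, integrable_w_iff] at hh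
  refine (hh.mono_set (Ioo_subset_Ioo_right hx.2.le)).congr_fun (fun y hy => ?_) measurableSet_Ioo
  simp only
  rw [indicator_of_mem (show y ∈ Iio x from hy.2)]

lemma IntegrableOn.intervalIntegrable_Ioi_w {h : ℝ → ℝ} {x : ℝ} (hx : x ∈ Ioo (0 : ℝ) 1)
    (hh : IntegrableOn h (Ioi x) (wMeasure β)) :
    IntervalIntegrable (fun y => y ^ β * h y) volume x 1 := by
  rw [intervalIntegrable_iff_integrableOn_Ioo_of_le hx.2.le]
  rw [← integrable_indicator_iff measurableSet_Ioi, integrable_w_iff] at hh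
  refine (hh.mono_set (Ioo_subset_Ioo_left hx.1.le)).congr_fun (fun y hy => ?_) measurableSet_Ioo
  simp only
  rw [indicator_of_mem (show y ∈ Ioi x from hy.1)]

/-! ### The Green operator -/

/-- The parameters for which `𝒜` is subcritical. -/
structure Subcritical (α β μ : ℝ) : Prop where
  lt_two : α < 2
  lt_muCrit : μ < muCrit (α + β)

/-- `γ = (1-α-β)/2`, half the sum of the indicial exponents of `𝒜`. -/
def gam (α β : ℝ) : ℝ := (1 - α - β) / 2

/-- `σ = √(μ(α+β) - μ)`, half the difference of the indicial exponents of `𝒜`. -/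
def sig (α β μ : ℝ) : ℝ := √(muCrit (α + β) - μ)

/-- The larger exponent `r` with `𝒜 x^r = 0`. -/
def rp (α β μ : ℝ) : ℝ := gam α β + sig α β μ

/-- The smaller exponent `r` with `𝒜 x^r = 0`. -/
def rq (α β μ : ℝ) : ℝ := gam α β - sig α β μ

/-- The gain `ε` in the estimate `|u(x)| ≤ C x^{γ+ε}` for `u` in the range of the Green operator. -/
def eps (α β μ : ℝ) : ℝ := min (kappa α) (sig α β μ) / 2

namespace Subcritical

lemma kappa_pos (h : Subcritical α β μ) : 0 < kappa α := by
  have := h.lt_two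
  unfold kappa
  linarith

lemma sig_pos (h : Subcritical α β μ) : 0 < sig α β μ :=
  Real.sqrt_pos.2 (by linarith [h.lt_muCrit])

lemma eps_pos (h : Subcritical α β μ) : 0 < eps α β μ :=
  half_pos (lt_min h.kappa_pos h.sig_pos)

lemma eps_lt_kappa (h : Subcritical α β μ) : eps α β μ < kappa α := by
  have := min_le_left (kappa α) (sig α β μ)
  have := h.kappa_pos
  unfold eps
  linarith

lemma eps_lt_sig (h : Subcritical α β μ) : eps α β μ < sig α β μ := by
  have := min_le_right (kappa α) (sig α β μ)
  have := h.sig_pos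
  unfold eps
  linarith

lemma rp_mul_rq (h : Subcritical α β μ) : rp α β μ * rq α β μ = μ := by
  have e : sig α β μ ^ 2 = muCrit (α + β) - μ := Real.sq_sqrt (by linarith [h.lt_muCrit])
  unfold rp rq
  have : (gam α β + sig α β μ) * (gam α β - sig α β μ) = gam α β ^ 2 - sig α β μ ^ 2 := by ring
  rw [this, e, gam, muCrit]
  ring

end Subcritical

lemma rp_add_rq : rp α β μ + rq α β μ = 1 - α - β := by
  unfold rp rq gam
  ring

lemma rp_sub_rq : rp α β μ - rq α β μ = 2 * sig α β μ := by
  unfold rp rq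
  ring

lemma two_gam_add : 2 * gam α β + β = 2 * kappa α - 1 := by
  unfold gam kappa
  ring

/-- `x ↦ ∫_0^x y^p f(y) y^β dy` with `p` the larger indicial exponent. -/
def greenL (α β μ : ℝ) (f : ℝ → ℝ) (x : ℝ) : ℝ :=
  ∫ y in Iio x, y ^ rp α β μ * f y ∂(wMeasure β)

/-- `x ↦ ∫_x^1 (y^q - y^p) f(y) y^β dy` with `p > q` the indicial exponents. -/
def greenR (α β μ : ℝ) (f : ℝ → ℝ) (x : ℝ) : ℝ :=
  ∫ y in Ioi x, (y ^ rq α β μ - y ^ rp α β μ) * f y ∂(wMeasure β)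

/-- The solution of `𝒜 u = f` given by the Green function. -/
def green (α β μ : ℝ) (f : ℝ → ℝ) (x : ℝ) : ℝ :=
  (x ^ rp α β μ * greenR α β μ f x
    + (x ^ rq α β μ - x ^ rp α β μ) * greenL α β μ f x) / (2 * sig α β μ)

/-- The derivative of `green`. -/
def greenDeriv (α β μ : ℝ) (f : ℝ → ℝ) (x : ℝ) : ℝ :=
  (rp α β μ * x ^ (rp α β μ - 1) * greenR α β μ f x
    + (rq α β μ * x ^ (rq α β μ - 1) - rp α β μ * x ^ (rp α β μ - 1)) * greenL α β μ f x)
      / (2 * sig α β μ)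

namespace Subcritical

lemma memLp_indicator_Iio (h : Subcritical α β μ) (x : ℝ) :
    MemLp ((Iio x).indicator fun y => y ^ rp α β μ) 2 (wMeasure β) := by
  refine MemLp.indicator measurableSet_Iio (memLp_rpow_w_iff.2 ?_)
  have := h.kappa_pos
  have := h.sig_pos
  have := two_gam_add (α := α) (β := β)
  unfold rp
  linarith

lemma rpow_le_rpow_of_lt_one {x a b : ℝ} (hx : x ∈ Ioo (0 : ℝ) 1) (hab : a ≤ b) :
    x ^ b ≤ x ^ a := Real.rpow_le_rpow_of_exponent_ge hx.1 hx.2.le hab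

lemma rq_le_rp (h : Subcritical α β μ) : rq α β μ ≤ rp α β μ := by
  have := h.sig_pos
  unfold rq rp
  linarith

lemma aestronglyMeasurable_kernelR (x : ℝ) : AEStronglyMeasurable
    ((Ioi x).indicator fun y => y ^ rq α β μ - y ^ rp α β μ) (wMeasure β) :=
  (aestronglyMeasurable_w_of_continuousOn
    ((continuousOn_rpow_Ioo _).sub (continuousOn_rpow_Ioo _))).indicator measurableSet_Ioi

lemma memLp_indicator_Ioi {x : ℝ} (hx : x ∈ Ioo (0 : ℝ) 1) :
    MemLp ((Ioi x).indicator fun y => y ^ rq α β μ - y ^ rp α β μ) 2 (wMeasure β) := by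
  rw [memLp_two_w_iff (aestronglyMeasurable_kernelR x)]
  have hI : IntegrableOn (fun y : ℝ => y ^ β * (y ^ rq α β μ - y ^ rp α β μ) ^ 2) (Icc x 1) := by
    have hc : ∀ a : ℝ, ContinuousOn (fun y : ℝ => y ^ a) (Icc x 1) := fun a y hy =>
      (Real.continuousAt_rpow_const y a (Or.inl (hx.1.trans_le hy.1).ne')).continuousWithinAt
    exact ((hc _).mul (((hc _).sub (hc _)).pow 2)).integrableOn_Icc
  rw [← integrable_indicator_iff measurableSet_Ioo]
  refine ((integrable_indicator_iff measurableSet_Icc).2 hI).mono' ?_ (ae_of_all _ fun y => ?_)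
  · have := aestronglyMeasurable_w_iff.1 (aestronglyMeasurable_kernelR (α := α) (β := β) (μ := μ) x)
    exact (aestronglyMeasurable_indicator_iff measurableSet_Ioo).2
      (((continuousOn_rpow_Ioo β).aestronglyMeasurable measurableSet_Ioo).mul (this.pow 2))
  · by_cases hy : y ∈ Ioo (0 : ℝ) 1
    · by_cases hxy : y ∈ Ioi x
      · rw [indicator_of_mem hy, indicator_of_mem hxy,
          indicator_of_mem (show y ∈ Icc x 1 from ⟨le_of_lt hxy, hy.2.le⟩), Real.norm_eq_abs,
          abs_of_nonneg (mul_nonneg (Real.rpow_nonneg hy.1.le _) (sq_nonneg _))]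
      · rw [indicator_of_mem hy, indicator_of_notMem hxy]
        simp only [ne_eq, OfNat.ofNat_ne_zero, not_false_eq_true, zero_pow, mul_zero, norm_zero]
        exact indicator_nonneg (fun z hz => mul_nonneg
          (Real.rpow_nonneg (hx.1.le.trans hz.1) _) (sq_nonneg _)) y
    · rw [indicator_of_notMem hy, norm_zero]
      exact indicator_nonneg (fun z hz => mul_nonneg
          (Real.rpow_nonneg (hx.1.le.trans hz.1) _) (sq_nonneg _)) y

lemma greenL_eq (x : ℝ) (f : ℝ → ℝ) : greenL α β μ f x =
    ∫ y, (Iio x).indicator (fun y => y ^ rp α β μ) y * f y ∂(wMeasure β) := by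
  rw [greenL, ← integral_indicator measurableSet_Iio]
  exact integral_congr_ae (ae_of_all _ fun y => indicator_mul_left _ _ _)

lemma greenR_eq (x : ℝ) (f : ℝ → ℝ) : greenR α β μ f x =
    ∫ y, (Ioi x).indicator (fun y => y ^ rq α β μ - y ^ rp α β μ) y * f y ∂(wMeasure β) := by
  rw [greenR, ← integral_indicator measurableSet_Ioi]
  exact integral_congr_ae (ae_of_all _ fun y => indicator_mul_left _ _ _)

/-- The bound is a power slightly worse than the exact one `x^{2(σ+κ)}`, chosen so that it combines
with the bound of `integral_kernelR_sq_le` to the factor `x^{γ+ε}` in `abs_green_le`. -/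
lemma integral_kernelL_sq_le (h : Subcritical α β μ) {x : ℝ} (hx : x ∈ Ioo (0 : ℝ) 1) :
    ∫ y, (Iio x).indicator (fun y => y ^ rp α β μ) y ^ 2 ∂(wMeasure β)
      ≤ (2 * (sig α β μ + kappa α))⁻¹ * (x ^ (sig α β μ + eps α β μ)) ^ 2 := by
  have hk := h.kappa_pos
  have hs := h.sig_pos
  have e1 : ∫ y, (Iio x).indicator (fun y => y ^ rp α β μ) y ^ 2 ∂(wMeasure β)
      = ∫ y in Iio x, (y ^ rp α β μ) ^ 2 ∂(wMeasure β) := by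
    rw [← integral_indicator measurableSet_Iio]
    refine integral_congr_ae (ae_of_all _ fun y => ?_)
    by_cases hy : y ∈ Iio x
    · simp only [indicator_of_mem hy]
    · simp only [indicator_of_notMem hy]; norm_num
  have e2 : ∫ y in (0 : ℝ)..x, y ^ β * (y ^ rp α β μ) ^ 2
      = ∫ y in (0 : ℝ)..x, y ^ (2 * (sig α β μ + kappa α) - 1) := by
    refine intervalIntegral.integral_congr_ae (ae_of_all _ fun y hy => ?_)
    rw [uIoc_of_le hx.1.le] at hy
    rw [rpow_mul_sq hy.1]
    congr 1
    have := two_gam_add (α := α) (β := β)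
    unfold rp
    linarith
  rw [e1, setIntegral_Iio_w hx, e2, integral_rpow (Or.inl (by linarith)), sub_add_cancel,
    Real.zero_rpow (by positivity), sub_zero, div_eq_inv_mul]
  refine mul_le_mul_of_nonneg_left ?_ (by positivity)
  rw [← Real.rpow_natCast, ← Real.rpow_mul hx.1.le]
  refine rpow_le_rpow_of_lt_one hx ?_
  push_cast
  linarith [h.eps_lt_kappa]

/-- Since `2q + β + 1 = 2(κ-σ)`, the exact behaviour at `0` depends on the sign of `κ - σ`, with a
logarithm when `κ = σ`. Giving up to `x^{-2(σ-ε)}` with `0 < ε < min κ σ` treats all cases at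
once. -/
lemma integral_kernelR_sq_le (h : Subcritical α β μ) {x : ℝ} (hx : x ∈ Ioo (0 : ℝ) 1) :
    ∫ y, (Ioi x).indicator (fun y => y ^ rq α β μ - y ^ rp α β μ) y ^ 2 ∂(wMeasure β)
      ≤ (2 * (sig α β μ - eps α β μ))⁻¹ * (x ^ (-sig α β μ + eps α β μ)) ^ 2 := by
  have hk := h.kappa_pos
  have hs := h.sig_pos
  have he := h.eps_pos
  have hes := h.eps_lt_sig
  have hek := h.eps_lt_kappa
  have e1 : ∫ y, (Ioi x).indicator (fun y => y ^ rq α β μ - y ^ rp α β μ) y ^ 2 ∂(wMeasure β)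
      = ∫ y in Ioi x, (y ^ rq α β μ - y ^ rp α β μ) ^ 2 ∂(wMeasure β) := by
    rw [← integral_indicator measurableSet_Ioi]
    refine integral_congr_ae (ae_of_all _ fun y => ?_)
    by_cases hy : y ∈ Ioi x
    · simp only [indicator_of_mem hy]
    · simp only [indicator_of_notMem hy]; norm_num
  have hc : ∀ a : ℝ, ContinuousOn (fun y : ℝ => y ^ a) (uIcc x 1) := fun a y hy => by
    rw [uIcc_of_le hx.2.le] at hy
    exact (Real.continuousAt_rpow_const y a (Or.inl (hx.1.trans_le hy.1).ne')).continuousWithinAt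
  have e2 : ∫ y in x..1, y ^ β * (y ^ rq α β μ - y ^ rp α β μ) ^ 2
      ≤ ∫ y in x..1, y ^ (-(2 * (sig α β μ - eps α β μ)) - 1) := by
    refine intervalIntegral.integral_mono_on_of_le_Ioo hx.2.le
      ((hc _).mul (((hc _).sub (hc _)).pow 2)).intervalIntegrable (hc _).intervalIntegrable
      fun y hy => ?_
    have hy' : y ∈ Ioo (0 : ℝ) 1 := ⟨hx.1.trans hy.1, hy.2⟩
    have b1 : y ^ rp α β μ ≤ y ^ rq α β μ := rpow_le_rpow_of_lt_one hy' h.rq_le_rp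
    have b2 := Real.rpow_nonneg hy'.1.le (rp α β μ)
    calc y ^ β * (y ^ rq α β μ - y ^ rp α β μ) ^ 2 ≤ y ^ β * (y ^ rq α β μ) ^ 2 := by
          refine mul_le_mul_of_nonneg_left ?_ (Real.rpow_nonneg hy'.1.le _)
          exact pow_le_pow_left₀ (by linarith) (by linarith) 2
      _ = y ^ (2 * rq α β μ + β) := rpow_mul_sq hy'.1 _ _
      _ ≤ _ := by
        refine rpow_le_rpow_of_lt_one hy' ?_
        have := two_gam_add (α := α) (β := β)
        unfold rq
        linarith
  rw [e1, setIntegral_Ioi_w hx]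
  refine e2.trans ?_
  rw [integral_rpow (Or.inr ⟨by linarith, by
    rw [uIcc_of_le hx.2.le]; exact fun h0 => absurd h0.1 (not_le.2 hx.1)⟩), sub_add_cancel,
    Real.one_rpow, div_neg, ← neg_div, neg_sub, div_eq_inv_mul]
  refine mul_le_mul_of_nonneg_left ?_ (inv_nonneg.2 (by linarith))
  rw [← Real.rpow_natCast, ← Real.rpow_mul hx.1.le]
  have : -sig α β μ + eps α β μ = -(sig α β μ - eps α β μ) := by ring
  rw [this]
  have e3 : -(sig α β μ - eps α β μ) * ((2 : ℕ) : ℝ) = -(2 * (sig α β μ - eps α β μ)) := by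
    push_cast; ring
  rw [e3]
  linarith

end Subcritical

/-- A constant for the estimates of `greenL` and `greenR`. -/
def greenConst (α β μ : ℝ) : ℝ :=
  √((2 * (sig α β μ + kappa α))⁻¹) + √((2 * (sig α β μ - eps α β μ))⁻¹)

lemma greenConst_nonneg : 0 ≤ greenConst α β μ :=
  add_nonneg (Real.sqrt_nonneg _) (Real.sqrt_nonneg _)

namespace Subcritical

lemma abs_greenL_le (h : Subcritical α β μ) (hf : MemLp f 2 (wMeasure β)) {x : ℝ}
    (hx : x ∈ Ioo (0 : ℝ) 1) : |greenL α β μ f x| ≤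
      greenConst α β μ * x ^ (sig α β μ + eps α β μ) * (eLpNorm f 2 (wMeasure β)).toReal := by
  rw [greenL_eq]
  refine (abs_integral_mul_le (h.memLp_indicator_Iio x) hf).trans ?_
  refine mul_le_mul_of_nonneg_right ?_ ENNReal.toReal_nonneg
  refine (Real.sqrt_le_sqrt (h.integral_kernelL_sq_le hx)).trans ?_
  have hX := Real.rpow_nonneg hx.1.le (sig α β μ + eps α β μ)
  rw [Real.sqrt_mul' _ (sq_nonneg _), Real.sqrt_sq hX]
  exact mul_le_mul_of_nonneg_right (le_add_of_nonneg_right (Real.sqrt_nonneg _)) hX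

lemma abs_greenR_le (h : Subcritical α β μ) (hf : MemLp f 2 (wMeasure β)) {x : ℝ}
    (hx : x ∈ Ioo (0 : ℝ) 1) : |greenR α β μ f x| ≤
      greenConst α β μ * x ^ (-sig α β μ + eps α β μ) * (eLpNorm f 2 (wMeasure β)).toReal := by
  rw [greenR_eq]
  refine (abs_integral_mul_le (memLp_indicator_Ioi hx) hf).trans ?_
  refine mul_le_mul_of_nonneg_right ?_ ENNReal.toReal_nonneg
  refine (Real.sqrt_le_sqrt (h.integral_kernelR_sq_le hx)).trans ?_
  have hX := Real.rpow_nonneg hx.1.le (-sig α β μ + eps α β μ)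
  rw [Real.sqrt_mul' _ (sq_nonneg _), Real.sqrt_sq hX]
  exact mul_le_mul_of_nonneg_right (le_add_of_nonneg_left (Real.sqrt_nonneg _)) hX

/-- The pointwise estimate `|u(x)| ≤ C ‖f‖ x^{γ+ε}` for the Green operator: the right side is square
integrable for the weight, which gives boundedness and a dominating function for compactness. -/
lemma abs_green_le (h : Subcritical α β μ) (hf : MemLp f 2 (wMeasure β)) {x : ℝ}
    (hx : x ∈ Ioo (0 : ℝ) 1) : |green α β μ f x| ≤
      greenConst α β μ / sig α β μ * (eLpNorm f 2 (wMeasure β)).toReal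
        * x ^ (gam α β + eps α β μ) := by
  have hs := h.sig_pos
  have h1 := h.abs_greenL_le hf hx
  have h2 := h.abs_greenR_le hf hx
  set N := (eLpNorm f 2 (wMeasure β)).toReal
  set C := greenConst α β μ
  have b1 : x ^ rp α β μ ≤ x ^ rq α β μ := rpow_le_rpow_of_lt_one hx h.rq_le_rp
  have b2 := Real.rpow_nonneg hx.1.le (rp α β μ)
  have b3 := Real.rpow_nonneg hx.1.le (rq α β μ)
  have e1 : x ^ rp α β μ * x ^ (-sig α β μ + eps α β μ) = x ^ (gam α β + eps α β μ) := by
    rw [← Real.rpow_add hx.1]; congr 1; unfold rp; ring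
  have e2 : x ^ rq α β μ * x ^ (sig α β μ + eps α β μ) = x ^ (gam α β + eps α β μ) := by
    rw [← Real.rpow_add hx.1]; congr 1; unfold rq; ring
  rw [green, abs_div, abs_of_pos (by positivity : 0 < 2 * sig α β μ), div_le_iff₀ (by positivity)]
  calc |x ^ rp α β μ * greenR α β μ f x + (x ^ rq α β μ - x ^ rp α β μ) * greenL α β μ f x|
      ≤ |x ^ rp α β μ * greenR α β μ f x|
        + |(x ^ rq α β μ - x ^ rp α β μ) * greenL α β μ f x| := abs_add_le _ _
    _ ≤ x ^ rp α β μ * (C * x ^ (-sig α β μ + eps α β μ) * N)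
        + x ^ rq α β μ * (C * x ^ (sig α β μ + eps α β μ) * N) := by
      rw [abs_mul, abs_mul, abs_of_nonneg b2,
        abs_of_nonneg (by linarith : 0 ≤ x ^ rq α β μ - x ^ rp α β μ)]
      refine add_le_add (mul_le_mul_of_nonneg_left h2 b2)
        (mul_le_mul (by linarith) h1 (abs_nonneg _) b3)
    _ = C * N * (x ^ rp α β μ * x ^ (-sig α β μ + eps α β μ))
        + C * N * (x ^ rq α β μ * x ^ (sig α β μ + eps α β μ)) := by ring
    _ = C / sig α β μ * N * x ^ (gam α β + eps α β μ) * (2 * sig α β μ) := by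
      rw [e1, e2]
      field_simp
      ring

lemma abs_greenDeriv_le (h : Subcritical α β μ) (hf : MemLp f 2 (wMeasure β)) : ∃ C : ℝ,
    ∀ x ∈ Ioo (0 : ℝ) 1, |greenDeriv α β μ f x| ≤ C * x ^ (gam α β + eps α β μ - 1) := by
  have hs := h.sig_pos
  set N := (eLpNorm f 2 (wMeasure β)).toReal
  set C := greenConst α β μ
  have hC : 0 ≤ C := greenConst_nonneg
  have hN : 0 ≤ N := ENNReal.toReal_nonneg
  refine ⟨(|rp α β μ| * (C * N) + (|rq α β μ| + |rp α β μ|) * (C * N)) / (2 * sig α β μ),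
    fun x hx => ?_⟩
  have h1 : |greenL α β μ f x| ≤ C * x ^ (sig α β μ + eps α β μ) * N := h.abs_greenL_le hf hx
  have h2 : |greenR α β μ f x| ≤ C * x ^ (-sig α β μ + eps α β μ) * N := h.abs_greenR_le hf hx
  have b1 : x ^ (rp α β μ - 1) ≤ x ^ (rq α β μ - 1) :=
    rpow_le_rpow_of_lt_one hx (by linarith [h.rq_le_rp])
  have b2 := Real.rpow_nonneg hx.1.le (rp α β μ - 1)
  have b3 := Real.rpow_nonneg hx.1.le (rq α β μ - 1)
  have e1 : x ^ (rp α β μ - 1) * x ^ (-sig α β μ + eps α β μ)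
      = x ^ (gam α β + eps α β μ - 1) := by
    rw [← Real.rpow_add hx.1]; congr 1; unfold rp; ring
  have e2 : x ^ (rq α β μ - 1) * x ^ (sig α β μ + eps α β μ)
      = x ^ (gam α β + eps α β μ - 1) := by
    rw [← Real.rpow_add hx.1]; congr 1; unfold rq; ring
  rw [greenDeriv, abs_div, abs_of_pos (by positivity : 0 < 2 * sig α β μ), div_mul_eq_mul_div]
  refine div_le_div_of_nonneg_right ?_ (by positivity)
  have c1 : |rp α β μ * x ^ (rp α β μ - 1) * greenR α β μ f x|
      ≤ |rp α β μ| * x ^ (rp α β μ - 1) * (C * x ^ (-sig α β μ + eps α β μ) * N) := by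
    rw [abs_mul, abs_mul, abs_of_nonneg b2]
    exact mul_le_mul_of_nonneg_left h2 (by positivity)
  have c2 : |(rq α β μ * x ^ (rq α β μ - 1) - rp α β μ * x ^ (rp α β μ - 1)) * greenL α β μ f x|
      ≤ (|rq α β μ| + |rp α β μ|) * x ^ (rq α β μ - 1) * (C * x ^ (sig α β μ + eps α β μ) * N) := by
    rw [abs_mul]
    refine mul_le_mul ?_ h1 (abs_nonneg _) (by positivity)
    refine (abs_sub _ _).trans ?_
    rw [abs_mul, abs_mul, abs_of_nonneg b2, abs_of_nonneg b3, add_mul]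
    exact add_le_add le_rfl (mul_le_mul_of_nonneg_left b1 (abs_nonneg _))
  refine (abs_add_le _ _).trans ((add_le_add c1 c2).trans (le_of_eq ?_))
  calc _ = |rp α β μ| * (C * N) * (x ^ (rp α β μ - 1) * x ^ (-sig α β μ + eps α β μ))
        + (|rq α β μ| + |rp α β μ|) * (C * N)
          * (x ^ (rq α β μ - 1) * x ^ (sig α β μ + eps α β μ)) := by ring
    _ = _ := by rw [e1, e2]; ring

end Subcritical

/-! ### The Green operator solves `𝒜 u = f` -/

namespace Subcritical

lemma greenL_sub (h : Subcritical α β μ) (hf : MemLp f 2 (wMeasure β)) {x y : ℝ}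
    (hx : x ∈ Ioo (0 : ℝ) 1) (hy : y ∈ Ioo (0 : ℝ) 1) :
    greenL α β μ f y - greenL α β μ f x = ∫ t in x..y, t ^ β * (t ^ rp α β μ * f t) := by
  have hi : ∀ z ∈ Ioo (0 : ℝ) 1,
      IntervalIntegrable (fun t => t ^ β * (t ^ rp α β μ * f t)) volume 0 z := by
    intro z hz
    refine IntegrableOn.intervalIntegrable_Iio_w hz ?_
    rw [← integrable_indicator_iff measurableSet_Iio]
    refine (MemLp.integrable_mul_w (h.memLp_indicator_Iio z) hf).congr
      (ae_of_all _ fun t => ?_)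
    exact (indicator_mul_left _ _ _).symm
  rw [greenL, greenL, setIntegral_Iio_w hx, setIntegral_Iio_w hy,
    intervalIntegral.integral_interval_sub_left (hi y hy) (hi x hx)]

lemma greenR_intervalIntegrable (hf : MemLp f 2 (wMeasure β)) {z : ℝ} (hz : z ∈ Ioo (0 : ℝ) 1) :
    IntervalIntegrable (fun t => t ^ β * ((t ^ rq α β μ - t ^ rp α β μ) * f t)) volume z 1 := by
  refine IntegrableOn.intervalIntegrable_Ioi_w hz ?_
  rw [← integrable_indicator_iff measurableSet_Ioi]
  refine (MemLp.integrable_mul_w (memLp_indicator_Ioi (α := α) (μ := μ) hz) hf).congr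
    (ae_of_all _ fun t => ?_)
  exact (indicator_mul_left _ _ _).symm

lemma greenR_sub (hf : MemLp f 2 (wMeasure β)) {x y : ℝ}
    (hx : x ∈ Ioo (0 : ℝ) 1) (hy : y ∈ Ioo (0 : ℝ) 1) :
    greenR α β μ f y - greenR α β μ f x
      = ∫ t in x..y, -(t ^ β * ((t ^ rq α β μ - t ^ rp α β μ) * f t)) := by
  have hi : ∀ z ∈ Ioo (0 : ℝ) 1, _ := fun z hz =>
    greenR_intervalIntegrable (α := α) (μ := μ) hf hz
  rw [greenR, greenR, setIntegral_Ioi_w hx, setIntegral_Ioi_w hy, intervalIntegral.integral_neg,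
    ← intervalIntegral.integral_add_adjacent_intervals ((hi x hx).trans (hi y hy).symm) (hi y hy)]
  ring

lemma locallyIntegrableOn_densityL (hf : MemLp f 2 (wMeasure β)) :
    LocallyIntegrableOn (fun t => t ^ β * (t ^ rp α β μ * f t)) (Ioo 0 1) :=
  locInt_rpow_mul _ (locInt_rpow_mul _ (MemL2loc.locallyIntegrableOn (MemLp.memL2loc hf)))

lemma locallyIntegrableOn_densityR (hf : MemLp f 2 (wMeasure β)) :
    LocallyIntegrableOn (fun t => -(t ^ β * ((t ^ rq α β μ - t ^ rp α β μ) * f t))) (Ioo 0 1) := by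
  have hl := MemL2loc.locallyIntegrableOn (MemLp.memL2loc hf)
  have := (locInt_rpow_mul β
    ((locInt_rpow_mul (rq α β μ) hl).sub (locInt_rpow_mul (rp α β μ) hl))).neg
  refine locInt_congr (.of_eq ?_) this
  ext t
  simp only [Pi.neg_apply, Pi.sub_apply]
  ring

lemma continuousOn_greenL (h : Subcritical α β μ) (hf : MemLp f 2 (wMeasure β)) :
    ContinuousOn (greenL α β μ f) (Ioo 0 1) :=
  continuousOn_of_sub_eq_integral (locallyIntegrableOn_densityL hf)
    fun _ hx _ hy => h.greenL_sub hf hx hy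

lemma continuousOn_greenR (hf : MemLp f 2 (wMeasure β)) :
    ContinuousOn (greenR α β μ f) (Ioo 0 1) :=
  continuousOn_of_sub_eq_integral (locallyIntegrableOn_densityR hf)
    fun _ hx _ hy => greenR_sub hf hx hy

lemma isWeakDeriv_greenL (h : Subcritical α β μ) (hf : MemLp f 2 (wMeasure β)) :
    IsWeakDeriv (greenL α β μ f) fun t => t ^ β * (t ^ rp α β μ * f t) :=
  isWeakDeriv_of_sub_eq_integral (locallyIntegrableOn_densityL hf)
    fun _ hx _ hy => h.greenL_sub hf hx hy

lemma isWeakDeriv_greenR (hf : MemLp f 2 (wMeasure β)) :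
    IsWeakDeriv (greenR α β μ f) fun t => -(t ^ β * ((t ^ rq α β μ - t ^ rp α β μ) * f t)) :=
  isWeakDeriv_of_sub_eq_integral (locallyIntegrableOn_densityR hf)
    fun _ hx _ hy => greenR_sub hf hx hy

lemma continuousOn_green (h : Subcritical α β μ) (hf : MemLp f 2 (wMeasure β)) :
    ContinuousOn (green α β μ f) (Ioo 0 1) :=
  (((continuousOn_rpow_Ioo _).mul (continuousOn_greenR hf)).add
    (((continuousOn_rpow_Ioo _).sub (continuousOn_rpow_Ioo _)).mul
      (h.continuousOn_greenL hf))).div_const _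

lemma continuousOn_greenDeriv (h : Subcritical α β μ) (hf : MemLp f 2 (wMeasure β)) :
    ContinuousOn (greenDeriv α β μ f) (Ioo 0 1) :=
  (((continuousOn_const.mul (continuousOn_rpow_Ioo _)).mul (continuousOn_greenR hf)).add
    (((continuousOn_const.mul (continuousOn_rpow_Ioo _)).sub
      (continuousOn_const.mul (continuousOn_rpow_Ioo _))).mul
      (h.continuousOn_greenL hf))).div_const _

lemma isWeakDeriv_green (h : Subcritical α β μ) (hf : MemLp f 2 (wMeasure β)) :
    IsWeakDeriv (green α β μ f) (greenDeriv α β μ f) := by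
  have hs := h.sig_pos.ne'
  have dL := h.isWeakDeriv_greenL hf
  have dR := isWeakDeriv_greenR (α := α) (μ := μ) hf
  set p := rp α β μ
  set q := rq α β μ
  set s := 2 * sig α β μ
  refine (((dR.const_rpow_mul s⁻¹ p).add (dL.const_rpow_mul s⁻¹ q)).add
    (dL.const_rpow_mul (-s⁻¹) p)).congr (.of_eq ?_) ?_
  · ext x
    simp only [Pi.add_apply, green]
    ring
  · filter_upwards with x
    simp only [Pi.add_apply, greenDeriv]
    ring

lemma isWeakDeriv_greenDeriv (h : Subcritical α β μ) (hf : MemLp f 2 (wMeasure β)) :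
    IsWeakDeriv (greenDeriv α β μ f) fun x =>
      (rp α β μ * (rp α β μ - 1) * x ^ (rp α β μ - 2) * greenR α β μ f x
        + (rq α β μ * (rq α β μ - 1) * x ^ (rq α β μ - 2)
          - rp α β μ * (rp α β μ - 1) * x ^ (rp α β μ - 2)) * greenL α β μ f x)
        / (2 * sig α β μ) - x ^ (-α) * f x := by
  have hs : 2 * sig α β μ ≠ 0 := by have := h.sig_pos; positivity
  have dL := h.isWeakDeriv_greenL hf
  have dR := isWeakDeriv_greenR (α := α) (μ := μ) hf
  have e1 : rp α β μ - rq α β μ = 2 * sig α β μ := rp_sub_rq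
  have e2 : rp α β μ + rq α β μ = 1 - α - β := rp_add_rq
  rw [← e1] at hs
  rw [← e1]
  set p := rp α β μ
  set q := rq α β μ
  refine (((dR.const_rpow_mul (p / (p - q)) (p - 1)).add
    (dL.const_rpow_mul (q / (p - q)) (q - 1))).add
    (dL.const_rpow_mul (-(p / (p - q))) (p - 1))).congr (.of_eq ?_) ?_
  · ext x
    simp only [Pi.add_apply, greenDeriv, ← e1]
    ring
  · filter_upwards [ae_restrict_mem measurableSet_Ioo] with x hx
    have hβ : x ^ (-α) = x ^ β * x ^ p * x ^ q / x := by
      rw [← Real.rpow_add hx.1, ← Real.rpow_add hx.1, show -α = β + p + q - 1 by linarith,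
        Real.rpow_sub hx.1, Real.rpow_one]
    have hx0 : x ≠ 0 := hx.1.ne'
    simp only [Pi.add_apply, hβ, Real.rpow_sub hx.1, Real.rpow_one, Real.rpow_two]
    field_simp
    ring

lemma memHloc_green (h : Subcritical α β μ) (hf : MemLp f 2 (wMeasure β)) :
    MemHloc 2 (green α β μ f) := by
  refine ⟨memL2loc_of_continuousOn (h.continuousOn_green hf), _, h.isWeakDeriv_green hf,
    memL2loc_of_continuousOn (h.continuousOn_greenDeriv hf), _, h.isWeakDeriv_greenDeriv hf, ?_⟩
  intro K hK hc
  refine MemLp.sub (memL2loc_of_continuousOn ?_ K hK hc)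
    (MemL2loc.rpow_mul (-α) (MemLp.memL2loc hf) K hK hc)
  exact (((continuousOn_const.mul (continuousOn_rpow_Ioo _)).mul (continuousOn_greenR hf)).add
    (((continuousOn_const.mul (continuousOn_rpow_Ioo _)).sub
      (continuousOn_const.mul (continuousOn_rpow_Ioo _))).mul
      (h.continuousOn_greenL hf))).div_const _

lemma exprA_green (h : Subcritical α β μ) (hf : MemLp f 2 (wMeasure β)) :
    exprA α β μ (green α β μ f) =ᵐ[volume.restrict (Ioo 0 1)] f := by
  have e0 := exprA_ae_eq (α := α) (β := β) (μ := μ) (h.isWeakDeriv_green hf)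
    (h.isWeakDeriv_greenDeriv hf)
  have hs := h.sig_pos
  have e1 : rp α β μ + rq α β μ = 1 - α - β := rp_add_rq
  have e2 := h.rp_mul_rq
  refine e0.trans ?_
  filter_upwards [ae_restrict_mem measurableSet_Ioo] with x hx
  have hx0 : x ≠ 0 := hx.1.ne'
  have hX : x ^ α ≠ 0 := (Real.rpow_pos_of_pos hx.1 α).ne'
  simp only [Pi.add_apply, green, greenDeriv, Real.rpow_neg hx.1.le, Real.rpow_sub hx.1,
    Real.rpow_one, Real.rpow_two]
  have hμ : μ = rp α β μ * rq α β μ := e2.symm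
  have hαβ : α + β = 1 - rp α β μ - rq α β μ := by linarith
  rw [hαβ]
  generalize rp α β μ = p at *
  generalize rq α β μ = q at *
  generalize greenR α β μ f x = R
  generalize greenL α β μ f x = l
  generalize sig α β μ = s at *
  rw [hμ]
  field_simp
  ring

lemma memLp_green (h : Subcritical α β μ) (hf : MemLp f 2 (wMeasure β)) :
    MemLp (green α β μ f) 2 (wMeasure β) := by
  refine memLp_w_of_le_rpow (aestronglyMeasurable_w_of_continuousOn (h.continuousOn_green hf))
    (C := greenConst α β μ / sig α β μ * (eLpNorm f 2 (wMeasure β)).toReal)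
    (r := gam α β + eps α β μ) ?_ fun x hx => h.abs_green_le hf hx
  have := two_gam_add (α := α) (β := β)
  linarith [h.kappa_pos, h.eps_pos]

lemma memH1_green (h : Subcritical α β μ) (hf : MemLp f 2 (wMeasure β)) :
    MemH1 α β (green α β μ f) := by
  refine ⟨h.memLp_green hf, (h.memHloc_green hf).of_succ, ?_⟩
  have hd := (h.isWeakDeriv_green hf).ae_eq_weakDeriv
  have hm : MemLp (fun x => x ^ (α / 2) * greenDeriv α β μ f x) 2 (wMeasure β) := by
    obtain ⟨C, hC⟩ := h.abs_greenDeriv_le hf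
    refine memLp_w_of_le_rpow (aestronglyMeasurable_w_of_continuousOn
      ((continuousOn_rpow_Ioo _).mul (h.continuousOn_greenDeriv hf))) (C := C)
      (r := α / 2 + (gam α β + eps α β μ - 1)) ?_ fun x hx => ?_
    · have := two_gam_add (α := α) (β := β)
      have hk : kappa α = (2 - α) / 2 := rfl
      linarith [h.eps_pos]
    · have hX := Real.rpow_nonneg hx.1.le (α / 2)
      rw [abs_mul, abs_of_nonneg hX, Real.rpow_add hx.1]
      calc _ ≤ x ^ (α / 2) * (C * x ^ (gam α β + eps α β μ - 1)) :=
            mul_le_mul_of_nonneg_left (hC x hx) hX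
        _ = _ := by ring
  refine (memLp_congr_ae (ae_w_iff.2 ?_)).2 hm
  filter_upwards [hd] with x hx
  rw [hx]

lemma tendsto_greenR_one (hf : MemLp f 2 (wMeasure β)) :
    Tendsto (greenR α β μ f) (𝓝[<] 1) (𝓝 0) := by
  have h2 : (1 / 2 : ℝ) ∈ Ioo (0 : ℝ) 1 := by norm_num
  have hi := greenR_intervalIntegrable (α := α) (μ := μ) hf h2
  have hu : uIcc (1 / 2 : ℝ) 1 = Icc (1 / 2) 1 := uIcc_of_le (by norm_num)
  have hi' : IntegrableOn (fun t => t ^ β * ((t ^ rq α β μ - t ^ rp α β μ) * f t))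
      (uIcc (1 / 2 : ℝ) 1) := by
    rw [hu]
    exact (intervalIntegrable_iff_integrableOn_Icc_of_le (by norm_num)).1 hi
  have hc := intervalIntegral.continuousOn_primitive_interval_left hi'
  rw [hu] at hc
  have ht := (hc 1 ⟨by norm_num, le_rfl⟩).tendsto
  rw [intervalIntegral.integral_same] at ht
  have hle : 𝓝[<] (1 : ℝ) ≤ 𝓝[Icc (1 / 2 : ℝ) 1] 1 := by
    refine le_inf nhdsWithin_le_nhds (le_principal_iff.2 ?_)
    exact mem_of_superset (Ioo_mem_nhdsLT (by norm_num : (1 / 2 : ℝ) < 1))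
      Ioo_subset_Icc_self
  refine (ht.mono_left hle).congr' ?_
  filter_upwards [Ioo_mem_nhdsLT_one] with x hx
  rw [greenR, setIntegral_Ioi_w hx]

lemma tendsto_green_one (h : Subcritical α β μ) (hf : MemLp f 2 (wMeasure β)) :
    Tendsto (green α β μ f) (𝓝[<] 1) (𝓝 0) := by
  have hpow : ∀ a : ℝ, Tendsto (fun x : ℝ => x ^ a) (𝓝[<] 1) (𝓝 1) := fun a => by
    have : Tendsto (fun x : ℝ => x ^ a) (𝓝[<] 1) (𝓝 (1 ^ a)) :=
      (Real.continuousAt_rpow_const 1 a (Or.inl one_ne_zero)).mono_left nhdsWithin_le_nhds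
    rwa [Real.one_rpow] at this
  have t1 := (hpow (rp α β μ)).mul (tendsto_greenR_one (α := α) (μ := μ) hf)
  have t2 : Tendsto (fun x => (x ^ rq α β μ - x ^ rp α β μ) * greenL α β μ f x) (𝓝[<] 1)
      (𝓝 0) := by
    have t3 := (hpow (rq α β μ)).sub (hpow (rp α β μ))
    rw [sub_self] at t3
    refine t3.zero_mul_isBoundedUnder_le ⟨greenConst α β μ * 1
      * (eLpNorm f 2 (wMeasure β)).toReal, ?_⟩
    rw [eventually_map]
    filter_upwards [Ioo_mem_nhdsLT_one] with x hx
    refine (h.abs_greenL_le hf hx).trans ?_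
    refine mul_le_mul_of_nonneg_right (mul_le_mul_of_nonneg_left ?_ greenConst_nonneg)
      ENNReal.toReal_nonneg
    exact Real.rpow_le_one hx.1.le hx.2.le (by linarith [h.sig_pos, h.eps_pos])
  have := (t1.add t2).div_const (2 * sig α β μ)
  rw [mul_zero, add_zero, zero_div] at this
  exact this

lemma tendsto_rpow_zero {a : ℝ} (ha : 0 < a) :
    Tendsto (fun x : ℝ => x ^ a) (𝓝[>] 0) (𝓝 0) := by
  have : Tendsto (fun x : ℝ => x ^ a) (𝓝[>] 0) (𝓝 (0 ^ a)) :=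
    (Real.continuousAt_rpow_const 0 a (Or.inr ha.le)).mono_left nhdsWithin_le_nhds
  rwa [Real.zero_rpow ha.ne'] at this

lemma tendsto_green_zero (h : Subcritical α β μ) (hαβ : α + β < 1)
    (hf : MemLp f 2 (wMeasure β)) : Tendsto (green α β μ f) (𝓝[>] 0) (𝓝 0) := by
  have hg : 0 < gam α β + eps α β μ := by
    have := h.eps_pos
    unfold gam
    linarith
  have ht := (tendsto_rpow_zero hg).const_mul
    (greenConst α β μ / sig α β μ * (eLpNorm f 2 (wMeasure β)).toReal)
  rw [mul_zero] at ht
  refine squeeze_zero_norm' ?_ ht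
  filter_upwards [Ioo_mem_nhdsGT_zero] with x hx using h.abs_green_le hf hx

lemma memH1N_green (h : Subcritical α β μ) (hf : MemLp f 2 (wMeasure β)) :
    MemH1N α β (green α β μ f) :=
  ⟨h.memH1_green hf, _, h.continuousOn_green hf, .rfl, h.tendsto_green_one hf⟩

lemma memH1D_green (h : Subcritical α β μ) (hαβ : α + β < 1) (hf : MemLp f 2 (wMeasure β)) :
    MemH1D α β (green α β μ f) :=
  ⟨h.memH1_green hf, ⟨_, h.continuousOn_green hf, .rfl, h.tendsto_green_zero hαβ hf⟩,
    ⟨_, h.continuousOn_green hf, .rfl, h.tendsto_green_one hf⟩⟩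

end Subcritical

/-! ### The Green operator on `L²_β(0,1)`: boundedness and symmetry -/

namespace Subcritical

lemma greenL_congr (hfg : f =ᵐ[wMeasure β] g) : greenL α β μ f = greenL α β μ g := by
  ext x
  refine integral_congr_ae (ae_restrict_of_ae ?_)
  filter_upwards [hfg] with y hy
  rw [hy]

lemma greenR_congr (hfg : f =ᵐ[wMeasure β] g) : greenR α β μ f = greenR α β μ g := by
  ext x
  refine integral_congr_ae (ae_restrict_of_ae ?_)
  filter_upwards [hfg] with y hy
  rw [hy]

lemma green_congr (hfg : f =ᵐ[wMeasure β] g) : green α β μ f = green α β μ g := by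
  ext x
  rw [green, green, greenL_congr hfg, greenR_congr hfg]

lemma green_add (h : Subcritical α β μ) (hf : MemLp f 2 (wMeasure β))
    (hg : MemLp g 2 (wMeasure β)) {x : ℝ} (hx : x ∈ Ioo (0 : ℝ) 1) :
    green α β μ (f + g) x = green α β μ f x + green α β μ g x := by
  have e1 : greenL α β μ (f + g) x = greenL α β μ f x + greenL α β μ g x := by
    rw [greenL_eq, greenL_eq, greenL_eq,
      ← integral_add (MemLp.integrable_mul_w (h.memLp_indicator_Iio x) hf)
        (MemLp.integrable_mul_w (h.memLp_indicator_Iio x) hg)]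
    simp only [Pi.add_apply, mul_add]
  have e2 : greenR α β μ (f + g) x = greenR α β μ f x + greenR α β μ g x := by
    rw [greenR_eq, greenR_eq, greenR_eq,
      ← integral_add (MemLp.integrable_mul_w (memLp_indicator_Ioi hx) hf)
        (MemLp.integrable_mul_w (memLp_indicator_Ioi hx) hg)]
    simp only [Pi.add_apply, mul_add]
  rw [green, green, green, e1, e2]
  ring

lemma green_smul (c : ℝ) (f : ℝ → ℝ) (x : ℝ) :
    green α β μ (c • f) x = c * green α β μ f x := by
  have e1 : greenL α β μ (c • f) x = c * greenL α β μ f x := by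
    rw [greenL, greenL, ← integral_const_mul]
    simp only [Pi.smul_apply, smul_eq_mul]
    congr 1; ext y; ring
  have e2 : greenR α β μ (c • f) x = c * greenR α β μ f x := by
    rw [greenR, greenR, ← integral_const_mul]
    simp only [Pi.smul_apply, smul_eq_mul]
    congr 1; ext y; ring
  rw [green, green, e1, e2]
  ring

lemma gam_add_eps_integrable (h : Subcritical α β μ) : -1 < 2 * (gam α β + eps α β μ) + β := by
  have := two_gam_add (α := α) (β := β)
  linarith [h.kappa_pos, h.eps_pos]

/-- The Green operator as a bounded operator in `L²_β(0,1)`. -/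
def greenOp (h : Subcritical α β μ) : L2w β →L[ℝ] L2w β :=
  LinearMap.mkContinuous
    { toFun := fun u => (h.memLp_green (Lp.memLp u)).toLp _
      map_add' := fun u v => by
        rw [← MemLp.toLp_add, MemLp.toLp_eq_toLp_iff]
        filter_upwards [ae_w_mem] with x hx
        rw [Pi.add_apply, ← h.green_add (Lp.memLp u) (Lp.memLp v) hx,
          green_congr (Lp.coeFn_add u v)]
      map_smul' := fun c u => by
        rw [RingHom.id_apply, ← MemLp.toLp_const_smul, MemLp.toLp_eq_toLp_iff]
        filter_upwards with x
        rw [Pi.smul_apply, smul_eq_mul, ← green_smul, green_congr (Lp.coeFn_smul c u)] }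
    (greenConst α β μ / sig α β μ
      * ‖(memLp_rpow_w_iff.2 h.gam_add_eps_integrable).toLp fun x : ℝ => x ^ (gam α β + eps α β μ)‖)
    fun u => by
      have hs := h.sig_pos
      have hC : 0 ≤ greenConst α β μ / sig α β μ := div_nonneg greenConst_nonneg hs.le
      have := Lp.norm_le_mul_norm_of_ae_le_mul (c := greenConst α β μ / sig α β μ * ‖u‖)
        (f := (h.memLp_green (Lp.memLp u)).toLp _)
        (g := (memLp_rpow_w_iff.2 h.gam_add_eps_integrable).toLp _) (by
          filter_upwards [ae_w_mem, (h.memLp_green (Lp.memLp u)).coeFn_toLp,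
            (memLp_rpow_w_iff.2 h.gam_add_eps_integrable).coeFn_toLp] with x hx h1 h2
          rw [h1, h2, Real.norm_eq_abs, Real.norm_eq_abs,
            abs_of_nonneg (Real.rpow_nonneg hx.1.le _)]
          exact h.abs_green_le (Lp.memLp u) hx)
      refine this.trans (le_of_eq ?_)
      ring

lemma greenOp_coeFn (h : Subcritical α β μ) (u : L2w β) :
    h.greenOp u =ᵐ[wMeasure β] green α β μ u :=
  (h.memLp_green (Lp.memLp u)).coeFn_toLp

lemma memLp_rp_greenR (h : Subcritical α β μ) (hf : MemLp f 2 (wMeasure β)) :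
    MemLp (fun x => x ^ rp α β μ * greenR α β μ f x) 2 (wMeasure β) := by
  refine memLp_w_of_le_rpow (C := greenConst α β μ
    * (eLpNorm f 2 (wMeasure β)).toReal) (r := gam α β + eps α β μ)
    (aestronglyMeasurable_w_of_continuousOn
      ((continuousOn_rpow_Ioo _).mul (continuousOn_greenR hf)))
    h.gam_add_eps_integrable fun x hx => ?_
  have hX := Real.rpow_nonneg hx.1.le (rp α β μ)
  have e1 : x ^ (gam α β + eps α β μ) = x ^ rp α β μ * x ^ (-sig α β μ + eps α β μ) := by
    rw [← Real.rpow_add hx.1]; congr 1; unfold rp; ring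
  rw [abs_mul, abs_of_nonneg hX, e1]
  calc _ ≤ x ^ rp α β μ * (greenConst α β μ * x ^ (-sig α β μ + eps α β μ)
        * (eLpNorm f 2 (wMeasure β)).toReal) :=
        mul_le_mul_of_nonneg_left (h.abs_greenR_le hf hx) hX
    _ = _ := by ring

/-- Fubini's theorem for the triangular part of the Green function. -/
lemma integral_greenR_mul (h : Subcritical α β μ) (hf : MemLp f 2 (wMeasure β))
    (hg : MemLp g 2 (wMeasure β)) :
    ∫ x, x ^ rp α β μ * greenR α β μ f x * g x ∂(wMeasure β)
      = ∫ y, (y ^ rq α β μ - y ^ rp α β μ) * greenL α β μ g y * f y ∂(wMeasure β) := by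
  let F : ℝ → ℝ → ℝ := fun x y =>
    (Ioi x).indicator (fun y => y ^ rq α β μ - y ^ rp α β μ) y * f y * (x ^ rp α β μ * g x)
  have hrm : ∀ a : ℝ, AEStronglyMeasurable (fun x : ℝ => x ^ a) (wMeasure β) := fun a =>
    aestronglyMeasurable_w_of_continuousOn (continuousOn_rpow_Ioo a)
  have hm : AEStronglyMeasurable (Function.uncurry F) ((wMeasure β).prod (wMeasure β)) := by
    have e : Function.uncurry F = {z : ℝ × ℝ | z.1 < z.2}.indicator fun z =>
        (z.2 ^ rq α β μ - z.2 ^ rp α β μ) * f z.2 * (z.1 ^ rp α β μ * g z.1) := by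
      ext ⟨x, y⟩
      by_cases hxy : x < y
      · rw [indicator_of_mem (show (x, y) ∈ {z : ℝ × ℝ | z.1 < z.2} from hxy)]
        simp only [Function.uncurry_apply_pair, F]
        rw [indicator_of_mem (show y ∈ Ioi x from hxy)]
      · rw [indicator_of_notMem (show (x, y) ∉ {z : ℝ × ℝ | z.1 < z.2} from hxy)]
        simp only [Function.uncurry_apply_pair, F]
        rw [indicator_of_notMem (show y ∉ Ioi x from hxy), zero_mul, zero_mul]
    rw [e]
    refine AEStronglyMeasurable.indicator ?_ (measurableSet_lt measurable_fst measurable_snd)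
    have a1 := (((hrm (rq α β μ)).sub (hrm (rp α β μ))).mul hf.1).comp_snd (μ := wMeasure β)
    have a2 := ((hrm (rp α β μ)).mul hg.1).comp_fst (ν := wMeasure β)
    exact a1.mul a2
  have hfn : MemLp (fun x => |f x|) 2 (wMeasure β) := hf.norm
  have hgn : MemLp (fun x => |g x|) 2 (wMeasure β) := hg.norm
  have hnorm : ∀ x ∈ Ioo (0 : ℝ) 1, ∫ y, ‖F x y‖ ∂(wMeasure β)
      = x ^ rp α β μ * greenR α β μ (fun x => |f x|) x * |g x| := by
    intro x hx
    rw [greenR_eq, mul_right_comm, ← integral_const_mul]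
    refine integral_congr_ae ?_
    filter_upwards [ae_w_mem] with y hy
    have b1 : y ^ rp α β μ ≤ y ^ rq α β μ := rpow_le_rpow_of_lt_one hy h.rq_le_rp
    have b2 : 0 ≤ (Ioi x).indicator (fun y => y ^ rq α β μ - y ^ rp α β μ) y := by
      by_cases hxy : y ∈ Ioi x
      · rw [indicator_of_mem hxy]; linarith
      · rw [indicator_of_notMem hxy]
    simp only [F]
    rw [Real.norm_eq_abs, abs_mul, abs_mul, abs_mul, abs_of_nonneg b2,
      abs_of_nonneg (Real.rpow_nonneg hx.1.le _)]
    ring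
  have hint : Integrable (Function.uncurry F) ((wMeasure β).prod (wMeasure β)) := by
    rw [integrable_prod_iff hm]
    constructor
    · filter_upwards [ae_w_mem] with x hx
      have hi := MemLp.integrable_mul_w (memLp_indicator_Ioi (α := α) (μ := μ) hx) hf
      have hi' := hi.mul_const (x ^ rp α β μ * g x)
      exact hi'
    · have hi := MemLp.integrable_mul_w (h.memLp_rp_greenR hfn) hgn
      refine hi.congr ?_
      filter_upwards [ae_w_mem] with x hx
      exact (hnorm x hx).symm
  have hswap := integral_integral_swap hint
  have e1 : ∀ x, ∫ y, F x y ∂(wMeasure β) = x ^ rp α β μ * greenR α β μ f x * g x := by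
    intro x
    rw [greenR_eq, mul_right_comm, ← integral_const_mul]
    congr 1; ext y; simp only [F]; ring
  have e2 : ∀ y, ∫ x, F x y ∂(wMeasure β)
      = (y ^ rq α β μ - y ^ rp α β μ) * greenL α β μ g y * f y := by
    intro y
    rw [greenL_eq, mul_right_comm, ← integral_const_mul]
    congr 1; ext x; simp only [F]
    by_cases hxy : x < y
    · rw [indicator_of_mem (show y ∈ Ioi x from hxy), indicator_of_mem (show x ∈ Iio y from hxy)]
    · rw [indicator_of_notMem (show y ∉ Ioi x from hxy),
        indicator_of_notMem (show x ∉ Iio y from hxy)]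
      simp only [zero_mul, mul_zero]
  simp_rw [e1, e2] at hswap
  exact hswap

/-- Fubini's theorem exchanges the two triangular parts of the Green function. -/
lemma isSymmetric_greenOp (h : Subcritical α β μ) :
    (h.greenOp : L2w β →ₗ[ℝ] L2w β).IsSymmetric := by
  have key : ∀ u v : L2w β, inner ℝ (h.greenOp u) v
      = ((∫ x, x ^ rp α β μ * greenR α β μ u x * v x ∂(wMeasure β))
        + ∫ x, (x ^ rq α β μ - x ^ rp α β μ) * greenL α β μ u x * v x ∂(wMeasure β))
          / (2 * sig α β μ) := by
    intro u v
    have hu := Lp.memLp u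
    have hs := h.sig_pos
    have m1 := h.memLp_rp_greenR hu
    have m2 : MemLp (fun x => (x ^ rq α β μ - x ^ rp α β μ) * greenL α β μ u x) 2
        (wMeasure β) := by
      refine (((h.memLp_green hu).const_mul (2 * sig α β μ)).sub m1).ae_eq (.of_eq ?_)
      ext x
      simp only [Pi.sub_apply, green]
      field_simp
      ring
    rw [← integral_add (MemLp.integrable_mul_w m1 (Lp.memLp v))
      (MemLp.integrable_mul_w m2 (Lp.memLp v)), inner_w, ← integral_div]
    refine integral_congr_ae ?_
    filter_upwards [h.greenOp_coeFn u] with x hx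
    rw [hx, green]
    ring
  intro u v
  change inner ℝ (h.greenOp u) v = inner ℝ u (h.greenOp v)
  rw [real_inner_comm (h.greenOp v), key, key, h.integral_greenR_mul (Lp.memLp u) (Lp.memLp v),
    h.integral_greenR_mul (Lp.memLp v) (Lp.memLp u), add_comm]

end Subcritical

/-! ### Compactness of the Green operator -/

/-- A bounded operator on a Hilbert space which maps bounded weakly null sequences to norm null
sequences is compact, provided the space is separable. -/
lemma isCompactOperator_of_weakly_null {E : Type*} [NormedAddCommGroup E] [InnerProductSpace ℝ E]
    [CompleteSpace E] [TopologicalSpace.SeparableSpace E] (T : E →L[ℝ] E)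
    (H : ∀ (d : ℕ → E) (C : ℝ), (∀ n, ‖d n‖ ≤ C) →
      (∀ v, Tendsto (fun n => inner ℝ (d n) v) atTop (𝓝 0)) →
      Tendsto (fun n => T (d n)) atTop (𝓝 0)) : IsCompactOperator T := by
  have hseq : ∀ u : ℕ → E, (∀ n, ‖u n‖ ≤ 1) → ∃ u₀ : E, ‖u₀‖ ≤ 1 ∧ ∃ φ : ℕ → ℕ, StrictMono φ ∧
      Tendsto (fun n => T (u (φ n))) atTop (𝓝 (T u₀)) := by
    intro u hu
    obtain ⟨ℓ, hℓ, φ, hφ, hlim⟩ := WeakDual.isSeqCompact_closedBall ℝ E 0 1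
      (x := fun n => StrongDual.toWeakDual (InnerProductSpace.toDual ℝ E (u n))) (fun n => by
        simpa [mem_closedBall_zero_iff] using hu n)
    set u₀ : E := (InnerProductSpace.toDual ℝ E).symm (WeakDual.toStrongDual ℓ) with hu₀
    have h1 : ‖u₀‖ ≤ 1 := by
      rw [hu₀, LinearIsometryEquiv.norm_map]
      simpa [mem_closedBall_zero_iff] using hℓ
    refine ⟨u₀, h1, φ, hφ, ?_⟩
    have hw : ∀ v, Tendsto (fun n => inner ℝ (u (φ n) - u₀) v) atTop (𝓝 0) := by
      intro v
      have e1 : Tendsto (fun n => inner ℝ (u (φ n)) v) atTop (𝓝 (inner ℝ u₀ v)) := by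
        have := ((WeakDual.eval_continuous v).tendsto ℓ).comp hlim
        rw [hu₀, InnerProductSpace.toDual_symm_apply]
        exact this
      simp_rw [inner_sub_left]
      rw [← sub_self (inner ℝ u₀ v)]
      exact e1.sub_const _
    have := H (fun n => u (φ n) - u₀) 2 (fun n => by
      have := norm_sub_le (u (φ n)) u₀
      linarith [hu (φ n)]) hw
    simp_rw [map_sub] at this
    simpa using this.add_const (T u₀)
  refine (isCompactOperator_iff_image_closedBall_subset_compact (T : E →ₗ[ℝ] E) one_pos).2
    ⟨T '' Metric.closedBall 0 1, ?_, subset_rfl⟩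
  refine IsSeqCompact.isCompact ?_
  intro y hy
  choose u hu hTu using hy
  obtain ⟨u₀, h0, φ, hφ, hlim⟩ := hseq u fun n => mem_closedBall_zero_iff.1 (hu n)
  exact ⟨T u₀, ⟨u₀, mem_closedBall_zero_iff.2 h0, rfl⟩, φ, hφ, by
    simpa only [Function.comp_def, hTu] using hlim⟩

namespace Subcritical

/-- At a fixed point, the Green operator is the inner product with a function of `L²_β(0,1)`. -/
lemma tendsto_green_of_weakly_null (h : Subcritical α β μ) {d : ℕ → L2w β}
    (hd : ∀ v, Tendsto (fun n => inner ℝ (d n) v) atTop (𝓝 0)) {x : ℝ} (hx : x ∈ Ioo (0 : ℝ) 1) :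
    Tendsto (fun n => green α β μ (d n) x) atTop (𝓝 0) := by
  have hk : ∀ {k : ℝ → ℝ} (hk : MemLp k 2 (wMeasure β)),
      Tendsto (fun n => ∫ y, k y * d n y ∂(wMeasure β)) atTop (𝓝 0) := by
    intro k hk
    refine (hd (hk.toLp k)).congr fun n => ?_
    rw [inner_w]
    refine integral_congr_ae ?_
    filter_upwards [hk.coeFn_toLp] with y hy
    rw [hy, mul_comm]
  have t1 := hk (h.memLp_indicator_Iio x)
  have t2 := hk (memLp_indicator_Ioi (α := α) (μ := μ) hx)
  have := ((t2.const_mul (x ^ rp α β μ)).add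
    (t1.const_mul (x ^ rq α β μ - x ^ rp α β μ))).div_const (2 * sig α β μ)
  rw [mul_zero, mul_zero, add_zero, zero_div] at this
  refine this.congr fun n => ?_
  rw [green, greenL_eq, greenR_eq]

/-- Weak convergence gives pointwise convergence of the images, and the pointwise estimate
`abs_green_le` dominates them. -/
lemma isCompactOperator_greenOp (h : Subcritical α β μ) : IsCompactOperator h.greenOp := by
  have hsep : TopologicalSpace.SeparableSpace (L2w β) := by
    have : Fact ((2 : ENNReal) ≠ ⊤) := ⟨by norm_num⟩
    infer_instance
  refine isCompactOperator_of_weakly_null h.greenOp fun d C hC hd => ?_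
  have hs := h.sig_pos
  set K := greenConst α β μ / sig α β μ with hK
  have hK0 : 0 ≤ K := div_nonneg greenConst_nonneg hs.le
  have hC0 : 0 ≤ C := (norm_nonneg _).trans (hC 0)
  have hsq : Tendsto (fun n => ∫ x, green α β μ (d n) x ^ 2 ∂(wMeasure β)) atTop (𝓝 0) := by
    have : Tendsto (fun n => ∫ x, green α β μ (d n) x ^ 2 ∂(wMeasure β)) atTop
        (𝓝 (∫ x, (0 : ℝ) ∂(wMeasure β))) := by
      refine tendsto_integral_of_dominated_convergence
        (fun x => (K * C) ^ 2 * (x ^ (gam α β + eps α β μ)) ^ 2) ?_ ?_ ?_ ?_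
      · exact fun n => (h.memLp_green (Lp.memLp (d n))).1.pow 2
      · exact ((memLp_rpow_w_iff.2 h.gam_add_eps_integrable).integrable_sq).const_mul _
      · intro n
        filter_upwards [ae_w_mem] with x hx
        have hX := Real.rpow_nonneg hx.1.le (gam α β + eps α β μ)
        rw [Real.norm_eq_abs, abs_pow, ← mul_pow]
        refine pow_le_pow_left₀ (abs_nonneg _) ((h.abs_green_le (Lp.memLp (d n)) hx).trans ?_) 2
        exact mul_le_mul_of_nonneg_right (mul_le_mul_of_nonneg_left (hC n) hK0) hX
      · filter_upwards [ae_w_mem] with x hx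
        have := (h.tendsto_green_of_weakly_null hd hx).pow 2
        simpa using this
    simpa using this
  rw [tendsto_zero_iff_norm_tendsto_zero]
  have hn : ∀ n, ‖h.greenOp (d n)‖ = √(∫ x, green α β μ (d n) x ^ 2 ∂(wMeasure β)) := by
    intro n
    rw [← Real.sqrt_sq (norm_nonneg (h.greenOp (d n))), ← real_inner_self_eq_norm_sq, inner_w]
    congr 1
    refine integral_congr_ae ?_
    filter_upwards [h.greenOp_coeFn (d n)] with x hx
    rw [hx, pow_two]
  simp_rw [hn]
  have := (Real.continuous_sqrt.tendsto 0).comp hsq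
  rw [Real.sqrt_zero] at this
  exact this

/-! ### The Green operator inverts `𝒜` -/

/-- Solutions of `𝒜 u = 0` are combinations of the two powers. -/
lemma ae_eq_of_exprA_eq_zero (h : Subcritical α β μ) (hf : MemHloc 2 f)
    (h0 : exprA α β μ f =ᵐ[volume.restrict (Ioo 0 1)] 0) : ∃ a b : ℝ,
    (f =ᵐ[volume.restrict (Ioo 0 1)] fun x => a * x ^ rp α β μ + b * x ^ rq α β μ) ∧
    weakDeriv f =ᵐ[volume.restrict (Ioo 0 1)]
      fun x => a * rp α β μ * x ^ (rp α β μ - 1) + b * rq α β μ * x ^ (rq α β μ - 1) := by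
  have hs : 2 * sig α β μ ≠ 0 := by have := h.sig_pos; positivity
  have e1 : rp α β μ - rq α β μ = 2 * sig α β μ := rp_sub_rq
  have e2 : rp α β μ + rq α β μ = 1 - α - β := rp_add_rq
  have e3 := h.rp_mul_rq
  -- For indicial exponents `r`, `s` the function `x^{-r} (x f' - s f)` is constant.
  have key : ∀ r s : ℝ, r + s = 1 - α - β → r * s = μ → ∃ c : ℝ, ∀ᵐ x ∂(volume.restrict
      (Ioo (0 : ℝ) 1)), x * weakDeriv f x - s * f x = c * x ^ r := by
    intro r s hrs hrs'
    have d1 := hf.isWeakDeriv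
    have d2 := hf.weakDeriv.isWeakDeriv
    have d := (d2.const_rpow_mul 1 (1 - r)).add (d1.const_rpow_mul (-s) (-r))
    have d0 := d.congr (g' := 0) .rfl (by
      filter_upwards [hf.exprA_ae_eq (α := α) (β := β) (μ := μ), h0,
        ae_restrict_mem measurableSet_Ioo] with x hx hx0 hm
      have hX : x ^ α ≠ 0 := (Real.rpow_pos_of_pos hm.1 α).ne'
      have hR : x ^ r ≠ 0 := (Real.rpow_pos_of_pos hm.1 r).ne'
      have hx0' : x ≠ 0 := hm.1.ne'
      rw [hx0] at hx
      simp only [Pi.add_apply, Pi.zero_apply, Real.rpow_sub hm.1, Real.rpow_one, Real.rpow_two,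
        Real.rpow_neg hm.1.le] at hx ⊢
      have hαβ : α + β = 1 - r - s := by linarith
      rw [hαβ, ← hrs'] at hx
      have hx' : x ^ α * (x ^ 2 * weakDeriv (weakDeriv f) x + (1 - r - s) * x * weakDeriv f x
          + r * s * f x) = 0 := by
        field_simp at hx
        linear_combination hx
      have hx'' := (mul_eq_zero.1 hx').resolve_left hX
      field_simp
      linear_combination hx'')
    obtain ⟨c, hc⟩ := d0.ae_eq_const
    refine ⟨c, ?_⟩
    filter_upwards [hc, ae_restrict_mem measurableSet_Ioo] with x hx hm
    have hR : x ^ r ≠ 0 := (Real.rpow_pos_of_pos hm.1 r).ne'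
    rw [← hx]
    simp only [Pi.add_apply, Real.rpow_sub hm.1, Real.rpow_one, Real.rpow_neg hm.1.le]
    field_simp
    ring
  obtain ⟨a, ha⟩ := key _ _ e2 e3
  obtain ⟨b, hb⟩ := key (rq α β μ) (rp α β μ) (by linarith) (by linarith)
  rw [← e1] at hs
  refine ⟨a / (rp α β μ - rq α β μ), -b / (rp α β μ - rq α β μ), ?_, ?_⟩
  · filter_upwards [ha, hb] with x h1 h2
    field_simp
    linear_combination h1 - h2
  · filter_upwards [ha, hb, ae_restrict_mem measurableSet_Ioo] with x h1 h2 hm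
    have hx0' : x ≠ 0 := hm.1.ne'
    rw [Real.rpow_sub hm.1, Real.rpow_sub hm.1, Real.rpow_one]
    field_simp
    linear_combination rp α β μ * h1 - rq α β μ * h2

/-- The singular solution `x^q` does not have finite energy, unless it is constant. -/
lemma coeff_rq_eq_zero (h : Subcritical α β μ) {a b : ℝ} (hq : rq α β μ ≠ 0)
    (hm : MemLp (fun x => x ^ (α / 2) * (a * rp α β μ * x ^ (rp α β μ - 1)
      + b * rq α β μ * x ^ (rq α β μ - 1))) 2 (wMeasure β)) : b = 0 := by
  have hs := h.sig_pos
  have hg := two_gam_add (α := α) (β := β)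
  have hk : kappa α = (2 - α) / 2 := rfl
  have m1 : MemLp (fun x : ℝ => x ^ (α / 2 + rp α β μ - 1)) 2 (wMeasure β) := by
    refine memLp_rpow_w_iff.2 ?_
    unfold rp
    linarith
  by_contra hb
  have m2 := (hm.sub (m1.const_mul (a * rp α β μ))).const_mul (b * rq α β μ)⁻¹
  have m3 : MemLp (fun x : ℝ => x ^ (α / 2 + rq α β μ - 1)) 2 (wMeasure β) := by
    refine m2.ae_eq ?_
    filter_upwards [ae_w_mem] with x hx
    simp only [Pi.sub_apply, Real.rpow_sub hx.1, Real.rpow_add hx.1]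
    field_simp
    ring
  have := memLp_rpow_w_iff.1 m3
  unfold rq at this
  linarith

/-- The boundary conditions exclude nonzero solutions of `𝒜 u = 0`. If `q = 0`, which forces
`μ = 0`, the solution `x^q` has finite energy, and the condition at `0` is needed to exclude it. -/
lemma ae_eq_zero_of_exprA_eq_zero (h : Subcritical α β μ) (hf : MemHloc 2 f) (hf1 : MemH1N α β f)
    (hq : rq α β μ ≠ 0 ∨ HasBoundaryValue f (𝓝[>] 0) 0)
    (h0 : exprA α β μ f =ᵐ[volume.restrict (Ioo 0 1)] 0) :
    f =ᵐ[volume.restrict (Ioo 0 1)] 0 := by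
  obtain ⟨a, b, e1, e2⟩ := h.ae_eq_of_exprA_eq_zero hf h0
  have hs := h.sig_pos
  have hc : ContinuousOn (fun x => a * x ^ rp α β μ + b * x ^ rq α β μ) (Ioo 0 1) :=
    (continuousOn_const.mul (continuousOn_rpow_Ioo _)).add
      (continuousOn_const.mul (continuousOn_rpow_Ioo _))
  have hb : b = 0 := by
    by_cases hq' : rq α β μ = 0
    · have t1 := (hq.resolve_left (fun h => h hq')).tendsto Ioo_mem_nhdsGT_zero hc e1
      have hp : 0 < rp α β μ := by
        have := rp_sub_rq (α := α) (β := β) (μ := μ)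
        linarith
      have t2 := ((tendsto_rpow_zero hp).const_mul a).add_const b
      rw [mul_zero, zero_add] at t2
      refine tendsto_nhds_unique t2 (t1.congr fun x => ?_)
      rw [hq', Real.rpow_zero, mul_one]
    · refine h.coeff_rq_eq_zero hq' (a := a) ((memLp_congr_ae (ae_w_iff.2 ?_)).1 hf1.1.2.2)
      filter_upwards [e2] with x hx
      rw [hx]
  have ha : a = 0 := by
    have t1 := hf1.2.tendsto Ioo_mem_nhdsLT_one hc e1
    have t2 : Tendsto (fun x : ℝ => a * x ^ rp α β μ) (𝓝[<] 1) (𝓝 (a * 1 ^ rp α β μ)) :=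
      (((Real.continuousAt_rpow_const 1 _ (Or.inl one_ne_zero)).const_mul a).tendsto).mono_left
        nhdsWithin_le_nhds
    rw [Real.one_rpow, mul_one] at t2
    refine tendsto_nhds_unique t2 (t1.congr fun x => ?_)
    rw [hb, zero_mul, add_zero]
  refine e1.trans (.of_eq ?_)
  ext x
  simp [ha, hb]

/-- The Green operator inverts every realization of `𝒜` whose form domain `V` contains its range and
admits no nonzero solution of `𝒜 u = 0`. -/
lemma isBoundedInverse (h : Subcritical α β μ) {V : Submodule ℝ (L2w β)} (hVN : V ≤ H1N α β)
    (hV0 : rq α β μ ≠ 0 ∨ ∀ u ∈ V, HasBoundaryValue u (𝓝[>] 0) 0) (hT : ∀ f, h.greenOp f ∈ V) :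
    IsBoundedInverse (opA α β μ V) h.greenOp := by
  have hc : ∀ f, h.greenOp f =ᵐ[volume.restrict (Ioo 0 1)] green α β μ f :=
    fun f => ae_w_iff.1 (h.greenOp_coeFn f)
  have hA : ∀ f : L2w β, exprA α β μ (h.greenOp f) =ᵐ[wMeasure β] f := fun f =>
    ae_w_iff.2 ((exprA_congr (hc f)).trans (h.exprA_green (Lp.memLp f)))
  have hm : ∀ f, h.greenOp f ∈ (opA α β μ V).domain := fun f =>
    ⟨hT f, (h.memHloc_green (Lp.memLp f)).congr (hc f).symm,
      (memLp_congr_ae (hA f)).2 (Lp.memLp f)⟩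
  have hr : ∀ f, opA α β μ V ⟨h.greenOp f, hm f⟩ = f := fun f =>
    Lp.ext ((ae_w_iff.2 (opA_coeFn ⟨h.greenOp f, hm f⟩)).trans (hA f))
  refine ⟨hm, hr, fun u => ?_⟩
  set w := (⟨h.greenOp (opA α β μ V u), hm _⟩ - u : (opA α β μ V).domain) with hw
  have hAw : opA α β μ V w = 0 := by
    rw [hw, LinearPMap.map_sub, hr, sub_self]
  have h0 : exprA α β μ (w : L2w β) =ᵐ[volume.restrict (Ioo 0 1)] 0 := by
    refine (opA_coeFn w).symm.trans ?_
    rw [hAw]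
    exact ae_w_iff.1 (Lp.coeFn_zero ℝ 2 (wMeasure β))
  have hz := h.ae_eq_zero_of_exprA_eq_zero w.2.2.1 (hVN w.2.1)
    (hV0.imp_right fun H => H _ w.2.1) h0
  have hw0 : (w : L2w β) = 0 :=
    Lp.ext ((ae_w_iff.2 hz).trans (Lp.coeFn_zero ℝ 2 (wMeasure β)).symm)
  exact sub_eq_zero.1 hw0

lemma isBoundedInverse_H1D (h : Subcritical α β μ) (hαβ : α + β < 1) :
    IsBoundedInverse (opA α β μ (H1D α β)) h.greenOp :=
  h.isBoundedInverse (fun _ hu => ⟨hu.1, hu.2.2⟩) (Or.inr fun _ hu => hu.2.1)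
    fun f => (toLp_mem_H1D_iff (h.memLp_green (Lp.memLp f))).2 (h.memH1D_green hαβ (Lp.memLp f))

lemma isBoundedInverse_H1N (h : Subcritical α β μ) (hαβ : 1 ≤ α + β) :
    IsBoundedInverse (opA α β μ (H1N α β)) h.greenOp :=
  h.isBoundedInverse le_rfl (Or.inl (by
    have := h.sig_pos
    unfold rq gam
    intro h0
    linarith)) fun f =>
      (toLp_mem_H1N_iff (h.memLp_green (Lp.memLp f))).2 (h.memH1N_green (Lp.memLp f))

end Subcritical

/-! ### The entire function behind the Bessel function -/

/-- The coefficients of `besselE`. -/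
def besselCoeff (ν : ℝ) (m : ℕ) : ℝ := (-1 : ℝ) ^ m / (m.factorial * Real.Gamma (m + ν + 1))

/-- The entire function `E_ν` with `J_ν(x) = (x/2)^ν E_ν(x²/4)`. -/
def besselE (ν z : ℝ) : ℝ := ∑' m : ℕ, besselCoeff ν m * z ^ m

lemma Gamma_add_nat_pos {ν : ℝ} (hν : 0 ≤ ν) (m : ℕ) : 0 < Real.Gamma (m + ν + 1) :=
  Real.Gamma_pos_of_pos (by positivity)

lemma Gamma_le_Gamma_add_nat {ν : ℝ} (hν : 0 ≤ ν) (m : ℕ) :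
    Real.Gamma (ν + 1) ≤ Real.Gamma (m + ν + 1) := by
  induction m with
  | zero => simp
  | succ m ih =>
    have e : ((m + 1 : ℕ) : ℝ) + ν + 1 = (m + ν + 1) + 1 := by push_cast; ring
    have hm : (0 : ℝ) ≤ m := Nat.cast_nonneg m
    rw [e, Real.Gamma_add_one (s := m + ν + 1) (by positivity)]
    have := Gamma_add_nat_pos hν m
    nlinarith

lemma abs_besselCoeff_le {ν : ℝ} (hν : 0 ≤ ν) (m : ℕ) :
    |besselCoeff ν m| ≤ (Real.Gamma (ν + 1))⁻¹ * (m.factorial : ℝ)⁻¹ := by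
  have h1 := Gamma_add_nat_pos hν m
  have h2 := Gamma_le_Gamma_add_nat hν m
  have h3 : 0 < Real.Gamma (ν + 1) := Real.Gamma_pos_of_pos (by positivity)
  have h4 : (0 : ℝ) < m.factorial := by positivity
  rw [besselCoeff, abs_div, abs_pow, abs_neg, abs_one, one_pow, abs_of_pos (by positivity),
    ← mul_inv, one_div]
  refine inv_anti₀ (by positivity) ?_
  rw [mul_comm]
  exact mul_le_mul_of_nonneg_left h2 h4.le

lemma summable_besselE {ν : ℝ} (hν : 0 ≤ ν) (z : ℝ) :
    Summable fun m : ℕ => besselCoeff ν m * z ^ m := by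
  refine Summable.of_norm_bounded ((Real.summable_pow_div_factorial |z|).mul_left
    (Real.Gamma (ν + 1))⁻¹) fun m => ?_
  rw [norm_mul, norm_pow, Real.norm_eq_abs, Real.norm_eq_abs]
  refine (mul_le_mul_of_nonneg_right (abs_besselCoeff_le hν m) (by positivity)).trans (le_of_eq ?_)
  ring

lemma besselCoeff_succ {ν : ℝ} (m : ℕ) :
    besselCoeff ν (m + 1) * (m + 1) = -besselCoeff (ν + 1) m := by
  have e : ((m + 1 : ℕ) : ℝ) + ν + 1 = m + (ν + 1) + 1 := by push_cast; ring
  have h : (m : ℝ) + 1 ≠ 0 := by positivity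
  rw [besselCoeff, besselCoeff, e, Nat.factorial_succ, pow_succ]
  push_cast
  field_simp

lemma hasDerivAt_besselE {ν : ℝ} (hν : 0 ≤ ν) (z : ℝ) :
    HasDerivAt (besselE ν) (-besselE (ν + 1) z) z := by
  set R := |z| + 1 with hR
  have hR0 : 0 ≤ R := by positivity
  have hu : Summable fun n : ℕ => (Real.Gamma (ν + 1))⁻¹
      * ((n.factorial : ℝ)⁻¹ * (n * R ^ (n - 1))) := by
    refine Summable.mul_left _ ((summable_nat_add_iff 1).1 ?_)
    refine (Real.summable_pow_div_factorial R).congr fun n => ?_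
    have : ((n : ℝ) + 1) ≠ 0 := by positivity
    rw [Nat.factorial_succ]
    push_cast
    field_simp
  have hz : z ∈ Metric.ball (0 : ℝ) R := by
    rw [mem_ball_zero_iff, Real.norm_eq_abs, hR]
    linarith
  have key := hasDerivAt_tsum_of_isPreconnected (g := fun n y => besselCoeff ν n * y ^ n)
    (g' := fun n y => besselCoeff ν n * (n * y ^ (n - 1))) hu Metric.isOpen_ball
    (convex_ball (0 : ℝ) R).isPreconnected
    (fun n y _ => (hasDerivAt_pow n y).const_mul _) (fun n y hy => by
      rw [mem_ball_zero_iff, Real.norm_eq_abs] at hy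
      rw [Real.norm_eq_abs, abs_mul, abs_mul, abs_pow, Nat.abs_cast,
        ← mul_assoc (Real.Gamma (ν + 1))⁻¹]
      refine mul_le_mul (abs_besselCoeff_le hν n) ?_ (by positivity) (by
        have := Real.Gamma_pos_of_pos (by positivity : 0 < ν + 1)
        positivity)
      exact mul_le_mul_of_nonneg_left (pow_le_pow_left₀ (abs_nonneg _) hy.le _)
        (Nat.cast_nonneg n)) hz (summable_besselE hν z) hz
  have e : ∑' n : ℕ, besselCoeff ν n * (n * z ^ (n - 1)) = -besselE (ν + 1) z := by
    have e1 : ∀ n : ℕ, besselCoeff ν (n + 1) * (((n + 1 : ℕ) : ℝ) * z ^ (n + 1 - 1))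
        = -(besselCoeff (ν + 1) n * z ^ n) := fun n => by
      rw [Nat.add_sub_cancel, ← neg_mul, ← besselCoeff_succ]
      push_cast
      ring
    have hs : Summable fun n : ℕ => besselCoeff ν n * ((n : ℝ) * z ^ (n - 1)) := by
      refine (summable_nat_add_iff 1).1 ?_
      simp_rw [e1]
      exact (summable_besselE (by linarith) z).neg
    rw [hs.tsum_eq_zero_add]
    simp_rw [e1]
    rw [tsum_neg, besselE]
    simp
  rw [e] at key
  exact key

/-- Bessel's differential equation `z E'' + (ν+1) E' + E = 0`, written as a recurrence. -/
lemma besselE_recurrence {ν : ℝ} (hν : 0 ≤ ν) (z : ℝ) :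
    z * besselE (ν + 1 + 1) z = (ν + 1) * besselE (ν + 1) z - besselE ν z := by
  have s0 := summable_besselE hν z
  have s1 := summable_besselE (by linarith : 0 ≤ ν + 1) z
  have s2 := summable_besselE (by linarith : 0 ≤ ν + 1 + 1) z
  have hG : ∀ m : ℕ, Real.Gamma (m + ν + 1 + 1) = (m + ν + 1) * Real.Gamma (m + ν + 1) :=
    fun m => Real.Gamma_add_one (by positivity)
  have c0 : (ν + 1) * besselCoeff (ν + 1) 0 = besselCoeff ν 0 := by
    have h1 := hG 0
    have h2 := Gamma_add_nat_pos hν 0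
    simp only [besselCoeff, Nat.factorial_zero, Nat.cast_zero, zero_add, pow_zero,
      Nat.cast_one, one_mul] at h1 h2 ⊢
    rw [h1]
    field_simp
  have c1 : ∀ m : ℕ, besselCoeff (ν + 1 + 1) m
      = (ν + 1) * besselCoeff (ν + 1) (m + 1) - besselCoeff ν (m + 1) := fun m => by
    have h1 := hG (m + 1)
    have h2 := Gamma_add_nat_pos hν (m + 1)
    have e1 : (m : ℝ) + (ν + 1 + 1) + 1 = ((m + 1 : ℕ) : ℝ) + ν + 1 + 1 := by push_cast; ring
    have e2 : ((m + 1 : ℕ) : ℝ) + (ν + 1) + 1 = ((m + 1 : ℕ) : ℝ) + ν + 1 + 1 := by ring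
    have h3 : ((m + 1 : ℕ) : ℝ) + ν + 1 ≠ 0 := by positivity
    rw [besselCoeff, besselCoeff, besselCoeff, e1, e2, h1, Nat.factorial_succ, pow_succ]
    push_cast at h3 h2 ⊢
    field_simp
    ring
  rw [besselE, besselE, besselE, s1.tsum_eq_zero_add, s0.tsum_eq_zero_add, ← tsum_mul_left,
    mul_add, ← tsum_mul_left]
  have t1 := ((summable_nat_add_iff 1).2 s1).mul_left (ν + 1)
  have t0 := (summable_nat_add_iff 1).2 s0
  have : ∑' m : ℕ, z * (besselCoeff (ν + 1 + 1) m * z ^ m)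
      = (∑' m : ℕ, (ν + 1) * (besselCoeff (ν + 1) (m + 1) * z ^ (m + 1)))
        - ∑' m : ℕ, besselCoeff ν (m + 1) * z ^ (m + 1) := by
    rw [← t1.tsum_sub t0]
    refine tsum_congr fun m => ?_
    rw [c1]
    ring
  rw [this, ← mul_assoc, c0]
  ring

lemma continuous_besselE {ν : ℝ} (hν : 0 ≤ ν) : Continuous (besselE ν) :=
  continuous_iff_continuousAt.2 fun z => (hasDerivAt_besselE hν z).continuousAt

lemma besselE_pos_of_nonpos {ν : ℝ} (hν : 0 ≤ ν) {z : ℝ} (hz : z ≤ 0) : 0 < besselE ν z := by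
  have h0 : 0 < besselCoeff ν 0 * z ^ 0 := by
    have := Gamma_add_nat_pos hν 0
    simp only [besselCoeff, pow_zero, Nat.factorial_zero, Nat.cast_one, one_mul, mul_one]
    positivity
  refine (summable_besselE hν z).tsum_pos (fun m => ?_) 0 h0
  have := Gamma_add_nat_pos hν m
  rw [besselCoeff, div_mul_eq_mul_div, ← mul_pow, neg_one_mul]
  have : 0 ≤ -z := by linarith
  positivity

lemma besselJ_eq {ν x : ℝ} (hx : 0 < x) :
    besselJ ν x = (x / 2) ^ ν * besselE ν (x ^ 2 / 4) := by
  rw [besselJ, besselE, ← tsum_mul_left]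
  refine tsum_congr fun m => ?_
  have hx2 : 0 < x / 2 := by positivity
  rw [Real.rpow_add hx2, show (2 * (m : ℝ)) = ((2 * m : ℕ) : ℝ) by push_cast; ring,
    Real.rpow_natCast, pow_mul, besselCoeff, show x ^ 2 / 4 = (x / 2) ^ 2 by ring]
  ring

lemma besselJ_eq_zero_iff {ν x : ℝ} (hx : 0 < x) :
    besselJ ν x = 0 ↔ besselE ν (x ^ 2 / 4) = 0 := by
  rw [besselJ_eq hx, mul_eq_zero, or_iff_right (Real.rpow_pos_of_pos (by positivity) ν).ne']

lemma deriv_besselJ_of_eq_zero {ν x : ℝ} (hν : 0 ≤ ν) (hx : 0 < x)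
    (h0 : besselE ν (x ^ 2 / 4) = 0) :
    deriv (besselJ ν) x = -((x / 2) ^ ν * (x / 2) * besselE (ν + 1) (x ^ 2 / 4)) := by
  have h1 : HasDerivAt (fun y : ℝ => y ^ 2 / 4) (x / 2) x := by
    refine ((hasDerivAt_pow 2 x).div_const 4).congr_deriv ?_
    push_cast
    ring
  have h2 := (hasDerivAt_besselE hν (x ^ 2 / 4)).comp x h1
  have h3 : HasDerivAt (fun y : ℝ => (y / 2) ^ ν) (1 / 2 * ν * (x / 2) ^ (ν - 1)) x :=
    ((hasDerivAt_id x).div_const 2).rpow_const (Or.inl (by simp only [id]; positivity))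
  have h4 := h3.mul h2
  have h5 : besselJ ν =ᶠ[𝓝 x] (fun y => (y / 2) ^ ν) * (besselE ν ∘ fun y => y ^ 2 / 4) := by
    filter_upwards [lt_mem_nhds hx] with y hy
    exact besselJ_eq hy
  rw [h5.deriv_eq, h4.deriv, Function.comp_apply, h0]
  ring

/-! ### Listing a discrete unbounded set of positive numbers -/

/-- An infinite set of positive numbers which is finite below any bound is listed increasingly by
the successive infima. -/
lemma strictMono_and_range_of_sInf {Z : Set ℝ} (hpos : ∀ z ∈ Z, 0 < z) (hinf : Z.Infinite)
    (hfin : ∀ R, (Z ∩ Iic R).Finite) (s : ℕ → ℝ) (h0 : s 0 = sInf Z)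
    (hs : ∀ k, s (k + 1) = sInf {x | s k < x ∧ x ∈ Z}) : StrictMono s ∧ range s = Z := by
  have hleast : ∀ a, IsLeast {x | a < x ∧ x ∈ Z} (sInf {x | a < x ∧ x ∈ Z}) := by
    intro a
    obtain ⟨R, hRZ, hR⟩ : ∃ R ∈ Z, a < R := by
      by_contra! hcon
      exact hinf ((hfin a).subset fun x hx => ⟨hx, hcon x hx⟩)
    have hf : ({x | a < x ∧ x ∈ Z} ∩ Iic R).Finite :=
      (hfin R).subset fun x hx => ⟨hx.1.2, hx.2⟩
    obtain ⟨m, hm, hmin⟩ := hf.exists_minimalFor id _ ⟨R, ⟨hR, hRZ⟩, le_refl R⟩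
    have hL : IsLeast {x | a < x ∧ x ∈ Z} m := by
      refine ⟨hm.1, fun x hx => ?_⟩
      rcases le_total x R with h | h
      · rcases le_total m x with h' | h'
        · exact h'
        · exact hmin ⟨hx, h⟩ h'
      · exact (show m ≤ R from hm.2).trans h
    rwa [hL.csInf_eq]
  have hZ0 : {x | (0 : ℝ) < x ∧ x ∈ Z} = Z := by
    ext x
    exact ⟨fun h => h.2, fun h => ⟨hpos x h, h⟩⟩
  have hL0 : IsLeast Z (s 0) := by
    have := hleast 0
    rw [hZ0] at this
    rwa [h0]
  have hL : ∀ k, IsLeast {x | s k < x ∧ x ∈ Z} (s (k + 1)) := fun k => by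
    rw [hs]
    exact hleast (s k)
  have hmono : StrictMono s := strictMono_nat_of_lt_succ fun k => (hL k).1.1
  have hmem : ∀ k, s k ∈ Z := by
    intro k
    cases k with
    | zero => exact hL0.1
    | succ k => exact (hL k).1.2
  refine ⟨hmono, Subset.antisymm (range_subset_iff.2 hmem) fun z hz => ?_⟩
  have hex : ∃ k, z ≤ s k := by
    by_contra! hcon
    refine (Set.infinite_range_of_injective hmono.injective) ((hfin z).subset ?_)
    rintro _ ⟨k, rfl⟩
    exact ⟨hmem k, (hcon k).le⟩
  classical
  have h1 := Nat.find_spec hex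
  have h2 : ∀ k < Nat.find hex, s k < z := fun k hk => not_le.1 (Nat.find_min hex hk)
  refine ⟨Nat.find hex, le_antisymm ?_ h1⟩
  rcases hk : Nat.find hex with _ | k
  · exact hL0.2 hz
  · exact (hL k).2 ⟨h2 k (by omega), hz⟩

/-! ### The regular solution of `𝒜 u = λ u` -/

/-- The solution `x^p E_ν(τ x^{2κ})` of `𝒜 u = 4κ²τ u`, regular at `0`. -/
def psi (α β μ τ : ℝ) (x : ℝ) : ℝ :=
  x ^ rp α β μ * besselE (nu α β μ) (τ * x ^ (2 * kappa α))

/-- The derivative of `psi`. -/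
def psiDeriv (α β μ τ : ℝ) (x : ℝ) : ℝ :=
  x ^ (rp α β μ - 1) * (rp α β μ * besselE (nu α β μ) (τ * x ^ (2 * kappa α))
    - 2 * kappa α * (τ * x ^ (2 * kappa α)) * besselE (nu α β μ + 1) (τ * x ^ (2 * kappa α)))

/-- The second derivative of `psi`, obtained from the differential equation. -/
def psiDeriv2 (α β μ τ : ℝ) (x : ℝ) : ℝ :=
  -(α + β) * x⁻¹ * psiDeriv α β μ τ x - (μ * x⁻¹ ^ 2 + 4 * kappa α ^ 2 * τ * x ^ (-α))
    * psi α β μ τ x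

namespace Subcritical

lemma nu_pos (h : Subcritical α β μ) : 0 < nu α β μ := div_pos h.sig_pos h.kappa_pos

lemma kappa_mul_nu (h : Subcritical α β μ) : kappa α * nu α β μ = sig α β μ :=
  mul_div_cancel₀ _ h.kappa_pos.ne'

lemma hasDerivAt_scaled (τ : ℝ) {x : ℝ} (hx : 0 < x) :
    HasDerivAt (fun x : ℝ => τ * x ^ (2 * kappa α))
      (2 * kappa α * (τ * x ^ (2 * kappa α)) / x) x := by
  refine ((Real.hasDerivAt_rpow_const (Or.inl hx.ne')).const_mul τ).congr_deriv ?_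
  rw [Real.rpow_sub hx, Real.rpow_one]
  ring

lemma hasDerivAt_besselE_scaled (τ : ℝ) {ν : ℝ} (hν : 0 ≤ ν) {x : ℝ} (hx : 0 < x) :
    HasDerivAt (fun x : ℝ => besselE ν (τ * x ^ (2 * kappa α)))
      (-(besselE (ν + 1) (τ * x ^ (2 * kappa α)) * (2 * kappa α * (τ * x ^ (2 * kappa α)) / x)))
      x := by
  refine ((hasDerivAt_besselE hν _).comp x (hasDerivAt_scaled τ hx)).congr_deriv ?_
  ring

lemma hasDerivAt_psi (h : Subcritical α β μ) (τ : ℝ) {x : ℝ} (hx : 0 < x) :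
    HasDerivAt (psi α β μ τ) (psiDeriv α β μ τ x) x := by
  refine ((Real.hasDerivAt_rpow_const (Or.inl hx.ne')).mul
    (hasDerivAt_besselE_scaled τ h.nu_pos.le hx)).congr_deriv ?_
  rw [psiDeriv, Real.rpow_sub hx, Real.rpow_one]
  field_simp
  ring

lemma hasDerivAt_psiDeriv (h : Subcritical α β μ) (τ : ℝ) {x : ℝ} (hx : 0 < x) :
    HasDerivAt (psiDeriv α β μ τ) (psiDeriv2 α β μ τ x) x := by
  have hν := h.nu_pos.le
  have hν1 : 0 ≤ nu α β μ + 1 := by linarith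
  have d0 := hasDerivAt_besselE_scaled (α := α) τ hν hx
  have d1 := hasDerivAt_besselE_scaled (α := α) τ hν1 hx
  have dz := hasDerivAt_scaled (α := α) τ hx
  have dx : HasDerivAt (fun x : ℝ => x ^ (rp α β μ - 1))
      ((rp α β μ - 1) * x ^ (rp α β μ - 1 - 1)) x := Real.hasDerivAt_rpow_const (Or.inl hx.ne')
  have D := dx.mul ((d0.const_mul (rp α β μ)).sub ((dz.const_mul (2 * kappa α)).mul d1))
  refine D.congr_deriv ?_
  have hrec := besselE_recurrence hν (τ * x ^ (2 * kappa α))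
  have hα : x ^ (-α) = x ^ (2 * kappa α) / x ^ 2 := by
    rw [show -α = 2 * kappa α - 2 by unfold kappa; ring, Real.rpow_sub hx, Real.rpow_two]
  have e1 : rp α β μ + rq α β μ = 1 - α - β := rp_add_rq
  have e2 : rp α β μ - rq α β μ = 2 * (kappa α * nu α β μ) := by
    rw [h.kappa_mul_nu]; exact rp_sub_rq
  have e3 : rp α β μ * rq α β μ = μ := h.rp_mul_rq
  have hab : -(α + β) = rp α β μ + rq α β μ - 1 := by linarith
  have hq : rq α β μ = rp α β μ - 2 * (kappa α * nu α β μ) := by linarith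
  rw [psiDeriv2, psiDeriv, psi, hα, hab]
  simp only [Real.rpow_sub hx, Real.rpow_one, Pi.mul_apply, Pi.sub_apply]
  rw [hq] at e3 ⊢
  generalize rp α β μ = p at *
  generalize nu α β μ = ν at *
  generalize kappa α = k at *
  generalize x ^ (2 * k) = X at *
  generalize x ^ p = P at *
  generalize besselE ν (τ * X) = E0 at *
  generalize besselE (ν + 1) (τ * X) = E1 at *
  generalize besselE (ν + 1 + 1) (τ * X) = E2 at *
  rw [← e3]
  field_simp
  linear_combination (4 * P * k ^ 2 * τ * X) * hrec

lemma continuousOn_psi (h : Subcritical α β μ) (τ : ℝ) : ContinuousOn (psi α β μ τ) (Ioi 0) :=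
  fun _ hx => (h.hasDerivAt_psi τ hx).continuousAt.continuousWithinAt

lemma continuousOn_psiDeriv (h : Subcritical α β μ) (τ : ℝ) :
    ContinuousOn (psiDeriv α β μ τ) (Ioi 0) :=
  fun _ hx => (h.hasDerivAt_psiDeriv τ hx).continuousAt.continuousWithinAt

lemma continuousOn_psiDeriv2 (h : Subcritical α β μ) (τ : ℝ) :
    ContinuousOn (psiDeriv2 α β μ τ) (Ioi 0) := by
  have hinv : ContinuousOn (fun x : ℝ => x⁻¹) (Ioi 0) :=
    continuousOn_inv₀.mono fun x hx => (show (0 : ℝ) < x from hx).ne'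
  have hpow : ContinuousOn (fun x : ℝ => x ^ (-α)) (Ioi 0) := fun x hx =>
    (Real.continuousAt_rpow_const x _ (Or.inl (show (0 : ℝ) < x from hx).ne')).continuousWithinAt
  exact ((continuousOn_const.mul hinv).mul (h.continuousOn_psiDeriv τ)).sub
    (((continuousOn_const.mul (hinv.pow 2)).add (continuousOn_const.mul hpow)).mul
      (h.continuousOn_psi τ))

lemma tendsto_besselE_scaled (h : Subcritical α β μ) (τ : ℝ) {ν : ℝ} (hν : 0 ≤ ν) :
    Tendsto (fun x : ℝ => besselE ν (τ * x ^ (2 * kappa α))) (𝓝[>] 0) (𝓝 (besselE ν 0)) := by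
  have h1 : Tendsto (fun x : ℝ => τ * x ^ (2 * kappa α)) (𝓝[>] 0) (𝓝 (τ * 0)) :=
    (tendsto_rpow_zero (by linarith [h.kappa_pos])).const_mul τ
  rw [mul_zero] at h1
  exact ((continuous_besselE hν).tendsto 0).comp h1

lemma eventually_psi_pos (h : Subcritical α β μ) (τ : ℝ) : ∀ᶠ x in 𝓝[>] 0, 0 < psi α β μ τ x := by
  have h1 := (h.tendsto_besselE_scaled τ h.nu_pos.le).eventually
    (lt_mem_nhds (besselE_pos_of_nonpos h.nu_pos.le le_rfl))
  filter_upwards [h1, self_mem_nhdsWithin] with x hx hx0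
  exact mul_pos (Real.rpow_pos_of_pos hx0 _) hx

lemma exists_bound_besselE_scaled (h : Subcritical α β μ) (τ : ℝ) {ν : ℝ} (hν : 0 ≤ ν) :
    ∃ C : ℝ, ∀ x ∈ Ioo (0 : ℝ) 1, |besselE ν (τ * x ^ (2 * kappa α))| ≤ C := by
  obtain ⟨C, hC⟩ := (isCompact_Icc (a := -|τ|) (b := |τ|)).exists_bound_of_continuousOn
    (continuous_besselE hν).continuousOn
  refine ⟨C, fun x hx => hC _ (abs_le.1 ?_)⟩
  rw [abs_mul, abs_of_nonneg (Real.rpow_nonneg hx.1.le _)]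
  exact mul_le_of_le_one_right (abs_nonneg _)
    (Real.rpow_le_one hx.1.le hx.2.le (by linarith [h.kappa_pos]))

lemma exists_abs_psi_le (h : Subcritical α β μ) (τ : ℝ) :
    ∃ C : ℝ, ∀ x ∈ Ioo (0 : ℝ) 1, |psi α β μ τ x| ≤ C * x ^ rp α β μ := by
  obtain ⟨C, hC⟩ := h.exists_bound_besselE_scaled τ h.nu_pos.le
  refine ⟨C, fun x hx => ?_⟩
  have hX := Real.rpow_nonneg hx.1.le (rp α β μ)
  rw [psi, abs_mul, abs_of_nonneg hX, mul_comm]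
  exact mul_le_mul_of_nonneg_right (hC x hx) hX

lemma exists_abs_psiDeriv_le (h : Subcritical α β μ) (τ : ℝ) :
    ∃ C : ℝ, ∀ x ∈ Ioo (0 : ℝ) 1, |psiDeriv α β μ τ x| ≤ C * x ^ (rp α β μ - 1) := by
  have hk := h.kappa_pos
  obtain ⟨C, hC⟩ := h.exists_bound_besselE_scaled τ h.nu_pos.le
  obtain ⟨C', hC'⟩ := h.exists_bound_besselE_scaled τ (by linarith [h.nu_pos] : 0 ≤ nu α β μ + 1)
  refine ⟨|rp α β μ| * C + 2 * kappa α * |τ| * C', fun x hx => ?_⟩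
  have hX := Real.rpow_nonneg hx.1.le (rp α β μ - 1)
  rw [psiDeriv, abs_mul, abs_of_nonneg hX, mul_comm]
  refine mul_le_mul_of_nonneg_right ?_ hX
  refine (abs_sub _ _).trans (add_le_add ?_ ?_)
  · rw [abs_mul]
    exact mul_le_mul_of_nonneg_left (hC x hx) (abs_nonneg _)
  · have hX1 : x ^ (2 * kappa α) ≤ 1 := Real.rpow_le_one hx.1.le hx.2.le (by linarith)
    have hX0 := Real.rpow_nonneg hx.1.le (2 * kappa α)
    rw [abs_mul, abs_mul, abs_mul, abs_mul, abs_of_pos hk, abs_of_pos (two_pos (α := ℝ)),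
      abs_of_nonneg hX0]
    refine mul_le_mul (mul_le_mul_of_nonneg_left ?_ (by positivity)) (hC' x hx) (abs_nonneg _)
      (by positivity)
    exact mul_le_of_le_one_right (abs_nonneg _) hX1

lemma isWeakDeriv_psi (h : Subcritical α β μ) (τ : ℝ) :
    IsWeakDeriv (psi α β μ τ) (psiDeriv α β μ τ) :=
  isWeakDeriv_of_hasDerivAt (fun _ hx => h.hasDerivAt_psi τ hx.1)
    ((h.continuousOn_psiDeriv τ).mono Ioo_subset_Ioi_self)

lemma isWeakDeriv_psiDeriv (h : Subcritical α β μ) (τ : ℝ) :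
    IsWeakDeriv (psiDeriv α β μ τ) (psiDeriv2 α β μ τ) :=
  isWeakDeriv_of_hasDerivAt (fun _ hx => h.hasDerivAt_psiDeriv τ hx.1)
    ((h.continuousOn_psiDeriv2 τ).mono Ioo_subset_Ioi_self)

lemma memHloc_psi (h : Subcritical α β μ) (τ : ℝ) : MemHloc 2 (psi α β μ τ) :=
  ⟨memL2loc_of_continuousOn ((h.continuousOn_psi τ).mono Ioo_subset_Ioi_self), _,
    h.isWeakDeriv_psi τ,
    memL2loc_of_continuousOn ((h.continuousOn_psiDeriv τ).mono Ioo_subset_Ioi_self), _,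
    h.isWeakDeriv_psiDeriv τ,
    memL2loc_of_continuousOn ((h.continuousOn_psiDeriv2 τ).mono Ioo_subset_Ioi_self)⟩

lemma exprA_psi (h : Subcritical α β μ) (τ : ℝ) :
    exprA α β μ (psi α β μ τ) =ᵐ[volume.restrict (Ioo 0 1)]
      (4 * kappa α ^ 2 * τ) • psi α β μ τ := by
  refine (exprA_ae_eq (h.isWeakDeriv_psi τ) (h.isWeakDeriv_psiDeriv τ)).trans ?_
  filter_upwards [ae_restrict_mem measurableSet_Ioo] with x hx
  have hx0 : x ≠ 0 := hx.1.ne'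
  have hX : x ^ α ≠ 0 := (Real.rpow_pos_of_pos hx.1 α).ne'
  simp only [Pi.add_apply, Pi.smul_apply, smul_eq_mul, psiDeriv2, Real.rpow_neg hx.1.le,
    Real.rpow_sub hx.1, Real.rpow_one, Real.rpow_two]
  field_simp
  ring

lemma memLp_psi (h : Subcritical α β μ) (τ : ℝ) : MemLp (psi α β μ τ) 2 (wMeasure β) := by
  obtain ⟨C, hC⟩ := h.exists_abs_psi_le τ
  refine memLp_w_of_le_rpow (aestronglyMeasurable_w_of_continuousOn
    ((h.continuousOn_psi τ).mono Ioo_subset_Ioi_self)) (C := C) (r := rp α β μ) ?_ hC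
  have := two_gam_add (α := α) (β := β)
  unfold rp
  linarith [h.kappa_pos, h.sig_pos]

lemma memH1_psi (h : Subcritical α β μ) (τ : ℝ) : MemH1 α β (psi α β μ τ) := by
  refine ⟨h.memLp_psi τ, (h.memHloc_psi τ).of_succ, ?_⟩
  have hm : MemLp (fun x => x ^ (α / 2) * psiDeriv α β μ τ x) 2 (wMeasure β) := by
    obtain ⟨C, hC⟩ := h.exists_abs_psiDeriv_le τ
    refine memLp_w_of_le_rpow (aestronglyMeasurable_w_of_continuousOn
      ((continuousOn_rpow_Ioo _).mul ((h.continuousOn_psiDeriv τ).mono Ioo_subset_Ioi_self)))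
      (C := C) (r := α / 2 + (rp α β μ - 1)) ?_ fun x hx => ?_
    · have := two_gam_add (α := α) (β := β)
      have hk : kappa α = (2 - α) / 2 := rfl
      unfold rp
      linarith [h.sig_pos]
    · have hX := Real.rpow_nonneg hx.1.le (α / 2)
      rw [abs_mul, abs_of_nonneg hX, Real.rpow_add hx.1]
      calc _ ≤ x ^ (α / 2) * (C * x ^ (rp α β μ - 1)) :=
            mul_le_mul_of_nonneg_left (hC x hx) hX
        _ = _ := by ring
  refine (memLp_congr_ae (ae_w_iff.2 ?_)).2 hm
  filter_upwards [(h.isWeakDeriv_psi τ).ae_eq_weakDeriv] with x hx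
  rw [hx]

lemma tendsto_psi_one (h : Subcritical α β μ) (τ : ℝ) :
    Tendsto (psi α β μ τ) (𝓝[<] 1) (𝓝 (besselE (nu α β μ) τ)) := by
  have := ((h.hasDerivAt_psi τ one_pos).continuousAt.tendsto).mono_left
    (nhdsWithin_le_nhds (s := Iio 1))
  simpa [psi] using this

lemma tendsto_psi_zero (h : Subcritical α β μ) (hαβ : α + β < 1) (τ : ℝ) :
    Tendsto (psi α β μ τ) (𝓝[>] 0) (𝓝 0) := by
  have hp : 0 < rp α β μ := by
    have := h.sig_pos
    unfold rp gam
    linarith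
  have := (tendsto_rpow_zero hp).mul (h.tendsto_besselE_scaled τ h.nu_pos.le)
  rwa [zero_mul] at this

lemma memH1N_psi (h : Subcritical α β μ) {τ : ℝ} (hτ : besselE (nu α β μ) τ = 0) :
    MemH1N α β (psi α β μ τ) :=
  ⟨h.memH1_psi τ, _, (h.continuousOn_psi τ).mono Ioo_subset_Ioi_self, .rfl,
    hτ ▸ h.tendsto_psi_one τ⟩

lemma memH1D_psi (h : Subcritical α β μ) (hαβ : α + β < 1) {τ : ℝ}
    (hτ : besselE (nu α β μ) τ = 0) : MemH1D α β (psi α β μ τ) :=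
  ⟨h.memH1_psi τ, ⟨_, (h.continuousOn_psi τ).mono Ioo_subset_Ioi_self, .rfl,
    h.tendsto_psi_zero hαβ τ⟩, (h.memH1N_psi hτ).2⟩

/-- If `E_ν(τ) = 0`, then `psi` is an eigenfunction of the Green operator. -/
lemma greenOp_psi (h : Subcritical α β μ) {τ : ℝ} (hτ : besselE (nu α β μ) τ = 0) :
    (4 * kappa α ^ 2 * τ) • h.greenOp ((h.memLp_psi τ).toLp _) = (h.memLp_psi τ).toLp _ := by
  -- Whichever boundary condition is the right one for the parameters, `psi` satisfies it.
  obtain ⟨V, hV, hψ⟩ : ∃ V : Submodule ℝ (L2w β), IsBoundedInverse (opA α β μ V) h.greenOp ∧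
      (h.memLp_psi τ).toLp _ ∈ V := by
    rcases lt_or_ge (α + β) 1 with hαβ | hαβ
    · exact ⟨_, h.isBoundedInverse_H1D hαβ, (toLp_mem_H1D_iff _).2 (h.memH1D_psi hαβ hτ)⟩
    · exact ⟨_, h.isBoundedInverse_H1N hαβ, (toLp_mem_H1N_iff _).2 (h.memH1N_psi hτ)⟩
  have hc := ae_w_iff.1 (h.memLp_psi τ).coeFn_toLp
  have hA := (ae_w_iff (β := β)).2 ((exprA_congr hc).trans (h.exprA_psi τ))
  have hm : (h.memLp_psi τ).toLp _ ∈ (opA α β μ V).domain :=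
    ⟨hψ, (h.memHloc_psi τ).congr hc.symm,
      (memLp_congr_ae hA).2 ((h.memLp_psi τ).const_smul _)⟩
  have e : opA α β μ V ⟨_, hm⟩ = (4 * kappa α ^ 2 * τ) • (h.memLp_psi τ).toLp _ := by
    refine Lp.ext ((ae_w_iff.2 (opA_coeFn ⟨_, hm⟩)).trans (hA.trans ?_))
    refine EventuallyEq.trans ?_ (Lp.coeFn_smul _ _).symm
    filter_upwards [(h.memLp_psi τ).coeFn_toLp] with x hx
    rw [Pi.smul_apply, Pi.smul_apply, hx]
  have := hV.left ⟨_, hm⟩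
  rw [e, map_smul] at this
  exact this

/-- The norm of `psi`, from the derivative of `(x v')² + (4κ²τx^{2κ} - σ²) v²` with
`v = x^{-γ} psi`. -/
lemma integral_psi_sq (h : Subcritical α β μ) {τ : ℝ} (hτ0 : 0 < τ)
    (hτ : besselE (nu α β μ) τ = 0) :
    ∫ x, psi α β μ τ x ^ 2 ∂(wMeasure β)
      = τ * besselE (nu α β μ + 1) τ ^ 2 / (2 * kappa α) := by
  have hk := h.kappa_pos
  have hs := h.sig_pos
  have hν := h.nu_pos.le
  have hν1 : 0 ≤ nu α β μ + 1 := by linarith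
  have hκν := h.kappa_mul_nu
  set N : ℝ → ℝ := fun x => x ^ (2 * sig α β μ)
    * ((sig α β μ * besselE (nu α β μ) (τ * x ^ (2 * kappa α))
        - 2 * kappa α * (τ * x ^ (2 * kappa α))
          * besselE (nu α β μ + 1) (τ * x ^ (2 * kappa α))) ^ 2
      + (4 * kappa α ^ 2 * (τ * x ^ (2 * kappa α)) - sig α β μ ^ 2)
        * besselE (nu α β μ) (τ * x ^ (2 * kappa α)) ^ 2) with hN
  have hcont : ContinuousOn N (Icc 0 1) := by
    have hr : ∀ a : ℝ, 0 < a → Continuous fun x : ℝ => x ^ a := fun a ha =>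
      Real.continuous_rpow_const ha.le
    have c1 := hr (2 * sig α β μ) (by positivity)
    have c2 : Continuous fun x : ℝ => τ * x ^ (2 * kappa α) :=
      continuous_const.mul (hr (2 * kappa α) (by positivity))
    have c3 := (continuous_besselE hν).comp c2
    have c4 := (continuous_besselE hν1).comp c2
    exact (c1.mul ((((continuous_const.mul c3).sub ((continuous_const.mul c2).mul c4)).pow 2).add
      (((continuous_const.mul c2).sub continuous_const).mul (c3.pow 2)))).continuousOn
  have hderiv : ∀ x ∈ Ioo (0 : ℝ) 1,
      HasDerivAt N (8 * kappa α ^ 3 * τ * (x ^ β * psi α β μ τ x ^ 2)) x := by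
    intro x hx
    have d0 := hasDerivAt_besselE_scaled (α := α) τ hν hx.1
    have d1 := hasDerivAt_besselE_scaled (α := α) τ hν1 hx.1
    have dz := hasDerivAt_scaled (α := α) τ hx.1
    have dx : HasDerivAt (fun x : ℝ => x ^ (2 * sig α β μ)) (2 * sig α β μ
        * x ^ (2 * sig α β μ - 1)) x := Real.hasDerivAt_rpow_const (Or.inl hx.1.ne')
    have D := dx.mul ((((d0.const_mul (sig α β μ)).sub
      ((dz.const_mul (2 * kappa α)).mul d1)).pow 2).add
      (((dz.const_mul (4 * kappa α ^ 2)).sub_const (sig α β μ ^ 2)).mul (d0.pow 2)))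
    refine D.congr_deriv ?_
    have hrec := besselE_recurrence hν (τ * x ^ (2 * kappa α))
    have hp : x ^ β * (x ^ rp α β μ) ^ 2 = x ^ (2 * sig α β μ) * x ^ (2 * kappa α) / x := by
      rw [rpow_mul_sq hx.1, ← Real.rpow_add hx.1, ← Real.rpow_sub_one hx.1.ne']
      congr 1
      have := two_gam_add (α := α) (β := β)
      unfold rp
      linarith
    have hx0 := hx.1.ne'
    rw [psi, mul_pow, ← mul_assoc (x ^ β), hp, Real.rpow_sub_one hx0]
    simp only [Pi.mul_apply, Pi.sub_apply, Pi.pow_apply, Nat.cast_ofNat, Nat.add_one_sub_one,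
      pow_one, Pi.add_apply]
    rw [← hκν]
    generalize nu α β μ = ν at *
    generalize kappa α = k at *
    generalize x ^ (2 * k) = X at *
    generalize x ^ (2 * (k * ν)) = S at *
    generalize besselE ν (τ * X) = E0 at *
    generalize besselE (ν + 1) (τ * X) = E1 at *
    generalize besselE (ν + 1 + 1) (τ * X) = E2 at *
    field_simp
    linear_combination (8 * S * τ * X * (ν * E0 - 2 * τ * X * E1)) * hrec
  have hint : IntervalIntegrable (fun x => 8 * kappa α ^ 3 * τ * (x ^ β * psi α β μ τ x ^ 2))
      volume 0 1 := by
    rw [intervalIntegrable_iff_integrableOn_Ioo_of_le zero_le_one]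
    exact ((memLp_two_w_iff (h.memLp_psi τ).1).1 (h.memLp_psi τ)).const_mul _
  have key := intervalIntegral.integral_eq_sub_of_hasDerivAt_of_le zero_le_one hcont hderiv hint
  rw [intervalIntegral.integral_const_mul, intervalIntegral.integral_of_le zero_le_one,
    integral_Ioc_eq_integral_Ioo] at key
  have h0 : N 0 = 0 := by
    simp only [hN]
    rw [Real.zero_rpow (by positivity), zero_mul]
  have h1 : N 1 = 4 * kappa α ^ 2 * τ ^ 2 * besselE (nu α β μ + 1) τ ^ 2 := by
    simp only [hN, Real.one_rpow, mul_one, hτ]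
    ring
  rw [h0, h1, sub_zero] at key
  rw [integral_w, eq_div_iff (by positivity)]
  have hne : 4 * kappa α ^ 2 * τ ≠ 0 := by positivity
  refine mul_left_cancel₀ hne ?_
  linear_combination key

lemma psi_toLp_ne_zero (h : Subcritical α β μ) (τ : ℝ) : (h.memLp_psi τ).toLp _ ≠ 0 := by
  intro h0
  have e : psi α β μ τ =ᵐ[volume.restrict (Ioo 0 1)] fun _ => (0 : ℝ) := by
    have := (h.memLp_psi τ).coeFn_toLp
    rw [h0] at this
    exact ae_w_iff.1 (this.symm.trans (Lp.coeFn_zero ℝ 2 (wMeasure β)))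
  have := Measure.eqOn_open_of_ae_eq e isOpen_Ioo
    ((h.continuousOn_psi τ).mono Ioo_subset_Ioi_self) continuousOn_const
  obtain ⟨x, hx, hx'⟩ := ((h.eventually_psi_pos τ).and Ioo_mem_nhdsGT_zero).exists
  exact hx.ne' (this hx')

/-- The positive zeros of `E_ν` are simple, for `E_ν' = -E_{ν+1}`: otherwise the norm of `psi` would
vanish. -/
lemma besselE_succ_ne_zero (h : Subcritical α β μ) {τ : ℝ} (hτ0 : 0 < τ)
    (hτ : besselE (nu α β μ) τ = 0) : besselE (nu α β μ + 1) τ ≠ 0 := by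
  intro h0
  have e := h.integral_psi_sq hτ0 hτ
  rw [h0] at e
  have e2 : ‖(h.memLp_psi τ).toLp _‖ ^ 2 = 0 := by
    rw [← real_inner_self_eq_norm_sq, inner_toLp_w]
    simp_rw [← pow_two]
    rw [e]
    simp
  exact h.psi_toLp_ne_zero τ (norm_eq_zero.1 (by simpa using e2))

end Subcritical

/-! ### Eigenfunctions of the Green operator -/

/-- A continuous function with a continuous weak derivative is differentiable. -/
lemma IsWeakDeriv.hasDerivAt (h : IsWeakDeriv f g) (hf : ContinuousOn f (Ioo 0 1))
    (hg : ContinuousOn g (Ioo 0 1)) {x : ℝ} (hx : x ∈ Ioo (0 : ℝ) 1) : HasDerivAt f (g x) x := by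
  have h2 : (1 / 2 : ℝ) ∈ Ioo (0 : ℝ) 1 := by norm_num
  have hd : ∀ y ∈ Ioo (0 : ℝ) 1, HasDerivAt (fun y => ∫ t in (1 / 2 : ℝ)..y, g t) (g y) y :=
    fun y hy => intervalIntegral.integral_hasDerivAt_right
      (LocallyIntegrableOn.intervalIntegrable_Ioo h.right h2 hy)
      (hg.stronglyMeasurableAtFilter isOpen_Ioo y hy) (hg.continuousAt (isOpen_Ioo.mem_nhds hy))
  have hw := isWeakDeriv_of_hasDerivAt hd hg
  have h0 := (h.add (hw.const_smul (-1))).congr (g' := 0) .rfl (.of_eq (by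
    ext y
    simp))
  obtain ⟨c, hc⟩ := h0.ae_eq_const
  have hcont : ContinuousOn (fun y => ∫ t in (1 / 2 : ℝ)..y, g t) (Ioo 0 1) :=
    fun y hy => (hd y hy).continuousAt.continuousWithinAt
  have heq := Measure.eqOn_open_of_ae_eq hc isOpen_Ioo
    (hf.add (hcont.const_smul (-1))) continuousOn_const
  refine ((hd x hx).add_const c).congr_of_eventuallyEq ?_
  filter_upwards [isOpen_Ioo.mem_nhds hx] with y hy
  have := heq hy
  simp only [Pi.add_apply, Pi.smul_apply, smul_eq_mul] at this
  linarith

/-- Uniqueness for a homogeneous linear second order equation with continuous coefficients. -/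
lemma eq_zero_of_linear_ode {D D' a b : ℝ → ℝ} {x₀ x₁ : ℝ}
    (h1 : ∀ x ∈ Icc x₀ x₁, HasDerivAt D (D' x) x)
    (h2 : ∀ x ∈ Icc x₀ x₁, HasDerivAt D' (a x * D' x + b x * D x) x)
    (ha : ContinuousOn a (Icc x₀ x₁)) (hb : ContinuousOn b (Icc x₀ x₁))
    (h0 : D x₀ = 0) (h0' : D' x₀ = 0) : ∀ x ∈ Icc x₀ x₁, D x = 0 := by
  obtain ⟨A, hA⟩ := isCompact_Icc.exists_bound_of_continuousOn ha
  obtain ⟨B, hB⟩ := isCompact_Icc.exists_bound_of_continuousOn hb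
  have hd : ∀ x ∈ Icc x₀ x₁, HasDerivAt (fun x => (D x, D' x))
      (D' x, a x * D' x + b x * D x) x := fun x hx => (h1 x hx).prodMk (h2 x hx)
  have key := eq_zero_of_abs_deriv_le_mul_abs_self_of_eq_zero_right (K := max 1 (A + B))
    (fun x hx => (hd x hx).continuousAt.continuousWithinAt)
    (fun x hx => (hd x (Ico_subset_Icc_self hx)).hasDerivWithinAt)
    (by rw [h0, h0']; rfl) (fun x hx => by
      have hx' := Ico_subset_Icc_self hx
      have n1 : |D x| ≤ ‖(D x, D' x)‖ := norm_fst_le (D x, D' x)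
      have n2 : |D' x| ≤ ‖(D x, D' x)‖ := norm_snd_le (D x, D' x)
      have hn := norm_nonneg (D x, D' x)
      have b1 : |a x| ≤ A := hA x hx'
      have b2 : |b x| ≤ B := hB x hx'
      rw [Prod.norm_def, max_le_iff]
      constructor
      · calc |D' x| ≤ 1 * ‖(D x, D' x)‖ := by linarith
          _ ≤ _ := mul_le_mul_of_nonneg_right (le_max_left _ _) hn
      · calc |a x * D' x + b x * D x| ≤ |a x| * |D' x| + |b x| * |D x| := by
              rw [← abs_mul, ← abs_mul]; exact abs_add_le _ _
          _ ≤ A * ‖(D x, D' x)‖ + B * ‖(D x, D' x)‖ :=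
              add_le_add (mul_le_mul b1 n2 (abs_nonneg _) ((abs_nonneg _).trans b1))
                (mul_le_mul b2 n1 (abs_nonneg _) ((abs_nonneg _).trans b2))
          _ = (A + B) * ‖(D x, D' x)‖ := by ring
          _ ≤ _ := mul_le_mul_of_nonneg_right (le_max_right _ _) hn)
  intro x hx
  exact congrArg Prod.fst (key x hx)

namespace Subcritical

lemma isWeakDeriv_greenDeriv' (h : Subcritical α β μ) (hf : MemLp f 2 (wMeasure β)) :
    IsWeakDeriv (greenDeriv α β μ f) fun x => -(α + β) * x⁻¹ * greenDeriv α β μ f x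
      - μ * x⁻¹ ^ 2 * green α β μ f x - x ^ (-α) * f x := by
  refine (h.isWeakDeriv_greenDeriv hf).congr .rfl ?_
  filter_upwards [h.exprA_green hf, exprA_ae_eq (α := α) (β := β) (μ := μ)
    (h.isWeakDeriv_green hf) (h.isWeakDeriv_greenDeriv hf), ae_restrict_mem measurableSet_Ioo]
    with x h1 h2 hx
  rw [h1] at h2
  have hx0 : x ≠ 0 := hx.1.ne'
  have hX : x ^ α ≠ 0 := (Real.rpow_pos_of_pos hx.1 α).ne'
  simp only [Pi.add_apply] at h2
  -- Solve `𝒜 u = f` for the second derivative.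
  set G2 := (rp α β μ * (rp α β μ - 1) * x ^ (rp α β μ - 2) * greenR α β μ f x
        + (rq α β μ * (rq α β μ - 1) * x ^ (rq α β μ - 2)
          - rp α β μ * (rp α β μ - 1) * x ^ (rp α β μ - 2)) * greenL α β μ f x)
        / (2 * sig α β μ) - x ^ (-α) * f x
  rw [Real.rpow_sub hx.1, Real.rpow_sub hx.1, Real.rpow_one, Real.rpow_two] at h2
  rw [Real.rpow_neg hx.1.le]
  clear_value G2
  rw [h2]
  field_simp
  ring

/-- An eigenfunction of the Green operator is a multiple of `psi`: both solve `𝒜 u = 4κ²τ u`, and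
the Green operator only produces the behaviour `O(x^{γ+ε})` at `0`, too small for the second
solution of order `x^{γ-σ}` in the Wronskian with `psi`. -/
lemma exists_eq_smul_psi (h : Subcritical α β μ) {f : ℝ → ℝ} (hf : MemLp f 2 (wMeasure β))
    {τ : ℝ} (hfix : ∀ x ∈ Ioo (0 : ℝ) 1, f x = 4 * kappa α ^ 2 * τ * green α β μ f x) :
    ∃ c : ℝ, ∀ x ∈ Ioo (0 : ℝ) 1, f x = c * psi α β μ τ x := by
  have hs := h.sig_pos
  have hε := h.eps_pos
  set lam := 4 * kappa α ^ 2 * τ with hlam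
  have cg := h.continuousOn_green hf
  have cd := h.continuousOn_greenDeriv hf
  have cf : ContinuousOn f (Ioo 0 1) := (continuousOn_const.mul cg).congr hfix
  have cinv : ContinuousOn (fun x : ℝ => x⁻¹) (Ioo 0 1) :=
    continuousOn_inv₀.mono fun x hx => hx.1.ne'
  have dg := fun x (hx : x ∈ Ioo (0 : ℝ) 1) => (h.isWeakDeriv_green hf).hasDerivAt cg cd hx
  have dd := fun x (hx : x ∈ Ioo (0 : ℝ) 1) => (h.isWeakDeriv_greenDeriv' hf).hasDerivAt cd
    ((((continuousOn_const.mul cinv).mul cd).sub ((continuousOn_const.mul (cinv.pow 2)).mul cg)).sub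
      ((continuousOn_rpow_Ioo _).mul cf)) hx
  set u : ℝ → ℝ := fun x => lam * green α β μ f x with hu
  set u' : ℝ → ℝ := fun x => lam * greenDeriv α β μ f x with hu'
  set a : ℝ → ℝ := fun x => -(α + β) * x⁻¹ with ha
  set b : ℝ → ℝ := fun x => -(μ * x⁻¹ ^ 2 + lam * x ^ (-α)) with hb
  have du : ∀ x ∈ Ioo (0 : ℝ) 1, HasDerivAt u (u' x) x := fun x hx => (dg x hx).const_mul lam
  have du' : ∀ x ∈ Ioo (0 : ℝ) 1, HasDerivAt u' (a x * u' x + b x * u x) x := fun x hx => by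
    refine ((dd x hx).const_mul lam).congr_deriv ?_
    rw [hfix x hx]
    simp only [hu, hu', ha, hb]
    ring
  have dψ : ∀ x ∈ Ioo (0 : ℝ) 1, HasDerivAt (psi α β μ τ) (psiDeriv α β μ τ x) x :=
    fun x hx => h.hasDerivAt_psi τ hx.1
  have dψ' : ∀ x ∈ Ioo (0 : ℝ) 1, HasDerivAt (psiDeriv α β μ τ)
      (a x * psiDeriv α β μ τ x + b x * psi α β μ τ x) x := fun x hx => by
    refine (h.hasDerivAt_psiDeriv τ hx.1).congr_deriv ?_
    simp only [psiDeriv2, ha, hb, hlam]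
    ring
  -- The weighted Wronskian is constant, and it vanishes at `0`.
  set W : ℝ → ℝ := fun x => x ^ (α + β) * (u' x * psi α β μ τ x - u x * psiDeriv α β μ τ x) with hW
  have dW : ∀ x ∈ Ioo (0 : ℝ) 1, HasDerivAt W 0 x := fun x hx => by
    have dx : HasDerivAt (fun x : ℝ => x ^ (α + β)) ((α + β) * x ^ (α + β - 1)) x :=
      Real.hasDerivAt_rpow_const (Or.inl hx.1.ne')
    have D := dx.mul (((du' x hx).mul (dψ x hx)).sub ((du x hx).mul (dψ' x hx)))
    refine D.congr_deriv ?_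
    have hx0 : x ≠ 0 := hx.1.ne'
    rw [Real.rpow_sub_one hx0]
    simp only [Pi.mul_apply, Pi.sub_apply, ha]
    field_simp
    ring
  have tW : Tendsto W (𝓝[>] 0) (𝓝 0) := by
    obtain ⟨C1, hC1⟩ := h.abs_greenDeriv_le hf
    obtain ⟨C2, hC2⟩ := h.exists_abs_psi_le τ
    obtain ⟨C3, hC3⟩ := h.exists_abs_psiDeriv_le τ
    set C4 := greenConst α β μ / sig α β μ * (eLpNorm f 2 (wMeasure β)).toReal
    have ht := (tendsto_rpow_zero (a := sig α β μ + eps α β μ) (by positivity)).const_mul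
      (|lam| * C1 * C2 + |lam| * C4 * C3)
    rw [mul_zero] at ht
    refine squeeze_zero_norm' ?_ ht
    filter_upwards [Ioo_mem_nhdsGT_zero] with x hx
    have p0 := Real.rpow_nonneg hx.1.le (α + β)
    have e1 : x ^ (α + β) * (x ^ (gam α β + eps α β μ - 1) * x ^ rp α β μ)
        = x ^ (sig α β μ + eps α β μ) := by
      rw [← Real.rpow_add hx.1, ← Real.rpow_add hx.1]
      congr 1
      unfold rp gam
      ring
    have e2 : x ^ (α + β) * (x ^ (gam α β + eps α β μ) * x ^ (rp α β μ - 1))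
        = x ^ (sig α β μ + eps α β μ) := by
      rw [← Real.rpow_add hx.1, ← Real.rpow_add hx.1]
      congr 1
      unfold rp gam
      ring
    have b1 := hC1 x hx
    have b2 := hC2 x hx
    have b3 := hC3 x hx
    have b4 : |green α β μ f x| ≤ C4 * x ^ (gam α β + eps α β μ) := h.abs_green_le hf hx
    simp only [hW, hu, hu']
    rw [Real.norm_eq_abs, abs_mul, abs_of_nonneg p0]
    calc x ^ (α + β) * |lam * greenDeriv α β μ f x * psi α β μ τ x
          - lam * green α β μ f x * psiDeriv α β μ τ x|
        ≤ x ^ (α + β) * (|lam| * (|greenDeriv α β μ f x| * |psi α β μ τ x|)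
          + |lam| * (|green α β μ f x| * |psiDeriv α β μ τ x|)) := by
          refine mul_le_mul_of_nonneg_left ((abs_sub _ _).trans (le_of_eq ?_)) p0
          simp only [abs_mul]
          ring
      _ ≤ x ^ (α + β) * (|lam| * ((C1 * x ^ (gam α β + eps α β μ - 1)) * (C2 * x ^ rp α β μ))
          + |lam| * ((C4 * x ^ (gam α β + eps α β μ)) * (C3 * x ^ (rp α β μ - 1)))) := by
          refine mul_le_mul_of_nonneg_left (add_le_add ?_ ?_) p0
          · exact mul_le_mul_of_nonneg_left (mul_le_mul b1 b2 (abs_nonneg _)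
              ((abs_nonneg _).trans b1)) (abs_nonneg _)
          · exact mul_le_mul_of_nonneg_left (mul_le_mul b4 b3 (abs_nonneg _)
              ((abs_nonneg _).trans b4)) (abs_nonneg _)
      _ = |lam| * C1 * C2 * (x ^ (α + β) * (x ^ (gam α β + eps α β μ - 1) * x ^ rp α β μ))
          + |lam| * C4 * C3
            * (x ^ (α + β) * (x ^ (gam α β + eps α β μ) * x ^ (rp α β μ - 1))) := by ring
      _ = _ := by rw [e1, e2]; ring
  have hW0 : ∀ x ∈ Ioo (0 : ℝ) 1, u' x * psi α β μ τ x - u x * psiDeriv α β μ τ x = 0 := by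
    obtain ⟨c, hc⟩ := isOpen_Ioo.exists_is_const_of_deriv_eq_zero
      (isPreconnected_Ioo (a := (0 : ℝ)) (b := 1))
      (fun x hx => (dW x hx).differentiableAt.differentiableWithinAt)
      (fun x hx => (dW x hx).deriv)
    have hc0 : c = 0 := by
      refine tendsto_nhds_unique (tendsto_const_nhds.congr' ?_) tW
      filter_upwards [Ioo_mem_nhdsGT_zero] with x hx using (hc x hx).symm
    intro x hx
    have := hc x hx
    rw [hc0] at this
    exact (mul_eq_zero.1 this).resolve_left (Real.rpow_pos_of_pos hx.1 _).ne'
  -- Hence `u` is a multiple of `psi` near `0`, where `psi` is positive.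
  obtain ⟨δ, hδ0, hδ⟩ := mem_nhdsGT_iff_exists_Ioo_subset.1
    (inter_mem (h.eventually_psi_pos τ) Ioo_mem_nhdsGT_zero)
  have hδ0 : (0 : ℝ) < δ := hδ0
  obtain ⟨c, hc⟩ := isOpen_Ioo.exists_is_const_of_deriv_eq_zero
    (isPreconnected_Ioo (a := (0 : ℝ)) (b := δ)) (f := fun x => u x / psi α β μ τ x)
    (fun x hx => (((du x (hδ hx).2).div (dψ x (hδ hx).2)
      (hδ hx).1.ne').differentiableAt).differentiableWithinAt)
    (fun x hx => by
      refine ((du x (hδ hx).2).div (dψ x (hδ hx).2) (hδ hx).1.ne').deriv.trans ?_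
      rw [hW0 x (hδ hx).2, zero_div]
      rfl)
  refine ⟨c, fun x hx => ?_⟩
  rw [hfix x hx]
  -- From a point `x₀` near `0` the equality is continued to `x` by uniqueness for the equation.
  set x₀ := min (δ / 2) x with hx₀
  have hx₀δ : x₀ ∈ Ioo 0 δ :=
    ⟨lt_min (by positivity) hx.1, (min_le_left _ _).trans_lt (by linarith)⟩
  have hsub : Icc x₀ x ⊆ Ioo 0 1 := fun y hy => ⟨hx₀δ.1.trans_le hy.1, hy.2.trans_lt hx.2⟩
  have hz : ∀ y ∈ Ioo 0 δ, u y = c * psi α β μ τ y := fun y hy =>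
    (div_eq_iff (hδ hy).1.ne').1 (hc y hy)
  have hz' : u' x₀ = c * psiDeriv α β μ τ x₀ := by
    have e : u =ᶠ[𝓝 x₀] fun y => c * psi α β μ τ y := by
      filter_upwards [isOpen_Ioo.mem_nhds hx₀δ] with y hy using hz y hy
    exact ((du x₀ (hδ hx₀δ).2).congr_of_eventuallyEq e.symm).unique
      ((dψ x₀ (hδ hx₀δ).2).const_mul c)
  have key := eq_zero_of_linear_ode (D := fun y => u y - c * psi α β μ τ y)
    (D' := fun y => u' y - c * psiDeriv α β μ τ y) (a := a) (b := b) (x₀ := x₀) (x₁ := x)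
    (fun y hy => (du y (hsub hy)).sub ((dψ y (hsub hy)).const_mul c))
    (fun y hy => ((du' y (hsub hy)).sub ((dψ' y (hsub hy)).const_mul c)).congr_deriv (by ring))
    ((continuousOn_const.mul cinv).mono hsub)
    ((((continuousOn_const.mul (cinv.pow 2)).add
      (continuousOn_const.mul (continuousOn_rpow_Ioo _))).neg).mono hsub)
    (by simp only [hz x₀ hx₀δ, sub_self]) (by simp only [hz', sub_self]) x
    ⟨min_le_right _ _, le_rfl⟩
  exact sub_eq_zero.1 key

lemma pos_of_besselE_eq_zero (h : Subcritical α β μ) {τ : ℝ}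
    (hτ : besselE (nu α β μ) τ = 0) : 0 < τ := by
  by_contra hcon
  exact (besselE_pos_of_nonpos h.nu_pos.le (not_lt.1 hcon)).ne' hτ

/-- The eigenspaces of the Green operator are spanned by functions `psi` with `E_ν(τ) = 0`. -/
lemma eigenvector_mem_span (h : Subcritical α β μ) {η : ℝ} (hη : η ≠ 0) {u : L2w β} (hu : u ≠ 0)
    (he : h.greenOp u = η • u) :
    ∃ τ, besselE (nu α β μ) τ = 0 ∧ ∃ c : ℝ, u = c • (h.memLp_psi τ).toLp _ := by
  have hk := h.kappa_pos
  set τ := η⁻¹ / (4 * kappa α ^ 2) with hτ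
  have hlam : 4 * kappa α ^ 2 * τ = η⁻¹ := by
    rw [hτ]
    field_simp
  set f : ℝ → ℝ := fun x => 4 * kappa α ^ 2 * τ * green α β μ u x with hf
  have hfu : f =ᵐ[wMeasure β] u := by
    have h1 := h.greenOp_coeFn u
    rw [he] at h1
    filter_upwards [h1, Lp.coeFn_smul η u] with x hx hx'
    rw [hx'] at hx
    simp only [hf, hlam, ← hx, Pi.smul_apply, smul_eq_mul]
    field_simp
  have hfm : MemLp f 2 (wMeasure β) := (Lp.memLp u).ae_eq hfu.symm
  obtain ⟨c, hc⟩ := h.exists_eq_smul_psi hfm (τ := τ) (fun x _ => by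
    rw [green_congr hfu])
  have huc : u = c • (h.memLp_psi τ).toLp _ := by
    refine Lp.ext (hfu.symm.trans ?_)
    filter_upwards [ae_w_mem, Lp.coeFn_smul c ((h.memLp_psi τ).toLp _),
      (h.memLp_psi τ).coeFn_toLp] with x hx h1 h2
    rw [h1, Pi.smul_apply, h2, hc x hx, smul_eq_mul]
  refine ⟨τ, ?_, c, huc⟩
  have hc0 : c ≠ 0 := by
    rintro rfl
    exact hu (by rw [huc, zero_smul])
  have t1 := (h.tendsto_psi_one τ).const_mul c
  have t2 := (h.tendsto_green_one (Lp.memLp u)).const_mul (4 * kappa α ^ 2 * τ)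
  rw [mul_zero] at t2
  have := tendsto_nhds_unique (t2.congr' (by
    filter_upwards [Ioo_mem_nhdsLT_one] with x hx using hc x hx)) t1
  exact (mul_eq_zero.1 this.symm).resolve_left hc0

lemma greenOp_injective (h : Subcritical α β μ) : Function.Injective h.greenOp := by
  rcases lt_or_ge (α + β) 1 with hαβ | hαβ
  · exact (h.isBoundedInverse_H1D hαβ).injective
  · exact (h.isBoundedInverse_H1N hαβ).injective

/-- The functions `psi` with `E_ν(τ) = 0` are complete in `L²_β(0,1)`. -/
lemma span_psi_orthogonal (h : Subcritical α β μ) {S : Submodule ℝ (L2w β)}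
    (hS : ∀ τ, besselE (nu α β μ) τ = 0 → (h.memLp_psi τ).toLp _ ∈ S) : Sᗮ = ⊥ := by
  have key := ContinuousLinearMap.orthogonalComplement_iSup_eigenspaces_eq_bot
    h.isCompactOperator_greenOp h.isSymmetric_greenOp
  rw [eq_bot_iff, ← key]
  refine Submodule.orthogonal_le (iSup_le fun η u hu => ?_)
  rw [Module.End.mem_eigenspace_iff] at hu
  have hu' : h.greenOp u = η • u := hu
  by_cases hu0 : u = 0
  · rw [hu0]
    exact S.zero_mem
  have hη : η ≠ 0 := by
    rintro rfl
    rw [zero_smul] at hu'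
    exact hu0 (h.greenOp_injective (by rw [hu', map_zero]))
  obtain ⟨τ, hτ, c, rfl⟩ := h.eigenvector_mem_span hη hu0 hu'
  exact S.smul_mem c (hS τ hτ)

/-- In finite dimension the injective Green operator would be surjective, but the functions in its
range vanish at `1`. -/
lemma not_finiteDimensional (h : Subcritical α β μ) : ¬ FiniteDimensional ℝ (L2w β) := by
  intro hfd
  have hsurj : Function.Surjective (h.greenOp : L2w β →ₗ[ℝ] L2w β) :=
    LinearMap.injective_iff_surjective.1 h.greenOp_injective
  have hm := memLp_rpow_w_iff.2 h.gam_add_eps_integrable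
  obtain ⟨g, hg⟩ := hsurj (hm.toLp _)
  have e : green α β μ g =ᵐ[volume.restrict (Ioo 0 1)] fun x => x ^ (gam α β + eps α β μ) := by
    refine ae_w_iff.1 ((h.greenOp_coeFn g).symm.trans ?_)
    have hg' : h.greenOp g = hm.toLp _ := hg
    rw [hg']
    exact hm.coeFn_toLp
  have e' := Measure.eqOn_open_of_ae_eq e isOpen_Ioo (h.continuousOn_green (Lp.memLp g))
    (continuousOn_rpow_Ioo _)
  have t1 : Tendsto (fun x : ℝ => x ^ (gam α β + eps α β μ)) (𝓝[<] 1)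
      (𝓝 (1 ^ (gam α β + eps α β μ))) :=
    (Real.continuousAt_rpow_const 1 _ (Or.inl one_ne_zero)).mono_left nhdsWithin_le_nhds
  have t2 := (h.tendsto_green_one (Lp.memLp g)).congr' (by
    filter_upwards [Ioo_mem_nhdsLT_one] with x hx using e' hx)
  rw [Real.one_rpow] at t1
  exact one_ne_zero (tendsto_nhds_unique t1 t2)

end Subcritical

/-! ### Zeros of the Bessel function and the orthonormal basis -/

namespace Subcritical

lemma kappa_sq_mul {j : ℝ} : 4 * kappa α ^ 2 * (j ^ 2 / 4) = kappa α ^ 2 * j ^ 2 := by ring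

/-- Below any bound, `J_ν` has finitely many positive zeros, because they are simple and do not
accumulate at `0`. -/
lemma finite_zeros (h : Subcritical α β μ) (R : ℝ) :
    ({x | 0 < x ∧ besselJ (nu α β μ) x = 0} ∩ Iic R).Finite := by
  have hν := h.nu_pos.le
  have hcont : Continuous fun x : ℝ => besselE (nu α β μ) (x ^ 2 / 4) :=
    (continuous_besselE hν).comp (by fun_prop)
  by_contra hinf
  obtain ⟨a, ha, hacc⟩ := Set.Infinite.exists_accPt_of_subset_isCompact hinf
    (isCompact_Icc (a := (0 : ℝ)) (b := R)) fun x hx => ⟨hx.1.1.le, hx.2⟩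
  rw [accPt_iff_frequently_nhdsNE] at hacc
  have hfr : ∃ᶠ x in 𝓝[≠] a, besselE (nu α β μ) (x ^ 2 / 4) = 0 :=
    hacc.mono fun x hx => (besselJ_eq_zero_iff hx.1.1).1 hx.1.2
  have h0 : besselE (nu α β μ) (a ^ 2 / 4) = 0 := by
    by_contra hne
    exact hfr (((hcont.tendsto a).eventually_ne hne).filter_mono nhdsWithin_le_nhds)
  have ha0 : 0 < a := by
    refine lt_of_le_of_ne ha.1 fun h' => ?_
    rw [← h'] at h0
    exact (besselE_pos_of_nonpos hν (by norm_num)).ne' h0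
  have hd : HasDerivAt (fun x : ℝ => besselE (nu α β μ) (x ^ 2 / 4))
      (-besselE (nu α β μ + 1) (a ^ 2 / 4) * (2 * a / 4)) a := by
    have h1 : HasDerivAt (fun x : ℝ => x ^ 2 / 4) (2 * a / 4) a := by
      simpa using (hasDerivAt_pow 2 a).div_const 4
    have h2 := (hasDerivAt_besselE hν (a ^ 2 / 4)).comp a h1
    exact h2
  have hne : -besselE (nu α β μ + 1) (a ^ 2 / 4) * (2 * a / 4) ≠ 0 :=
    mul_ne_zero (neg_ne_zero.2 (h.besselE_succ_ne_zero (by positivity) h0)) (by positivity)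
  exact hfr (hd.eventually_ne hne)

/-- The spectral theorem for the Green operator forces `J_ν` to have infinitely many zeros. -/
lemma infinite_zeros (h : Subcritical α β μ) :
    {x | 0 < x ∧ besselJ (nu α β μ) x = 0}.Infinite := by
  intro hfin
  have hfin' : {τ | besselE (nu α β μ) τ = 0}.Finite := by
    refine (hfin.image fun x => x ^ 2 / 4).subset fun τ hτ => ?_
    have hτ0 := h.pos_of_besselE_eq_zero hτ
    have e : (2 * √τ) ^ 2 / 4 = τ := by
      rw [mul_pow, Real.sq_sqrt hτ0.le]
      ring
    have hpos : 0 < 2 * √τ := by positivity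
    exact ⟨2 * √τ, ⟨hpos, (besselJ_eq_zero_iff hpos).2 (by rw [e]; exact hτ)⟩, e⟩
  set S : Submodule ℝ (L2w β) :=
    Submodule.span ℝ ((fun τ => (h.memLp_psi τ).toLp _) '' {τ | besselE (nu α β μ) τ = 0}) with hS
  have hSf : FiniteDimensional ℝ S := FiniteDimensional.span_of_finite ℝ (hfin'.image _)
  have hbot : Sᗮ = ⊥ := h.span_psi_orthogonal fun τ hτ =>
    Submodule.subset_span (mem_image_of_mem _ hτ)
  have htop : S = ⊤ := Submodule.orthogonal_eq_bot_iff.1 hbot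
  rw [htop] at hSf
  exact h.not_finiteDimensional (Module.Finite.equiv (Submodule.topEquiv (R := ℝ) (M := L2w β)))

lemma strictMono_besselZero_and_range (h : Subcritical α β μ) :
    StrictMono (besselZero (nu α β μ)) ∧
      range (besselZero (nu α β μ)) = {x | 0 < x ∧ besselJ (nu α β μ) x = 0} := by
  refine strictMono_and_range_of_sInf (fun _ hz => hz.1) h.infinite_zeros h.finite_zeros _ rfl ?_
  -- Above a zero the condition of positivity in the definition of the zero set is automatic.
  have hnonneg : ∀ k, 0 ≤ besselZero (nu α β μ) k := by
    intro k
    induction k with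
    | zero => exact Real.sInf_nonneg fun x hx => hx.1.le
    | succ k ih => exact Real.sInf_nonneg fun x hx => ih.trans hx.1.le
  intro k
  rw [besselZero]
  congr 1
  ext x
  exact ⟨fun hx => ⟨hx.1, (hnonneg k).trans_lt hx.1, hx.2⟩, fun hx => ⟨hx.1, hx.2.2⟩⟩

lemma besselZero_pos (h : Subcritical α β μ) (k : ℕ) : 0 < besselZero (nu α β μ) k := by
  have : besselZero (nu α β μ) k ∈ range (besselZero (nu α β μ)) := mem_range_self k
  rw [h.strictMono_besselZero_and_range.2] at this
  exact this.1

lemma besselE_besselZero (h : Subcritical α β μ) (k : ℕ) :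
    besselE (nu α β μ) (besselZero (nu α β μ) k ^ 2 / 4) = 0 := by
  have : besselZero (nu α β μ) k ∈ range (besselZero (nu α β μ)) := mem_range_self k
  rw [h.strictMono_besselZero_and_range.2] at this
  exact (besselJ_eq_zero_iff this.1).1 this.2

/-- The factor between `Phi` and `psi`. -/
def phiConst (α β μ : ℝ) (k : ℕ) : ℝ :=
  (2 * kappa α) ^ (1 / 2 : ℝ) / |deriv (besselJ (nu α β μ)) (besselZero (nu α β μ) k)|
    * (besselZero (nu α β μ) k / 2) ^ nu α β μ

lemma Phi_eq (h : Subcritical α β μ) (k : ℕ) {x : ℝ} (hx : 0 < x) :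
    Phi α β μ k x = phiConst α β μ k * psi α β μ (besselZero (nu α β μ) k ^ 2 / 4) x := by
  have hj := h.besselZero_pos k
  have hX := Real.rpow_pos_of_pos hx (kappa α)
  have e1 : (besselZero (nu α β μ) k * x ^ kappa α) ^ 2 / 4
      = besselZero (nu α β μ) k ^ 2 / 4 * x ^ (2 * kappa α) := by
    rw [two_mul, Real.rpow_add hx]
    ring
  have e2 : (besselZero (nu α β μ) k * x ^ kappa α / 2) ^ nu α β μ
      = (besselZero (nu α β μ) k / 2) ^ nu α β μ * x ^ sig α β μ := by
    rw [mul_div_right_comm, Real.mul_rpow (by positivity) hX.le, ← Real.rpow_mul hx.le,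
      h.kappa_mul_nu]
  have e3 : x ^ rp α β μ = x ^ ((1 - α - β) / 2) * x ^ sig α β μ := by
    rw [← Real.rpow_add hx]
    rfl
  rw [Phi, besselJ_eq (by positivity), e1, e2, psi, e3, phiConst]
  ring

lemma phiConst_sq (h : Subcritical α β μ) (k : ℕ) : phiConst α β μ k ^ 2
    * ∫ x, psi α β μ (besselZero (nu α β μ) k ^ 2 / 4) x ^ 2 ∂(wMeasure β) = 1 := by
  have hj := h.besselZero_pos k
  have hE := h.besselE_besselZero k
  have hE1 := h.besselE_succ_ne_zero (by positivity) hE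
  have hk := h.kappa_pos
  have hr : ((2 * kappa α) ^ (1 / 2 : ℝ)) ^ 2 = 2 * kappa α := by
    rw [← Real.sqrt_eq_rpow, Real.sq_sqrt (by positivity)]
  have hJ := Real.rpow_pos_of_pos (half_pos hj) (nu α β μ)
  rw [h.integral_psi_sq (by positivity) hE, phiConst, mul_pow, div_pow, sq_abs, hr,
    deriv_besselJ_of_eq_zero h.nu_pos.le hj hE]
  field_simp
  norm_num

/-- The normalized eigenfunctions as elements of `L²_β(0,1)`. -/
def phiLp (h : Subcritical α β μ) (k : ℕ) : L2w β :=
  phiConst α β μ k • (h.memLp_psi (besselZero (nu α β μ) k ^ 2 / 4)).toLp _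

lemma phiLp_coeFn (h : Subcritical α β μ) (k : ℕ) : h.phiLp k =ᵐ[wMeasure β] Phi α β μ k := by
  filter_upwards [ae_w_mem, Lp.coeFn_smul (phiConst α β μ k)
    ((h.memLp_psi (besselZero (nu α β μ) k ^ 2 / 4)).toLp _),
    (h.memLp_psi (besselZero (nu α β μ) k ^ 2 / 4)).coeFn_toLp] with x hx h1 h2
  rw [phiLp, h1, Pi.smul_apply, h2, smul_eq_mul, h.Phi_eq k hx.1]

lemma greenOp_phiLp (h : Subcritical α β μ) (k : ℕ) :
    (kappa α ^ 2 * besselZero (nu α β μ) k ^ 2) • h.greenOp (h.phiLp k) = h.phiLp k := by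
  have := h.greenOp_psi (h.besselE_besselZero k)
  rw [kappa_sq_mul] at this
  rw [phiLp, map_smul, smul_comm, this]

lemma orthonormal_phiLp (h : Subcritical α β μ) : Orthonormal ℝ h.phiLp := by
  have hk := h.kappa_pos
  constructor
  · intro k
    have e : ‖h.phiLp k‖ ^ 2 = 1 := by
      rw [phiLp, norm_smul, mul_pow, ← real_inner_self_eq_norm_sq ((h.memLp_psi _).toLp _),
        inner_toLp_w, Real.norm_eq_abs, sq_abs]
      simp_rw [← pow_two]
      exact h.phiConst_sq k
    exact (pow_eq_one_iff_of_nonneg (norm_nonneg (h.phiLp k)) two_ne_zero).1 e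
  · intro i j hij
    have hz : besselZero (nu α β μ) i ^ 2 ≠ besselZero (nu α β μ) j ^ 2 := by
      intro heq
      refine hij (h.strictMono_besselZero_and_range.1.injective ?_)
      exact (pow_left_inj₀ (h.besselZero_pos i).le (h.besselZero_pos j).le two_ne_zero).1 heq
    have hs : inner ℝ (h.greenOp (h.phiLp i)) (h.phiLp j)
        = inner ℝ (h.phiLp i) (h.greenOp (h.phiLp j)) := h.isSymmetric_greenOp _ _
    have e1 : inner ℝ (h.phiLp i) (h.phiLp j) = kappa α ^ 2 * besselZero (nu α β μ) i ^ 2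
        * inner ℝ (h.greenOp (h.phiLp i)) (h.phiLp j) := by
      conv_lhs => rw [← h.greenOp_phiLp i]
      rw [real_inner_smul_left]
    have e2 : inner ℝ (h.phiLp i) (h.phiLp j) = kappa α ^ 2 * besselZero (nu α β μ) j ^ 2
        * inner ℝ (h.greenOp (h.phiLp i)) (h.phiLp j) := by
      rw [hs]
      conv_lhs => rw [← h.greenOp_phiLp j]
      rw [real_inner_smul_right]
    have e3 : kappa α ^ 2 * (besselZero (nu α β μ) i ^ 2 - besselZero (nu α β μ) j ^ 2)
        * inner ℝ (h.greenOp (h.phiLp i)) (h.phiLp j) = 0 := by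
      linear_combination e2 - e1
    have e4 := (mul_eq_zero.1 e3).resolve_left
      (mul_ne_zero (by positivity) (sub_ne_zero.2 hz))
    change inner ℝ (h.phiLp i) (h.phiLp j) = 0
    rw [e1, e4, mul_zero]

lemma span_phiLp_orthogonal (h : Subcritical α β μ) :
    (Submodule.span ℝ (range h.phiLp))ᗮ = ⊥ := by
  refine h.span_psi_orthogonal fun τ hτ => ?_
  have hτ0 := h.pos_of_besselE_eq_zero hτ
  have e : (2 * √τ) ^ 2 / 4 = τ := by
    rw [mul_pow, Real.sq_sqrt hτ0.le]
    ring
  have hpos : 0 < 2 * √τ := by positivity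
  have hmem : 2 * √τ ∈ range (besselZero (nu α β μ)) := by
    rw [h.strictMono_besselZero_and_range.2]
    exact ⟨hpos, (besselJ_eq_zero_iff hpos).2 (by rw [e]; exact hτ)⟩
  obtain ⟨k, hk⟩ := hmem
  rw [← hk] at e
  subst e
  have hc : phiConst α β μ k ≠ 0 := by
    intro h0
    have := h.phiConst_sq k
    rw [h0] at this
    norm_num at this
  have : (h.memLp_psi (besselZero (nu α β μ) k ^ 2 / 4)).toLp _
      = (phiConst α β μ k)⁻¹ • h.phiLp k := by
    rw [phiLp, smul_smul, inv_mul_cancel₀ hc, one_smul]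
  rw [this]
  exact Submodule.smul_mem _ _ (Submodule.subset_span (mem_range_self k))

/-- The properties of `𝒜²` which hold for any realization of `𝒜` inverted by the Green operator. -/
lemma spectral_properties (h : Subcritical α β μ) {A : L2w β →ₗ.[ℝ] L2w β}
    (hA : IsBoundedInverse A h.greenOp) :
    Dense ((opSq A).domain : Set (L2w β)) ∧ IsSelfAdjoint (-opSq A) ∧
      (∀ u : (-opSq A).domain, u ≠ 0 → inner ℝ ((-opSq A) u) (u : L2w β) < 0) ∧
      ∃ b : HilbertBasis ℕ ℝ (L2w β), ∀ k : ℕ, b k =ᵐ[wMeasure β] Phi α β μ k ∧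
        ∃ hb : b k ∈ (opSq A).domain,
          opSq A ⟨b k, hb⟩ = (kappa α ^ 4 * besselZero (nu α β μ) k ^ 4) • b k := by
  have hsym : ((h.greenOp * h.greenOp : L2w β →L[ℝ] L2w β) : L2w β →ₗ[ℝ] L2w β).IsSymmetric := by
    intro u v
    exact (h.isSymmetric_greenOp (h.greenOp u) v).trans (h.isSymmetric_greenOp u (h.greenOp v))
  refine ⟨hA.opSq.dense hsym, hA.opSq.isSelfAdjoint_neg hsym,
    hA.inner_neg_opSq_lt_zero h.isSymmetric_greenOp,
    HilbertBasis.mkOfOrthogonalEqBot h.orthonormal_phiLp h.span_phiLp_orthogonal, fun k => ?_⟩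
  rw [HilbertBasis.coe_mkOfOrthogonalEqBot]
  refine ⟨h.phiLp_coeFn k, ?_⟩
  have e : h.phiLp k = (h.greenOp * h.greenOp)
      ((kappa α ^ 4 * besselZero (nu α β μ) k ^ 4) • h.phiLp k) := by
    change _ = h.greenOp (h.greenOp _)
    have e0 := h.greenOp_phiLp k
    rw [← map_smul] at e0
    set lam := kappa α ^ 2 * besselZero (nu α β μ) k ^ 2 with hlam
    have : kappa α ^ 4 * besselZero (nu α β μ) k ^ 4 = lam * lam := by rw [hlam]; ring
    rw [this, mul_smul, map_smul h.greenOp lam (lam • h.phiLp k), e0, e0]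
  have hr := hA.opSq.right ((kappa α ^ 4 * besselZero (nu α β μ) k ^ 4) • h.phiLp k)
  have key : ∀ (v : L2w β) (hv : v ∈ (opSq A).domain), h.phiLp k = v → ∀ w, opSq A ⟨v, hv⟩ = w →
      ∃ hb : h.phiLp k ∈ (opSq A).domain, opSq A ⟨h.phiLp k, hb⟩ = w := by
    rintro v hv rfl w hw
    exact ⟨hv, hw⟩
  exact key _ _ e _ hr

end Subcritical

end DegenerateBessel

end

open DegenerateBessel in
theorem proposition2p1 (α β μ : ℝ) (hα₀ : 0 ≤ α) (hα₂ : α < 2) (hμ : μ < muCrit (α + β)) :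
    -- `besselZero ν` is the increasing enumeration of the positive zeros of `J_ν`
    (StrictMono (besselZero (nu α β μ)) ∧
      range (besselZero (nu α β μ)) = {x | 0 < x ∧ besselJ (nu α β μ) x = 0}) ∧
    (α + β < 1 →
      -- the second description of the domain
      (∀ u : L2w β, u ∈ (A2D α β μ).domain ↔
        MemH1D α β u ∧ MemHloc 4 u ∧
          HasBoundaryValue (exprA α β μ u) (𝓝[>] 0) 0 ∧
          HasBoundaryValue (weakDeriv fun x => x ^ (α + β) * weakDeriv u x) (𝓝[<] 1) 0 ∧
          MemLp (exprA α β μ u) 2 (wMeasure β) ∧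
          MemLp (fun x => x ^ (α / 2) * weakDeriv (exprA α β μ u) x) 2 (wMeasure β) ∧
          MemLp (exprA2 α β μ u) 2 (wMeasure β)) ∧
      -- on its domain the operator acts by the fourth order expression
      (∀ u : (A2D α β μ).domain, A2D α β μ u =ᵐ[wMeasure β] exprA2 α β μ (u : L2w β)) ∧
      -- densely defined, self-adjoint, negative
      Dense ((A2D α β μ).domain : Set (L2w β)) ∧
      IsSelfAdjoint (-A2D α β μ) ∧
      (∀ u : (-A2D α β μ).domain, u ≠ 0 → inner ℝ ((-A2D α β μ) u) (u : L2w β) < 0) ∧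
      -- orthonormal basis of eigenfunctions
      ∃ b : HilbertBasis ℕ ℝ (L2w β), ∀ k : ℕ,
        b k =ᵐ[wMeasure β] Phi α β μ k ∧
        ∃ h : b k ∈ (A2D α β μ).domain,
          A2D α β μ ⟨b k, h⟩ = (kappa α ^ 4 * besselZero (nu α β μ) k ^ 4) • b k) ∧
    (1 < α + β →
      -- the second description of the domain
      (∀ u : L2w β, u ∈ (A2N α β μ).domain ↔
        MemH1N α β u ∧ MemHloc 4 u ∧ MemH1N α β (exprA α β μ u) ∧
          MemLp (exprA α β μ u) 2 (wMeasure β) ∧ MemLp (exprA2 α β μ u) 2 (wMeasure β)) ∧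
      -- on its domain the operator acts by the fourth order expression
      (∀ u : (A2N α β μ).domain, A2N α β μ u =ᵐ[wMeasure β] exprA2 α β μ (u : L2w β)) ∧
      -- densely defined, self-adjoint, negative
      Dense ((A2N α β μ).domain : Set (L2w β)) ∧
      IsSelfAdjoint (-A2N α β μ) ∧
      (∀ u : (-A2N α β μ).domain, u ≠ 0 → inner ℝ ((-A2N α β μ) u) (u : L2w β) < 0) ∧
      -- orthonormal basis of eigenfunctions
      ∃ b : HilbertBasis ℕ ℝ (L2w β), ∀ k : ℕ,
        b k =ᵐ[wMeasure β] Phi α β μ k ∧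
        ∃ h : b k ∈ (A2N α β μ).domain,
          A2N α β μ ⟨b k, h⟩ = (kappa α ^ 4 * besselZero (nu α β μ) k ^ 4) • b k) := by
  have h : Subcritical α β μ := ⟨hα₂, hμ⟩
  refine ⟨h.strictMono_besselZero_and_range, fun hαβ => ?_, fun hαβ => ?_⟩
  · exact ⟨mem_A2D_domain_iff, opSq_opA_coeFn,
      h.spectral_properties (h.isBoundedInverse_H1D hαβ)⟩
  · exact ⟨mem_A2N_domain_iff, opSq_opA_coeFn,
      h.spectral_properties (h.isBoundedInverse_H1N hαβ.le)⟩
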